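/- Let $K$ be a non-archimedean local field, $L/K$ a finite Galois extension with group $\mathcal G$, and $\mathfrak A$ a quaternion division algebra over $K$ (a central division algebra of dimension $4$) that splits over $L$. For a field $K\subseteq E\subseteq L$ let $\mathcal O_E$ be its ring of integers, $\mathfrak A_E=E\otimes_K\mathfrak A\subseteq\mathfrak A_L$, and let $\mathcal T_E$ be the Bruhat–Tits tree of $E$: its vertices are the maximal $\mathcal O_E$-orders of $\mathbb M_2(E)$, two of them being neighbors when in some basis they are $\left(\begin{smallmatrix}\mathcal O_E&\mathcal O_E\\ \mathcal O_E&\mathcal O_E\end{smallmatrix}\right)$ and $\left(\begin{smallmatrix}\mathcal O_E&\pi_E\mathcal O_E\\ \pi_E^{-1}\mathcal O_E&\mathcal O_E\end{smallmatrix}\right)$, with $\pi_E$ a uniformizer. A graph is identified with the topological space obtained by gluing a copy of $[0,1]$ for every edge. Fix an isomorphism of $L$-algebras $f:\mathfrak A_L\to\mathbb M_2(L)$, and put ${}^\tau\! f=\tau\circ f\circ\tau^{-1}$ and $a_\tau=f\circ({}^\tau\! f)^{-1}$ for $\tau\in\mathcal G$. Let $\widehat{\mathcal T}$ be the twisted form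 of $\mathcal T_L$ attached to $\mathfrak A$, i.e. $\mathcal T_L$ with the $\mathcal G$-action $\tau*x=a_\tau(\tau(x))$. For a field $K\subseteq E\subseteq L$ splitting $\mathfrak A$, let $\widehat{\mathcal T}_E\subseteq\widehat{\mathcal T}$ be the minimal subtree containing every visual limit (equivalence class of rays) that is invariant under $\mathrm{Gal}(L/E)$ for the action $*$. Let $\mathfrak H$ be an $\mathcal O_K$-order in $\mathfrak A$, and let $\mathfrak H_E\subseteq\mathfrak A_E$ be the $\mathcal O_E$-order it generates. Then: (1) For every intermediate field $E$ splitting $\mathfrak A$ the minimal subtree $\widehat{\mathcal T}_E$ exists, and $\widehat{\mathcal T}_E\subseteq\widehat{\mathcal T}_{E'}$ whenever $E\subseteq E'\subseteq L$. For every isomorphism of $E$-algebras $g:\mathfrak A_E\to\mathbb M_2(E)$ there is a homeomorphism $h$ from $\mathcal T_E$ onto the subspace $\widehat{\mathcal T}_E$ of $\widehat{\mathcal T}$ that sends the vertex $g(\mathfrak D)$ to the vertex $f(\mathcal O_L\mathfrak D)$ of $\widehat{\mathcal T}$, for every maximal order $\mathfrak D$ of $\mathfrak A_E$. With the graph structure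 that $\widehat{\mathcal T}_E$ receives through $h$, the embedding into $\widehat{\mathcal T}$ of its subdivision $\widehat{\mathcal T}_E(e(L/E))$, in which every edge is replaced by a path with $e(L/E)$ edges ($e(L/E)$ the ramification index), is simplicial. (2) Let $\mathcal S\subseteq\widehat{\mathcal T}$ be the largest subgraph whose vertices are the maximal orders of $\mathbb M_2(L)$ containing $f(\mathfrak H_L)$; it does not depend on $E$. Then $\mathcal S$ is a subtree of $\widehat{\mathcal T}$, and for every intermediate field $E$ splitting $\mathfrak A$, the map $\mathfrak D\mapsto f(\mathcal O_L\mathfrak D)$ is a bijection from the set of maximal orders of $\mathfrak A_E$ containing $\mathfrak H_E$ onto the set of vertices of $\widehat{\mathcal T}_E$ lying inside $\mathcal S$. Moreover, $\mathcal S\cap\widehat{\mathcal T}_E$ is a subgraph of $\widehat{\mathcal T}_E$. -/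

import Mathlib

open scoped ValuativeRel TensorProduct

universe u v w w'

noncomputable section

namespace TwistedTree

/-! ### Combinatorial graphs and their topological spaces -/

section Graphs

variable {V : Type u} {V' : Type v}

/-- The gluing relation: a copy of `[0,1]` is attached to every oriented edge `d`, its point `0`
is glued to the origin of `d`, and the copies belonging to the two orientations of an edge
are identified through `t ↦ 1 - t` (so the point `1` is glued to the endpoint of `d`). -/
inductive GlueRel (G : SimpleGraph V) : V ⊕ (G.Dart × unitInterval) → V ⊕ (G.Dart × unitInterval) → Prop
  | origin (d : G.Dart) : GlueRel G (Sum.inr (d, 0)) (Sum.inl d.fst)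
  | flip (d : G.Dart) (t : unitInterval) :
      GlueRel G (Sum.inr (d, t)) (Sum.inr (d.symm, unitInterval.symm t))

/-- The topological space underlying a combinatorial graph. -/
def Space (G : SimpleGraph V) : Type u := Quot (GlueRel G)

/-- A vertex, as a point of the space. -/
def pt (G : SimpleGraph V) (x : V) : Space G := Quot.mk _ (Sum.inl x)

/-- The point of parameter `t` on the oriented edge `d`. -/
def edgePt (G : SimpleGraph V) (d : G.Dart) (t : unitInterval) : Space G := Quot.mk _ (Sum.inr (d, t))

/-- The quotient topology of the discrete union of the vertices and of the copies of `[0,1]`: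
the finest topology for which all the maps `[0,1] → Space G` given by the edges are continuous. -/
instance (G : SimpleGraph V) : TopologicalSpace (Space G) :=
  ⨆ d : G.Dart, TopologicalSpace.coinduced (edgePt G d) inferInstance

/-- The subspace of `Space G` corresponding to a subgraph of `G`. -/
def subspaceOf {G : SimpleGraph V} (S : G.Subgraph) : Set (Space G) :=
  {x | (∃ a ∈ S.verts, x = pt G a) ∨
    ∃ (d : G.Dart) (t : unitInterval), S.Adj d.fst d.snd ∧ x = edgePt G d t}

/-- The number `(k + t) / n`, as a point of `[0,1]` (for `0 ≤ k + t ≤ n`). -/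
def frac (n k : ℕ) (t : ℝ) : unitInterval := Set.projIcc 0 1 zero_le_one ((k + t) / n)

/-- The vertices of the `n`-th subdivision of `G`: the vertices of `G` and the points that cut
the edges of `G` into `n` equal pieces. -/
def SubdivisionVertex (G : SimpleGraph V) (n : ℕ) : Type u :=
  {x : Space G // (∃ a, x = pt G a) ∨ ∃ (d : G.Dart) (k : ℕ), k ≤ n ∧ x = edgePt G d (frac n k 0)}

/-- The `n`-th subdivision of `G`: every edge is replaced by a path of length `n`. -/
def subdivision (G : SimpleGraph V) (n : ℕ) : SimpleGraph (SubdivisionVertex G n) :=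
  SimpleGraph.fromRel fun x y => ∃ (d : G.Dart) (k : ℕ), k < n ∧
    x.1 = edgePt G d (frac n k 0) ∧ y.1 = edgePt G d (frac n (k + 1) 0)

/-- A map `h : Space G → Space G'` is simplicial on the `n`-th subdivision of `G` (whose space is
identified with that of `G`): it is induced by a morphism of combinatorial graphs from the
subdivision to `G'`, i.e. it agrees with that morphism on the vertices and maps every
edge of the subdivision affinely onto its image. -/
def IsSimplicialOnSubdivision (G : SimpleGraph V) (G' : SimpleGraph V') (n : ℕ)
    (h : Space G → Space G') : Prop :=
  ∃ φ : subdivision G n →g G',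
    (∀ x : SubdivisionVertex G n, h x.1 = pt G' (φ x)) ∧
    ∀ (d : G.Dart) (k : ℕ), k < n → ∀ δ : (subdivision G n).Dart,
      δ.fst.1 = edgePt G d (frac n k 0) → δ.snd.1 = edgePt G d (frac n (k + 1) 0) →
      ∀ t : unitInterval, h (edgePt G d (frac n k t)) = edgePt G' (φ.mapDart δ) t

/-- A ray, given by the sequence of its vertices. -/
def IsRay (G : SimpleGraph V) (r : ℕ → V) : Prop :=
  Function.Injective r ∧ ∀ n, G.Adj (r n) (r (n + 1))

/-- Two rays are equivalent (have the same visual limit) if they share a tail. -/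
def SameLimit (r s : ℕ → V) : Prop := ∃ m n : ℕ, ∀ k, r (m + k) = s (n + k)

/-- The subgraph `S` contains the visual limit of the ray `r`, i.e. a ray equivalent to `r`. -/
def ContainsLimit {G : SimpleGraph V} (S : G.Subgraph) (r : ℕ → V) : Prop :=
  ∃ s : ℕ → V, IsRay G s ∧ SameLimit s r ∧ ∀ n, S.Adj (s n) (s (n + 1))

end Graphs

/-! ### Rings of integers and orders -/

section Orders

variable (K : Type u) [Field K] [ValuativeRel K]

/-- The ring of integers of an extension `F` of the local field `K`: the elements that are
integral over the valuation ring of `K`. -/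
abbrev ringOfInt (F : Type v) [Field F] [Algebra K F] : Subalgebra 𝒪[K] F :=
  integralClosure 𝒪[K] F

/-- The maximal ideal of the (local) ring of integers, as the intersection of all its
maximal ideals. -/
def maxIdeal (F : Type v) [Field F] [Algebra K F] : Ideal (ringOfInt K F) :=
  (⊥ : Ideal (ringOfInt K F)).jacobson

/-- The ramification index `e(L/E)`: the largest `n` such that the maximal ideal of the ring of
integers of `E` is contained in the `n`-th power of that of `L`. -/
def ramIdx (E : Type v) (L : Type w) [Field E] [Algebra K E] [Field L] [Algebra K L]
    [Algebra E L] : ℕ :=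
  sSup {n : ℕ | ∀ x ∈ maxIdeal K E, ∀ y : ringOfInt K L,
    (y : L) = algebraMap E L (x : E) → y ∈ maxIdeal K L ^ n}

/-- An order in an `F`-algebra `B`: a subring that is a lattice, i.e. a finitely generated
module over the ring of integers of `F` that spans `B` over `F`. -/
def IsOrder (F : Type v) [Field F] [Algebra K F] {B : Type w} [Ring B] [Algebra F B]
    (Λ : Subring B) : Prop :=
  (∃ s : Finset B, (Λ : Set B) = Submodule.span (ringOfInt K F) (s : Set B)) ∧
    Submodule.span F (Λ : Set B) = ⊤

/-- The maximal orders of an `F`-algebra `B`. -/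
def MaximalOrder (F : Type v) [Field F] [Algebra K F] (B : Type w) [Ring B] [Algebra F B] :
    Type w :=
  {Λ : Subring B // Maximal (IsOrder K F) Λ}

variable {K}

lemma isOrder_map {F : Type v} [Field F] [Algebra K F] {B : Type w} {B' : Type w'} [Ring B] [Algebra F B]
    [Ring B'] [Algebra F B'] (σ : F ≃ₐ[K] F) (φ : B ≃+* B')
    (h : ∀ (c : F) (x : B), φ (c • x) = σ c • φ x) {Λ : Subring B} (hΛ : IsOrder K F Λ) :
    IsOrder K F (Λ.map (φ : B →+* B')) := by
  classical
  have hint : ∀ (τ : F ≃ₐ[K] F) (c : ringOfInt K F), IsIntegral 𝒪[K] (τ (c : F)) := fun τ c =>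
    IsIntegral.map (τ.toAlgHom.restrictScalars 𝒪[K]) c.2
  have hspan : ∀ s : Set B, φ '' (Submodule.span (ringOfInt K F) s : Set B) =
      Submodule.span (ringOfInt K F) (φ '' s) := by
    intro s
    apply Set.Subset.antisymm
    · rintro _ ⟨x, hx, rfl⟩
      induction hx using Submodule.span_induction with
      | mem x hx => exact Submodule.subset_span ⟨x, hx, rfl⟩
      | zero => simp
      | add x y _ _ hx hy => rw [map_add]; exact add_mem hx hy
      | smul c x _ hx =>
        have : φ (c • x) = (⟨σ c, hint σ c⟩ : ringOfInt K F) • φ x := h c x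
        rw [this]
        exact Submodule.smul_mem _ _ hx
    · intro y hy
      induction hy using Submodule.span_induction with
      | mem x hx => obtain ⟨a, ha, rfl⟩ := hx; exact ⟨a, Submodule.subset_span ha, rfl⟩
      | zero => exact ⟨0, zero_mem _, map_zero _⟩
      | add x y _ _ hx hy =>
        obtain ⟨a, ha, rfl⟩ := hx
        obtain ⟨b, hb, rfl⟩ := hy
        exact ⟨a + b, add_mem ha hb, map_add _ _ _⟩
      | smul c x _ hx =>
        obtain ⟨a, ha, rfl⟩ := hx
        refine ⟨(⟨σ.symm c, hint σ.symm c⟩ : ringOfInt K F) • a, Submodule.smul_mem _ _ ha, ?_⟩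
        have : φ ((⟨σ.symm c, hint σ.symm c⟩ : ringOfInt K F) • a) = σ (σ.symm c) • φ a :=
          h (σ.symm c) a
        rw [this, AlgEquiv.apply_symm_apply]
        rfl
  obtain ⟨⟨s, hs⟩, ht⟩ := hΛ
  refine ⟨⟨s.image φ, ?_⟩, ?_⟩
  · rw [Finset.coe_image, ← hspan, ← hs]
    rfl
  · rw [eq_top_iff]
    intro y _
    obtain ⟨x, rfl⟩ := φ.surjective y
    have hx : x ∈ Submodule.span F (Λ : Set B) := ht ▸ Submodule.mem_top
    induction hx using Submodule.span_induction with
    | mem x hx => exact Submodule.subset_span ⟨x, hx, rfl⟩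
    | zero => simp
    | add x y _ _ hx hy => rw [map_add]; exact add_mem (hx trivial) (hy trivial)
    | smul c x _ hx => rw [h]; exact Submodule.smul_mem _ _ (hx trivial)

/-- The image of a maximal order under a semilinear isomorphism of algebras. -/
def MaximalOrder.map {F : Type v} [Field F] [Algebra K F] {B : Type w} {B' : Type w'} [Ring B] [Algebra F B]
    [Ring B'] [Algebra F B'] (σ : F ≃ₐ[K] F) (φ : B ≃+* B')
    (h : ∀ (c : F) (x : B), φ (c • x) = σ c • φ x) (Λ : MaximalOrder K F B) :
    MaximalOrder K F B' :=
  ⟨Λ.1.map (φ : B →+* B'), isOrder_map σ φ h Λ.2.1, by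
    intro Λ' hΛ' hle
    have h' : ∀ (c : F) (y : B'), φ.symm (c • y) = σ.symm c • φ.symm y := by
      intro c y
      apply φ.injective
      rw [h]
      simp
    have hmax := Λ.2.2 (isOrder_map σ.symm φ.symm h' hΛ') (fun x hx =>
      ⟨φ x, hle ⟨x, hx, rfl⟩, φ.symm_apply_apply x⟩)
    intro y hy
    exact ⟨φ.symm y, hmax ⟨y, hy, rfl⟩, φ.apply_symm_apply y⟩⟩

/-- The image of a maximal order under an isomorphism of `F`-algebras. -/
def MaximalOrder.mapAlg {F : Type v} [Field F] [Algebra K F] {B : Type w} {B' : Type w'} [Ring B]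
    [Algebra F B] [Ring B'] [Algebra F B'] (g : B ≃ₐ[F] B') (Λ : MaximalOrder K F B) :
    MaximalOrder K F B' :=
  Λ.map AlgEquiv.refl g.toRingEquiv (fun c x => map_smul g c x)

end Orders

/-! ### The Bruhat–Tits tree -/

section Tree

variable (K : Type u) [Field K] [ValuativeRel K] (F : Type v) [Field F] [Algebra K F]

/-- The vertices of the Bruhat–Tits tree of `F`: the maximal orders in `M₂(F)`. -/
abbrev Vertex : Type v := MaximalOrder K F (Matrix (Fin 2) (Fin 2) F)

/-- The order of all matrices `(a, b; c, d)` with `a, d ∈ 𝒪`, `b ∈ ϖ ^ r 𝒪`, `c ∈ ϖ ^ (-r) 𝒪`,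
where `𝒪` is the ring of integers of `F`. -/
def stdOrder (ϖ : F) (r : ℤ) : Set (Matrix (Fin 2) (Fin 2) F) :=
  {N | N 0 0 ∈ ringOfInt K F ∧ ϖ ^ (-r) * N 0 1 ∈ ringOfInt K F ∧
    ϖ ^ r * N 1 0 ∈ ringOfInt K F ∧ N 1 1 ∈ ringOfInt K F}

/-- The Bruhat–Tits tree of `F`: two maximal orders are neighbors if, in some basis, they are
`stdOrder 0` and `stdOrder 1`. -/
def bruhatTits : SimpleGraph (Vertex K F) :=
  SimpleGraph.fromRel fun Λ Λ' => ∃ (g : GL (Fin 2) F) (ϖ : ringOfInt K F), Irreducible ϖ ∧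
    ∀ M : Matrix (Fin 2) (Fin 2) F,
      (M ∈ Λ.1 ↔ (g⁻¹).1 * M * g.1 ∈ stdOrder K F ϖ 0) ∧
      (M ∈ Λ'.1 ↔ (g⁻¹).1 * M * g.1 ∈ stdOrder K F ϖ 1)

/-- The branch of a set `X` of matrices: the largest subgraph whose vertices are maximal orders
containing `X`. -/
def branch (X : Set (Matrix (Fin 2) (Fin 2) F)) : (bruhatTits K F).Subgraph :=
  (⊤ : (bruhatTits K F).Subgraph).induce {Λ | X ⊆ Λ.1}

end Tree

/-! ### The twisted form defined by a quaternion algebra -/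

section Twisted

variable {K : Type u} [Field K] {L : Type v} [Field L] [Algebra K L]
  {A : Type w} [Ring A] [Algebra K A]

/-- The standard Galois action on matrices, entry by entry. -/
def galMatrix (τ : L ≃ₐ[K] L) : Matrix (Fin 2) (Fin 2) L ≃ₐ[K] Matrix (Fin 2) (Fin 2) L :=
  τ.mapMatrix

/-- The Galois action on `A_L = L ⊗ A`, through the first factor. -/
def galAlgebra (A : Type w) [Ring A] [Algebra K A] (τ : L ≃ₐ[K] L) : L ⊗[K] A ≃ₐ[K] L ⊗[K] A :=
  Algebra.TensorProduct.congr τ AlgEquiv.refl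

lemma galMatrix_smul (τ : L ≃ₐ[K] L) (c : L) (M : Matrix (Fin 2) (Fin 2) L) :
    galMatrix τ (c • M) = τ c • galMatrix τ M := by
  ext i j
  simp [galMatrix]

lemma galAlgebra_smul (τ : L ≃ₐ[K] L) (c : L) (x : L ⊗[K] A) :
    galAlgebra A τ (c • x) = τ c • galAlgebra A τ x := by
  induction x using TensorProduct.induction_on with
  | zero => simp
  | tmul a b => simp [galAlgebra, TensorProduct.smul_tmul']
  | add x y hx hy => rw [smul_add, map_add, map_add, smul_add, hx, hy]

variable [ValuativeRel K]

/-- The standard Galois action on the vertices of the Bruhat–Tits tree of `L`. -/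
def galVertex (τ : L ≃ₐ[K] L) (x : Vertex K L) : Vertex K L :=
  x.map τ (galMatrix τ).toRingEquiv (galMatrix_smul τ)

/-- The Galois action on trivializations: `(τf)(q) = τ (f (τ⁻¹ q))`. -/
def galTriv (f : L ⊗[K] A ≃ₐ[L] Matrix (Fin 2) (Fin 2) L) (τ : L ≃ₐ[K] L) :
    L ⊗[K] A ≃ₐ[L] Matrix (Fin 2) (Fin 2) L :=
  AlgEquiv.ofLinearEquiv
    { toFun := fun q => galMatrix τ (f (galAlgebra A τ.symm q))
      map_add' := fun x y => by simp
      map_smul' := fun c x => by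
        rw [galAlgebra_smul, map_smul, galMatrix_smul]
        simp
      invFun := fun M => (galAlgebra A τ.symm).symm (f.symm ((galMatrix τ).symm M))
      left_inv := fun x => by simp
      right_inv := fun x => by simp }
    (by simp) (by simp)

/-- The cocycle `a_τ = f ∘ (τf)⁻¹` with values in the automorphisms of the `L`-algebra `M₂(L)`. -/
def cocycle (f : L ⊗[K] A ≃ₐ[L] Matrix (Fin 2) (Fin 2) L) (τ : L ≃ₐ[K] L) :
    Matrix (Fin 2) (Fin 2) L ≃ₐ[L] Matrix (Fin 2) (Fin 2) L :=
  (galTriv f τ).symm.trans f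

/-- The Galois action `τ * x = a_τ (τ x)` of the twisted form of the Bruhat–Tits tree of `L`
defined by `A`, on vertices. -/
def twistedAct (f : L ⊗[K] A ≃ₐ[L] Matrix (Fin 2) (Fin 2) L) (τ : L ≃ₐ[K] L)
    (x : Vertex K L) : Vertex K L :=
  (galVertex τ x).mapAlg (cocycle f τ)

/-- The visual limit of the ray `r` is invariant under `Gal(L/E)` in the twisted form. -/
def InvariantLimit (f : L ⊗[K] A ≃ₐ[L] Matrix (Fin 2) (Fin 2) L) (E : IntermediateField K L)
    (r : ℕ → Vertex K L) : Prop :=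
  ∀ τ ∈ E.fixingSubgroup, SameLimit (fun n => twistedAct f τ (r n)) r

/-- The subtrees of the twisted form that contain every `Gal(L/E)`-invariant visual limit. -/
def limitSubtrees (f : L ⊗[K] A ≃ₐ[L] Matrix (Fin 2) (Fin 2) L) (E : IntermediateField K L) :
    Set (bruhatTits K L).Subgraph :=
  {S | S.coe.IsTree ∧
    ∀ r, IsRay (bruhatTits K L) r → InvariantLimit f E r → ContainsLimit S r}

/-- The subtree of the twisted form attached to `E`: the minimal subtree containing every
`Gal(L/E)`-invariant visual limit. -/
def twistedTree (f : L ⊗[K] A ≃ₐ[L] Matrix (Fin 2) (Fin 2) L) (E : IntermediateField K L) :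
    (bruhatTits K L).Subgraph :=
  sInf (limitSubtrees f E)

/-- The `𝒪_F`-order `𝔥_F` in `A_F = F ⊗ A` generated by a subring `𝔥` of `A`. -/
def generatedOrder (F : Type v) [Field F] [Algebra K F] (𝔥 : Subring A) : Subring (F ⊗[K] A) :=
  (Algebra.adjoin (ringOfInt K F) ((fun a : A => (1 : F) ⊗ₜ[K] a) '' 𝔥)).toSubring

/-- The inclusion of `A_E` in `A_L`. -/
def inclusionMap (A : Type w) [Ring A] [Algebra K A] (E : IntermediateField K L) :
    E ⊗[K] A →ₐ[K] L ⊗[K] A :=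
  Algebra.TensorProduct.map E.val (AlgHom.id K A)

/-- `x` is the vertex of the twisted form attached to the maximal order `𝔇` of `A_E`: the maximal
order `f (𝒪_L 𝔇)`, where `𝒪_L 𝔇` is `𝒪_L ⊗ 𝔇` seen in `A_L`. -/
def IsVertexOf (f : L ⊗[K] A ≃ₐ[L] Matrix (Fin 2) (Fin 2) L) (E : IntermediateField K L)
    (𝔇 : MaximalOrder K E (E ⊗[K] A)) (x : Vertex K L) : Prop :=
  (x.1 : Set (Matrix (Fin 2) (Fin 2) L)) =
    f '' (Submodule.span (ringOfInt K L) (inclusionMap A E '' (𝔇.1 : Set (E ⊗[K] A))))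

/-- The branch of `𝔥` in the twisted form: its vertices are the maximal orders containing
the image of `𝔥_L`. -/
def twistedBranch (f : L ⊗[K] A ≃ₐ[L] Matrix (Fin 2) (Fin 2) L) (𝔥 : Subring A) :
    (bruhatTits K L).Subgraph :=
  branch K L (f '' (generatedOrder (K := K) L 𝔥))

end Twisted

end TwistedTree

end

open TwistedTree

/-! A vertex of the tree of `F` is treated as a ball. The ball `a + π ^ n 𝒪` corresponds to the
conjugate of `M₂(𝒪)` by the affine matrix `(π ^ n, a; 0, 1)`, and two such vertices coincide exactly
when the balls do (`ballVertex_eq_iff`). The number `n` is an exponent, so larger `n` means a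
smaller ball. Every maximal order arises in this way (`exists_ballVertex_eq`) and neighbors are
consecutive concentric balls. The abstract structure `BallModel` records just this. It gives
acyclicity, a description of all rays (towards a common end at infinity, or towards a center, by
completeness), and coordinates on the topological space: the point of height `s` on the line with
center `a`.

Valuations from `E` are multiplied by `e` in `L`, so after rescaling heights by `e` the lines with
center in `E` form a copy of the tree of `E` inside the tree of `L`, each edge being stretched to
`e` edges. This is the structure `Refinement`; it yields the closed embedding `R.map`, its
simpliciality on the subdivision, and its image.

The twist is absorbed by a choice of coordinates. By Skolem–Noether, `f` and the extension of `g` to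
`L` differ by conjugation by some `c` in `GL₂(L)`. In the coordinates given by `c`, `Gal(L/E)` acts
in the twisted form simply by moving centers, `a ↦ τ a` (`twistedAct_ballVertex`). The invariant
ends are therefore infinity and the elements of `E`. A connected subgraph containing both ends of a
line contains the line, so the union of the lines with center in `E` is the least subtree
(`isLeast_limitSubtrees`). Monotonicity in `E` follows because a smaller Galois group fixes more
ends.

For branches, membership of a matrix `M` in the order of a ball consists of two conditions free of
the radius, one that weakens as the radius exponent decreases, and one that weakens as it increases
(`mem_ballVertex_one_iff`). Hence branches are convex. When `M` and the center are defined over `E`,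
both radius conditions only see multiples of `e`, so membership at an inner vertex of a stretched
edge forces membership at both of its ends. This makes the intersection a subgraph, and at the
vertices coming from `E` it gives the bijection with maximal orders. -/

noncomputable section

namespace TwistedTree

/-! ### The ring of integers of a finite extension of a local field -/

section LocalField

variable (K : Type u) [Field K] [ValuativeRel K]

/-- The ring of integers of a finite extension of a local field is the unit ball of a complete
ultrametric absolute value. -/
theorem exists_abs [TopologicalSpace K] [IsNonarchimedeanLocalField K]
    (F : Type v) [Field F] [Algebra K F] [FiniteDimensional K F] :
    ∃ N : F → ℝ, (∀ x y, N (x * y) = N x * N y) ∧ (∀ x y, N (x + y) ≤ max (N x) (N y)) ∧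
      (∀ x, x ∈ ringOfInt K F ↔ N x ≤ 1) ∧
      ∀ (a : ℕ → F) (r : ℝ), 0 < r → r < 1 → (∀ k, N (a (k + 1) - a k) ≤ r ^ k) →
        ∃ x, ∀ k, N (x - a k) ≤ r ^ k := by
  let := IsTopologicalAddGroup.rightUniformSpace K
  have := isUniformAddGroup_of_addCommGroup (G := K)
  -- The rank-one embedding of the value group into the reals turns the valuation of `K` into a
  -- norm, which the spectral norm then extends to `F`.
  let rk : (Valued.v (R := K) (Γ₀ := ValuativeRel.ValueGroupWithZero K)).RankOne :=
  { hom' := ValuativeRel.IsRankLeOne.nonempty.some.emb (R := K).comp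
      MonoidWithZeroHom.ValueGroup₀.embedding
    strictMono' := ValuativeRel.IsRankLeOne.nonempty.some.strictMono.comp
        MonoidWithZeroHom.ValueGroup₀.embedding_strictMono }
  let nK : NontriviallyNormedField K := Valued.toNontriviallyNormedField K
    (ValuativeRel.ValueGroupWithZero K)
  have : IsUltrametricDist K := inferInstance
  have : CompleteSpace K := inferInstance
  have hint : ∀ x : K, x ∈ 𝒪[K] ↔ ‖x‖ ≤ 1 := fun x =>
    (Valued.toNormedField.norm_le_one_iff (x := x)).symm
  let := spectralNorm.normedField K F
  have hN : ∀ x : F, ‖x‖ = spectralNorm K F x := fun x => rfl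
  have hna : ∀ x y : F, ‖x + y‖ ≤ max ‖x‖ ‖y‖ := isNonarchimedean_spectralNorm (K := K) (L := F)
  have : CompleteSpace F := spectralNorm.completeSpace K F
  refine ⟨fun x => ‖x‖, norm_mul, hna, fun x => ?_, fun a r hr hr1 ha => ?_⟩
  · have hx : IsIntegral K x := Algebra.IsIntegral.isIntegral x
    beta_reduce
    -- Spectral norm at most one means that the minimal polynomial over `K` has integral
    -- coefficients. As `𝒪[K]` is integrally closed, this is equivalent to integrality.
    rw [hN, spectralNorm, spectralValue_le_one_iff (minpoly.monic hx)]
    constructor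
    · intro h n
      have h' : IsIntegral 𝒪[K] x := h
      rw [minpoly.isIntegrallyClosed_eq_field_fractions' K h', Polynomial.coeff_map]
      exact (hint _).1 (Subtype.property _)
    · intro h
      have hl : minpoly K x ∈ Polynomial.lifts (algebraMap 𝒪[K] K) := by
        rw [Polynomial.lifts_iff_coeff_lifts]
        intro n
        exact ⟨⟨_, (hint _).2 (h n)⟩, rfl⟩
      obtain ⟨q, hq, -, hm⟩ := Polynomial.lifts_and_natDegree_eq_and_monic hl (minpoly.monic hx)
      refine ⟨q, hm, ?_⟩
      have := minpoly.aeval K x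
      rw [← hq, Polynomial.aeval_def, Polynomial.eval₂_map] at this
      exact this
  · have hc : CauchySeq a := by
      refine cauchySeq_of_le_geometric r 1 hr1 fun k => ?_
      rw [dist_comm, dist_eq_norm, one_mul]
      exact ha k
    obtain ⟨x, hx⟩ := cauchySeq_tendsto_of_complete hc
    refine ⟨x, fun k => ?_⟩
    -- The ultrametric inequality bounds a telescoping sum by its largest term, so no
    -- geometric-series constant appears in the bound on the limit.
    have h1 : ∀ m, ‖a (k + m) - a k‖ ≤ r ^ k := by
      intro m
      induction m with
      | zero => simpa using (pow_pos hr k).le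
      | succ m ih =>
        have : a (k + (m + 1)) - a k = (a (k + m + 1) - a (k + m)) + (a (k + m) - a k) := by
          rw [add_assoc]; ring
        rw [this]
        refine (hna _ _).trans (max_le ((ha _).trans ?_) ih)
        exact pow_le_pow_of_le_one hr.le hr1.le (Nat.le_add_right k m)
    have h2 : Filter.Tendsto (fun m => ‖a (k + m) - a k‖) Filter.atTop (nhds ‖x - a k‖) := by
      have := hx.comp (Filter.tendsto_add_atTop_nat k)
      refine ((this.congr fun m => ?_).sub_const (a k)).norm
      simp [add_comm]
    exact le_of_tendsto' h2 h1

variable (F : Type v) [Field F] [Algebra K F]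

/-- `π` is a uniformizer of the ring of integers of `F`, which is a discrete valuation ring. -/
structure IsUniformizer (π : F) : Prop where
  mem : π ∈ ringOfInt K F
  ne_zero : π ≠ 0
  inv_notMem : π⁻¹ ∉ ringOfInt K F
  exists_unit : ∀ x : F, x ≠ 0 → ∃ n : ℤ, π ^ (-n) * x ∈ ringOfInt K F ∧
    (π ^ (-n) * x)⁻¹ ∈ ringOfInt K F

variable {K F}

theorem isUnit_ringOfInt_iff (x : ringOfInt K F) (hx : x ≠ 0) :
    IsUnit x ↔ (x : F)⁻¹ ∈ ringOfInt K F := by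
  have hx' : (x : F) ≠ 0 := fun h => hx (Subtype.ext h)
  constructor
  · rintro ⟨y, rfl⟩
    have : ((y : ringOfInt K F) : F)⁻¹ = ((y⁻¹ : (ringOfInt K F)ˣ) : ringOfInt K F) := by
      apply inv_eq_of_mul_eq_one_right
      rw [← MulMemClass.coe_mul, Units.mul_inv]
      rfl
    rw [this]
    exact Subtype.property _
  · intro h
    exact IsUnit.of_mul_eq_one ⟨_, h⟩ (Subtype.ext (mul_inv_cancel₀ hx'))

variable (K F)

/-- Separability makes the integral closure a Dedekind domain. Multiplicativity of the absolute
value puts `x` or `x⁻¹` in the unit ball, so it is a valuation ring. It is not a field because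
`𝒪[K]`, over which it is integral, is not one. -/
theorem isDiscreteValuationRing_ringOfInt [TopologicalSpace K] [IsNonarchimedeanLocalField K]
    [FiniteDimensional K F] [Algebra.IsSeparable K F] :
    IsDiscreteValuationRing (ringOfInt K F) := by
  obtain ⟨N, hmul, hadd, hN, -⟩ := exists_abs K F
  have : IsFractionRing (ringOfInt K F) F :=
    integralClosure.isFractionRing_of_finite_extension K F
  have : IsDedekindDomain (ringOfInt K F) := integralClosure.isDedekindDomain 𝒪[K] K F
  have hv : ∀ x : F, x ∈ ringOfInt K F ∨ x⁻¹ ∈ ringOfInt K F := by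
    intro x
    by_cases hx0 : x = 0
    · left; rw [hx0]; exact zero_mem _
    rw [hN, hN]
    have h1 : N 1 ≤ 1 := (hN 1).1 (one_mem _)
    have h2 : N x * N x⁻¹ ≤ 1 := by rw [← hmul, mul_inv_cancel₀ hx0]; exact h1
    by_contra! h
    nlinarith [h.1, h.2]
  have : ValuationRing (ringOfInt K F) := by
    refine (ValuationRing.iff_isInteger_or_isInteger (ringOfInt K F) F).2 fun x => ?_
    exact (hv x).imp (fun h => ⟨⟨x, h⟩, rfl⟩) (fun h => ⟨⟨_, h⟩, rfl⟩)
  have hnf : ¬ IsField (ringOfInt K F) := by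
    intro h
    have h1 : IsField 𝒪[K] := by
      refine isField_of_isIntegral_of_isField (S := ringOfInt K F) ?_ h
      intro a b hab
      have hab' : algebraMap K F (a : K) = algebraMap K F (b : K) := congrArg Subtype.val hab
      exact Subtype.ext ((algebraMap K F).injective hab')
    exact IsDiscreteValuationRing.not_isField 𝒪[K] h1
  have ht := IsDiscreteValuationRing.TFAE (ringOfInt K F) hnf
  exact (ht.out 0 1).2 ‹ValuationRing (ringOfInt K F)›

variable {K F}

theorem isUniformizer_of_irreducible [IsDiscreteValuationRing (ringOfInt K F)]
    [IsFractionRing (ringOfInt K F) F] {ϖ : ringOfInt K F} (h : Irreducible ϖ) :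
    IsUniformizer K F (ϖ : F) where
  mem := ϖ.2
  ne_zero := fun h0 => h.ne_zero (Subtype.ext h0)
  inv_notMem := fun h' => h.not_isUnit ((isUnit_ringOfInt_iff ϖ h.ne_zero).2 h')
  exists_unit := by
    intro x hx
    have h0 : (ϖ : F) ≠ 0 := fun h0 => h.ne_zero (Subtype.ext h0)
    obtain ⟨a, b, hb, rfl⟩ := IsFractionRing.div_surjective (A := ringOfInt K F) x
    have hb0 : b ≠ 0 := nonZeroDivisors.ne_zero hb
    have ha0 : a ≠ 0 := by rintro rfl; simp at hx
    obtain ⟨n, s, rfl⟩ := IsDiscreteValuationRing.eq_unit_mul_pow_irreducible ha0 h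
    obtain ⟨m, t, rfl⟩ := IsDiscreteValuationRing.eq_unit_mul_pow_irreducible hb0 h
    have hs : ((s : ringOfInt K F) : F) * ((s⁻¹ : (ringOfInt K F)ˣ) : ringOfInt K F) = 1 := by
      rw [← MulMemClass.coe_mul, Units.mul_inv]; rfl
    have ht : ((t : ringOfInt K F) : F) * ((t⁻¹ : (ringOfInt K F)ˣ) : ringOfInt K F) = 1 := by
      rw [← MulMemClass.coe_mul, Units.mul_inv]; rfl
    have hs0 := left_ne_zero_of_mul_eq_one hs
    have ht0 := left_ne_zero_of_mul_eq_one ht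
    refine ⟨(n : ℤ) - m, ?_⟩
    have key : (ϖ : F) ^ (-((n : ℤ) - m)) * (algebraMap (ringOfInt K F) F (s * ϖ ^ n) /
        algebraMap (ringOfInt K F) F (t * ϖ ^ m)) =
        ((s * (t⁻¹ : (ringOfInt K F)ˣ) : ringOfInt K F) : F) := by
      rw [MulMemClass.coe_mul, eq_inv_of_mul_eq_one_right ht]
      change (ϖ : F) ^ (-((n : ℤ) - m)) * ((s : ringOfInt K F) * (ϖ : F) ^ n /
        ((t : ringOfInt K F) * (ϖ : F) ^ m)) = _
      rw [neg_sub, zpow_sub₀ h0, zpow_natCast, zpow_natCast]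
      field_simp
    rw [key]
    refine ⟨Subtype.property _, ?_⟩
    rw [← isUnit_ringOfInt_iff]
    · exact s.isUnit.mul (Units.isUnit t⁻¹)
    · exact (s.isUnit.mul (Units.isUnit t⁻¹)).ne_zero

/-! ### Valuations expressed through divisibility by powers of a uniformizer. -/

/-- `x` lies in the fractional ideal generated by `π ^ n`. -/
def PowDvd (π : F) (n : ℤ) (x : F) : Prop := π ^ (-n) * x ∈ ringOfInt K F

variable {π : F} {n m : ℤ} {x y : F}

theorem PowDvd.zero : PowDvd (K := K) π n 0 := by
  simp [PowDvd, zero_mem]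

theorem PowDvd.add (hx : PowDvd (K := K) π n x) (hy : PowDvd (K := K) π n y) :
    PowDvd (K := K) π n (x + y) := by
  rw [PowDvd, mul_add]; exact add_mem hx hy

theorem PowDvd.neg (hx : PowDvd (K := K) π n x) : PowDvd (K := K) π n (-x) := by
  rw [PowDvd, mul_neg]; exact neg_mem hx

theorem PowDvd.sub (hx : PowDvd (K := K) π n x) (hy : PowDvd (K := K) π n y) :
    PowDvd (K := K) π n (x - y) := by
  rw [sub_eq_add_neg]; exact hx.add hy.neg

theorem powDvd_zero_iff : PowDvd (K := K) π 0 x ↔ x ∈ ringOfInt K F := by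
  simp [PowDvd]

namespace IsUniformizer

theorem powDvd_mul (hπ : IsUniformizer K F π) (hx : PowDvd (K := K) π n x)
    (hy : PowDvd (K := K) π m y) : PowDvd (K := K) π (n + m) (x * y) := by
  rw [PowDvd, neg_add, zpow_add₀ hπ.ne_zero, mul_mul_mul_comm]
  exact mul_mem hx hy

theorem powDvd_mul_of_mem (hπ : IsUniformizer K F π) (hx : PowDvd (K := K) π n x)
    (hy : y ∈ ringOfInt K F) : PowDvd (K := K) π n (x * y) := by
  rw [← powDvd_zero_iff (π := π)] at hy
  simpa using hπ.powDvd_mul hx hy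

theorem zpow_mem_of_inv_mem {u : F} (h1 : u ∈ ringOfInt K F) (h2 : u⁻¹ ∈ ringOfInt K F) (m : ℤ) :
    u ^ m ∈ ringOfInt K F := by
  cases m with
  | ofNat m => rw [Int.ofNat_eq_natCast, zpow_natCast]; exact pow_mem h1 m
  | negSucc m => rw [zpow_negSucc, ← inv_pow]; exact pow_mem h2 _

theorem zpow_mem_iff (hπ : IsUniformizer K F π) : π ^ n ∈ ringOfInt K F ↔ 0 ≤ n := by
  constructor
  · intro h
    by_contra! hn
    apply hπ.inv_notMem
    have h1 : π ^ (-n - 1).toNat ∈ ringOfInt K F := pow_mem hπ.mem _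
    have h2 := mul_mem h h1
    rw [← zpow_natCast, ← zpow_add₀ hπ.ne_zero, Int.toNat_of_nonneg (by omega)] at h2
    rw [← zpow_neg_one]
    convert h2 using 2
    omega
  · intro h
    lift n to ℕ using h
    rw [zpow_natCast]
    exact pow_mem hπ.mem _

theorem powDvd_mono (hπ : IsUniformizer K F π) (hx : PowDvd (K := K) π n x) (h : m ≤ n) :
    PowDvd (K := K) π m x := by
  have h1 : π ^ (n - m) ∈ ringOfInt K F := hπ.zpow_mem_iff.2 (by omega)
  have := mul_mem h1 hx
  rwa [← mul_assoc, ← zpow_add₀ hπ.ne_zero, show n - m + -n = -m by ring] at this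

theorem powDvd_iff_le (hπ : IsUniformizer K F π) {u : F} (hu : u ∈ ringOfInt K F)
    (hu' : u⁻¹ ∈ ringOfInt K F) (h0 : u ≠ 0) : PowDvd (K := K) π m (π ^ n * u) ↔ m ≤ n := by
  rw [PowDvd, ← mul_assoc, ← zpow_add₀ hπ.ne_zero, neg_add_eq_sub, ← sub_nonneg,
    ← hπ.zpow_mem_iff]
  constructor
  · intro h
    simpa [mul_assoc, h0] using mul_mem h hu'
  · intro h
    exact mul_mem h hu

theorem exists_eq (hπ : IsUniformizer K F π) (hx : x ≠ 0) :
    ∃ (n : ℤ) (u : F), u ∈ ringOfInt K F ∧ u⁻¹ ∈ ringOfInt K F ∧ u ≠ 0 ∧ x = π ^ n * u := by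
  obtain ⟨n, h1, h2⟩ := hπ.exists_unit x hx
  refine ⟨n, _, h1, h2, mul_ne_zero (zpow_ne_zero _ hπ.ne_zero) hx, ?_⟩
  rw [← mul_assoc, ← zpow_add₀ hπ.ne_zero]
  simp

/-- This replaces a valuation function: the integer `n` is the order of `x`, and zero, divisible by
every power, needs no conventional value. -/
theorem exists_ord (hπ : IsUniformizer K F π) (hx : x ≠ 0) :
    ∃ n : ℤ, (∀ m, PowDvd (K := K) π m x ↔ m ≤ n) ∧
      ∀ m, PowDvd (K := K) π m x⁻¹ ↔ m ≤ -n := by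
  obtain ⟨n, u, h1, h2, h0, rfl⟩ := hπ.exists_eq hx
  refine ⟨n, fun m => hπ.powDvd_iff_le h1 h2 h0, fun m => ?_⟩
  rw [mul_inv, ← zpow_neg]
  exact hπ.powDvd_iff_le h2 (by simpa using h1) (inv_ne_zero h0)

theorem eq_zero_of_forall (hπ : IsUniformizer K F π) (h : ∀ k : ℕ, PowDvd (K := K) π k x) :
    x = 0 := by
  by_contra hx
  obtain ⟨n, hn, -⟩ := hπ.exists_ord hx
  have := (hn _).1 (h (n.toNat + 1))
  omega

theorem irreducible_iff (hπ : IsUniformizer K F π) (ϖ : ringOfInt K F) :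
    Irreducible ϖ ↔ ∃ u : F, u ∈ ringOfInt K F ∧ u⁻¹ ∈ ringOfInt K F ∧ u ≠ 0 ∧
      (ϖ : F) = π * u := by
  have key : ∀ (a : ringOfInt K F) (n : ℤ) (u : F), u ∈ ringOfInt K F → u⁻¹ ∈ ringOfInt K F →
      u ≠ 0 → (a : F) = π ^ n * u → 0 ≤ n ∧ (IsUnit a ↔ n = 0) := by
    intro a n u h1 h2 h0 ha
    have hn : 0 ≤ n := by
      rw [← hπ.powDvd_iff_le h1 h2 h0, powDvd_zero_iff, ← ha]
      exact a.2
    have ha0 : a ≠ 0 := by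
      rintro rfl
      exact mul_ne_zero (zpow_ne_zero n hπ.ne_zero) h0 ha.symm
    refine ⟨hn, ?_⟩
    rw [isUnit_ringOfInt_iff a ha0, ha, mul_inv, ← zpow_neg, ← powDvd_zero_iff (π := π),
      hπ.powDvd_iff_le h2 (by simpa using h1) (inv_ne_zero h0)]
    omega
  constructor
  · intro h
    have h0 : (ϖ : F) ≠ 0 := fun h0 => h.ne_zero (Subtype.ext h0)
    obtain ⟨n, u, h1, h2, hu0, hu⟩ := hπ.exists_eq h0
    obtain ⟨hn, hu1⟩ := key ϖ n u h1 h2 hu0 hu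
    have hn0 : n ≠ 0 := fun hn => h.not_isUnit (hu1.2 hn)
    -- Splitting off one factor `π`, which is not a unit, forces the cofactor `π ^ (n - 1) * u` to
    -- be a unit, so `n = 1`.
    have hfac : ϖ = ⟨π, hπ.mem⟩ * ⟨π ^ (n - 1) * u,
        mul_mem (hπ.zpow_mem_iff.2 (by omega)) h1⟩ := by
      apply Subtype.ext
      change (ϖ : F) = π * (π ^ (n - 1) * u)
      rw [hu, ← mul_assoc, ← zpow_one_add₀ hπ.ne_zero]
      congr 2
      omega
    rcases h.isUnit_or_isUnit hfac with h' | h'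
    · have := (key ⟨π, hπ.mem⟩ 1 1 (one_mem _) (by simp [one_mem]) one_ne_zero (by simp)).2.1 h'
      omega
    · have := (key _ (n - 1) u h1 h2 hu0 rfl).2.1 h'
      refine ⟨u, h1, h2, hu0, ?_⟩
      rw [hu, show n = 1 by omega, zpow_one]
  · rintro ⟨u, h1, h2, h0, hu⟩
    have hk := key ϖ 1 u h1 h2 h0 (by simpa using hu)
    refine ⟨fun h => by simpa using hk.2.1 h, ?_⟩
    intro a b hab
    have hab' : (ϖ : F) = a * b := congrArg Subtype.val hab
    have hne : (a : F) * b ≠ 0 := by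
      rw [← hab', hu]
      exact mul_ne_zero hπ.ne_zero h0
    obtain ⟨n, s, hs1, hs2, hs0, hs⟩ := hπ.exists_eq (left_ne_zero_of_mul hne)
    obtain ⟨m, t, ht1, ht2, ht0, ht⟩ := hπ.exists_eq (right_ne_zero_of_mul hne)
    obtain ⟨hn, hna⟩ := key a n s hs1 hs2 hs0 hs
    obtain ⟨hm, hmb⟩ := key b m t ht1 ht2 ht0 ht
    have e1 : (ϖ : F) = π ^ (n + m) * (s * t) := by
      rw [hab', hs, ht, zpow_add₀ hπ.ne_zero]; ring
    have hst : (s * t)⁻¹ ∈ ringOfInt K F := by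
      rw [mul_inv]; exact mul_mem hs2 ht2
    -- The same element is written with exponents `1` and `n + m`; testing divisibility in both
    -- directions gives `n + m = 1`, so one of the two factors is a unit.
    have e2 := hπ.powDvd_iff_le (m := n + m) (n := 1) h1 h2 h0
    have e3 := hπ.powDvd_iff_le (m := 1) (n := n + m) (mul_mem hs1 ht1) hst (mul_ne_zero hs0 ht0)
    rw [← e1] at e3
    rw [zpow_one, ← hu, e1] at e2
    have e4 := e2.1 ((hπ.powDvd_iff_le (mul_mem hs1 ht1) hst (mul_ne_zero hs0 ht0)).2 le_rfl)
    have e5 := e3.1 (by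
      rw [hu]
      simpa using (hπ.powDvd_iff_le (m := 1) (n := 1) h1 h2 h0).2 le_rfl)
    rw [hna, hmb]
    omega

theorem exists_limit (hπ : IsUniformizer K F π) [TopologicalSpace K] [IsNonarchimedeanLocalField K]
    [FiniteDimensional K F] (a : ℕ → F) (n : ℤ)
    (ha : ∀ k : ℕ, PowDvd (K := K) π (n + k) (a (k + 1) - a k)) :
    ∃ x, ∀ k : ℕ, PowDvd (K := K) π (n + k) (x - a k) := by
  obtain ⟨N, hmul, -, hN, hlim⟩ := exists_abs K F
  -- Nontriviality of `N` is not part of `exists_abs`. It is recovered from `π⁻¹` being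
  -- non-integral, which excludes that `N` vanishes identically.
  have h1 : N 1 = 1 := by
    have e := hmul 1 1
    rw [mul_one] at e
    by_contra h
    have h0 : N 1 = 0 := by
      by_contra h0
      exact h (mul_left_cancel₀ h0 (by rw [mul_one]; exact e.symm))
    exact hπ.inv_notMem ((hN _).2 (by rw [← one_mul π⁻¹, hmul, h0, zero_mul]; exact zero_le_one))
  have hππ : N π * N π⁻¹ = 1 := by rw [← hmul, mul_inv_cancel₀ hπ.ne_zero, h1]
  have hinv : 1 < N π⁻¹ := not_le.1 fun h => hπ.inv_notMem ((hN _).2 h)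
  have hpos : 0 < N π := by
    by_contra! h
    nlinarith
  have hlt : N π < 1 := by nlinarith
  have hpow : ∀ k : ℕ, N (π ^ k) = N π ^ k := by
    intro k
    induction k with
    | zero => simp [h1]
    | succ k ih => rw [pow_succ, hmul, ih, pow_succ]
  -- Dividing by `π ^ n` translates divisibility by `π ^ (n + k)` into the bound `N π ^ k`, so
  -- completeness applies with ratio `r = N π`.
  have hle : ∀ (k : ℕ) (x : F), PowDvd (K := K) π (n + k) x ↔ N (π ^ (-n) * x) ≤ N π ^ k := by
    intro k x
    have e : π ^ (-n) * x = π ^ k * (π ^ (-(n + k)) * x) := by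
      rw [← mul_assoc, ← zpow_natCast, ← zpow_add₀ hπ.ne_zero]
      congr 2
      ring
    rw [e, hmul, hpow, PowDvd, hN]
    constructor
    · intro h; nlinarith [pow_pos hpos k]
    · intro h
      by_contra! h'
      nlinarith [pow_pos hpos k]
  obtain ⟨x, hx⟩ := hlim (fun k => π ^ (-n) * a k) (N π) hpos hlt fun k => by
    rw [← mul_sub, ← hle]
    exact ha k
  refine ⟨π ^ n * x, fun k => ?_⟩
  rw [hle, mul_sub, ← mul_assoc, ← zpow_add₀ hπ.ne_zero]
  simpa using hx k

end IsUniformizer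

theorem exists_isUniformizer [TopologicalSpace K] [IsNonarchimedeanLocalField K]
    [FiniteDimensional K F] [Algebra.IsSeparable K F] : ∃ π : F, IsUniformizer K F π := by
  have := isDiscreteValuationRing_ringOfInt K F
  have : IsFractionRing (ringOfInt K F) F :=
    integralClosure.isFractionRing_of_finite_extension K F
  obtain ⟨ϖ, h⟩ := IsDiscreteValuationRing.exists_irreducible (ringOfInt K F)
  exact ⟨ϖ, isUniformizer_of_irreducible h⟩

end LocalField

/-! ### Graphs modelled on balls -/

/-- A description of the vertices of a graph as the balls `ball a n` of center `a` and radius `n`,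
such that the edges are the pairs of consecutive concentric balls, and any two balls are
contained in a third one. Such a graph is a tree. -/
structure BallModel {V : Type u} (G : SimpleGraph V) (F : Type v) where
  ball : F → ℤ → V
  surj : ∀ x, ∃ a n, x = ball a n
  level_eq : ∀ {a b n m}, ball a n = ball b m → n = m
  mono : ∀ {a b n m}, ball a n = ball b n → m ≤ n → ball a m = ball b m
  join : ∀ a b, ∃ n, ball a n = ball b n
  adj_iff : ∀ {x y}, G.Adj x y ↔
    ∃ a n, (x = ball a n ∧ y = ball a (n + 1)) ∨ (y = ball a n ∧ x = ball a (n + 1))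

namespace BallModel

variable {V : Type u} {G : SimpleGraph V} {F : Type v} (B : BallModel G F)

/-! #### The tree -/

theorem adj_ball (a : F) (n : ℤ) : G.Adj (B.ball a n) (B.ball a (n + 1)) :=
  B.adj_iff.2 ⟨a, n, Or.inl ⟨rfl, rfl⟩⟩

/-- The balls contained in the ball `ball a n`. -/
def below (a : F) (n : ℤ) : Set V := {x | ∃ b m, x = B.ball b m ∧ n ≤ m ∧ B.ball b n = B.ball a n}

theorem ball_mem_below_iff {a b : F} {n m : ℤ} :
    B.ball b m ∈ B.below a n ↔ n ≤ m ∧ B.ball b n = B.ball a n := by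
  constructor
  · rintro ⟨c, k, h1, h2, h3⟩
    obtain rfl := B.level_eq h1
    exact ⟨h2, (B.mono h1 h2).trans h3⟩
  · rintro ⟨h1, h2⟩
    exact ⟨b, m, rfl, h1, h2⟩

/-- A ball has a unique parent, so a single edge leaves the set of balls contained in a given one.
Both acyclicity and the minimality of the subtree rest on this. -/
theorem eq_of_boundary {a : F} {n : ℤ} {x y : V} (h : G.Adj x y) (hx : x ∈ B.below a (n + 1))
    (hy : y ∉ B.below a (n + 1)) : x = B.ball a (n + 1) ∧ y = B.ball a n := by
  obtain ⟨b, m, ⟨rfl, rfl⟩ | ⟨rfl, rfl⟩⟩ := B.adj_iff.1 h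
  · rw [ball_mem_below_iff] at hx hy
    exact absurd ⟨by omega, hx.2⟩ hy
  · rw [ball_mem_below_iff] at hx hy
    have : m = n := by
      by_contra hm
      exact hy ⟨by omega, hx.2⟩
    subst this
    exact ⟨hx.2, B.mono hx.2 (by omega)⟩

theorem ball_mem_below (a : F) {n m : ℤ} (h : n ≤ m) : B.ball a m ∈ B.below a n :=
  B.ball_mem_below_iff.2 ⟨h, rfl⟩

theorem ball_notMem_below (a b : F) {n m : ℤ} (h : m < n) : B.ball b m ∉ B.below a n := by
  rw [ball_mem_below_iff]
  omega

/-- Every edge is a bridge: a walk from the smaller ball to its parent has to leave the set of balls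
below the smaller one, and only that edge does so. -/
theorem isAcyclic (B : BallModel G F) : G.IsAcyclic := by
  have key : ∀ (a : F) (n : ℤ) (p : G.Walk (B.ball a (n + 1)) (B.ball a n)),
      s(B.ball a n, B.ball a (n + 1)) ∈ p.edges := by
    intro a n p
    obtain ⟨d, hd, h1, h2⟩ := p.exists_boundary_dart (B.below a (n + 1))
      (B.ball_mem_below a le_rfl) (B.ball_notMem_below a a (by omega))
    obtain ⟨e1, e2⟩ := B.eq_of_boundary d.adj h1 h2
    have he : d.edge = s(B.ball a n, B.ball a (n + 1)) := by
      rw [Sym2.eq_swap, ← e1, ← e2]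
      rfl
    rw [← he]
    exact List.mem_map_of_mem hd
  rw [SimpleGraph.isAcyclic_iff_forall_adj_isBridge]
  intro v w h
  rw [SimpleGraph.isBridge_iff_forall_walk_mem_edges]
  intro p
  obtain ⟨a, n, ⟨rfl, rfl⟩ | ⟨rfl, rfl⟩⟩ := B.adj_iff.1 h
  · simpa using key a n p.reverse
  · rw [Sym2.eq_swap]
    exact key a n p

/-- Any two vertices of the subgraph induced on `P` are joined inside `P` by the geodesic through
a common larger ball. -/
def Convex (P : Set V) : Prop :=
  ∀ ⦃a b : F⦄ ⦃n m : ℤ⦄, B.ball a n ∈ P → B.ball b m ∈ P → ∃ k, k ≤ n ∧ k ≤ m ∧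
    B.ball a k = B.ball b k ∧ (∀ j, k ≤ j → j ≤ n → B.ball a j ∈ P) ∧
    ∀ j, k ≤ j → j ≤ m → B.ball b j ∈ P

theorem isTree_induce {P : Set V} (hne : P.Nonempty) (hP : B.Convex P) :
    ((⊤ : G.Subgraph).induce P).coe.IsTree := by
  set S := (⊤ : G.Subgraph).induce P
  have hline : ∀ (a : F) (k : ℤ) (i : ℕ) (h : ∀ j, k ≤ j → j ≤ k + i → B.ball a j ∈ P),
      S.coe.Reachable ⟨B.ball a k, h k le_rfl (by omega)⟩
        ⟨B.ball a (k + i), h _ (by omega) le_rfl⟩ := by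
    intro a k i
    induction i with
    | zero =>
      intro h
      have : (⟨B.ball a k, h k le_rfl (by omega)⟩ : S.verts) =
        ⟨B.ball a (k + (0 : ℕ)), h _ (by omega) le_rfl⟩ := by simp
      rw [← this]
    | succ i ih =>
      intro h
      refine (ih fun j h1 h2 => h j h1 (by omega)).trans (SimpleGraph.Adj.reachable ?_)
      refine ⟨h _ (by omega) (by omega), h _ (by omega) le_rfl, ?_⟩
      have := B.adj_ball a (k + i)
      rw [add_assoc] at this
      exact_mod_cast this
  have hline' : ∀ (a : F) (k n : ℤ) (hk : k ≤ n) (h : ∀ j, k ≤ j → j ≤ n → B.ball a j ∈ P),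
      S.coe.Reachable ⟨B.ball a k, h k le_rfl hk⟩ ⟨B.ball a n, h _ hk le_rfl⟩ := by
    intro a k n hk h
    obtain ⟨i, rfl⟩ := Int.le.dest hk
    exact hline a k i h
  refine ⟨{ preconnected := ?_, nonempty := ?_ }, B.isAcyclic.subgraph S⟩
  · rintro ⟨x, hx⟩ ⟨y, hy⟩
    obtain ⟨a, n, rfl⟩ := B.surj x
    obtain ⟨b, m, rfl⟩ := B.surj y
    obtain ⟨k, h1, h2, h3, h4, h5⟩ := hP hx hy
    have := hline' a k n h1 h4
    refine (hline' a k n h1 h4).symm.trans ?_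
    have e : (⟨B.ball a k, h4 k le_rfl h1⟩ : S.verts) = ⟨B.ball b k, h5 k le_rfl h2⟩ :=
      Subtype.ext h3
    rw [e]
    exact hline' b k m h2 h5
  · obtain ⟨x, hx⟩ := hne
    exact ⟨⟨x, hx⟩⟩

/-! #### Rays -/

theorem isRay_down (a : F) : IsRay G fun k : ℕ => B.ball a k :=
  ⟨fun _ _ h => by exact_mod_cast B.level_eq h, fun n => by exact_mod_cast B.adj_ball a n⟩

theorem isRay_up (a : F) : IsRay G fun k : ℕ => B.ball a (-k) := by
  refine ⟨fun _ _ h => by exact_mod_cast neg_injective (B.level_eq h), fun n => ?_⟩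
  have := (B.adj_ball a (-(n + 1))).symm
  simpa using this

/-- Once a ray passes to a smaller ball it continues that way, since passing to the unique parent
would repeat a vertex. The resulting nested balls have a common center by completeness. A ray that
never descends consists of successive parents. -/
theorem ray_cases
    (hcomplete : ∀ (c : ℕ → F) (n : ℤ),
      (∀ k : ℕ, B.ball (c (k + 1)) (n + k) = B.ball (c k) (n + k)) →
      ∃ x, ∀ k : ℕ, B.ball x (n + k) = B.ball (c k) (n + k))
    {r : ℕ → V} (hr : IsRay G r) :
    (∃ N a n, ∀ k : ℕ, r (N + k) = B.ball a (n - k)) ∨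
      ∃ N a n, ∀ k : ℕ, r (N + k) = B.ball a (n + k) := by
  by_cases h : ∃ N a n, r N = B.ball a n ∧ r (N + 1) = B.ball a (n + 1)
  · right
    obtain ⟨N, a, n, h0, h1⟩ := h
    have step : ∀ k : ℕ, ∃ a, r (N + k) = B.ball a (n + k) ∧
        r (N + (k + 1)) = B.ball a (n + (k + 1 : ℕ)) := by
      intro k
      induction k with
      | zero => exact ⟨a, by simpa using h0, by simpa using h1⟩
      | succ k ih =>
        obtain ⟨a, ha0, ha1⟩ := ih
        obtain ⟨b, m, ⟨e1, e2⟩ | ⟨e1, e2⟩⟩ := B.adj_iff.1 (hr.2 (N + (k + 1)))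
        · obtain rfl := B.level_eq (e1.symm.trans ha1)
          refine ⟨b, e1, e2.trans ?_⟩
          congr 1
          push_cast
          ring
        · exfalso
          have hm := B.level_eq (ha1.symm.trans e2)
          obtain rfl : m = n + k := by push_cast at hm; omega
          have e3 : B.ball b (n + k) = B.ball a (n + k) :=
            (B.mono ((ha1.symm.trans e2).trans (by rw [hm])).symm (by push_cast; omega))
          have := hr.1 (e1.trans (e3.trans ha0.symm))
          omega
    choose c hc0 hc1 using step
    obtain ⟨x, hx⟩ := hcomplete c n fun k => by
      have e := (hc0 (k + 1)).symm.trans (hc1 k)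
      exact B.mono e (by push_cast; omega)
    exact ⟨N, x, n, fun k => (hc0 k).trans (hx k).symm⟩
  · left
    push Not at h
    obtain ⟨a, n, h0⟩ := B.surj (r 0)
    refine ⟨0, a, n, fun k => ?_⟩
    rw [zero_add]
    induction k with
    | zero => simpa using h0
    | succ k ih =>
      obtain ⟨b, m, ⟨e1, e2⟩ | ⟨e1, e2⟩⟩ := B.adj_iff.1 (hr.2 k)
      · exact absurd e2 (h k b m e1)
      · have e := ih.symm.trans e2
        have hm := B.level_eq e
        obtain rfl : m = n - (k + 1 : ℕ) := by push_cast; omega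
        rw [e1]
        rw [hm] at e
        exact (B.mono e (by omega)).symm

/-- Any two balls lie in a common larger one, so all ascending rays have the same limit, whatever
the choice of `a`. -/
theorem ray_cases_sameLimit
    (hcomplete : ∀ (c : ℕ → F) (n : ℤ),
      (∀ k : ℕ, B.ball (c (k + 1)) (n + k) = B.ball (c k) (n + k)) →
      ∃ x, ∀ k : ℕ, B.ball x (n + k) = B.ball (c k) (n + k))
    {r : ℕ → V} (hr : IsRay G r) (a : F) :
    SameLimit (fun k : ℕ => B.ball a (-k)) r ∨ ∃ x, SameLimit (fun k : ℕ => B.ball x k) r := by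
  rcases B.ray_cases hcomplete hr with ⟨N, b, n, h⟩ | ⟨N, b, n, h⟩
  · left
    obtain ⟨m, hm⟩ := B.join a b
    -- Both tails start at radius `n - |n| - |m|`, which is at most `m`, where the balls around `a`
    -- and `b` already agree.
    refine ⟨(m.natAbs + n.natAbs - n).toNat, N + (m.natAbs + n.natAbs), fun k => ?_⟩
    rw [add_assoc, h]
    rw [show n - ((m.natAbs + n.natAbs + k : ℕ) : ℤ) =
      -(((m.natAbs + n.natAbs - n).toNat + k : ℕ) : ℤ) by omega]
    exact B.mono hm (by omega)
  · right
    refine ⟨b, (n.natAbs + n).toNat, N + n.natAbs, fun k => ?_⟩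
    rw [add_assoc, h]
    exact congrArg (B.ball b) (by omega)

/-- A connected subgraph that contains both limits of a line contains the line. -/
theorem subgraph_adj_of_containsLimit {S : G.Subgraph} (hS : S.coe.Preconnected) {a b : F}
    (h1 : ContainsLimit S fun k : ℕ => B.ball a k)
    (h2 : ContainsLimit S fun k : ℕ => B.ball b (-k)) (n : ℤ) :
    S.Adj (B.ball a (n + 1)) (B.ball a n) := by
  obtain ⟨s, -, ⟨m, l, hs⟩, hadj⟩ := h1
  obtain ⟨t, -, ⟨p, q, ht⟩, hadj'⟩ := h2
  have hx : ∀ k, s k ∈ S.verts := fun k => (hadj k).fst_mem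
  have hy : ∀ k, t k ∈ S.verts := fun k => (hadj' k).fst_mem
  -- Far enough along the two rays, the first vertex lies below `ball a (n + 1)` and the second does
  -- not. A walk inside `S` between them must use the only edge crossing this boundary.
  obtain ⟨w⟩ := hS ⟨_, hx (m + (n.natAbs + 1))⟩ ⟨_, hy (p + (n.natAbs + 1))⟩
  obtain ⟨d, -, hd1, hd2⟩ := w.exists_boundary_dart (Subtype.val ⁻¹' B.below a (n + 1))
    (by
      change s (m + (n.natAbs + 1)) ∈ B.below a (n + 1)
      rw [hs]
      exact B.ball_mem_below a (by omega))
    (by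
      change t (p + (n.natAbs + 1)) ∉ B.below a (n + 1)
      rw [ht]
      exact B.ball_notMem_below a b (by omega))
  have hd : S.Adj d.fst d.snd := d.adj
  obtain ⟨e1, e2⟩ := B.eq_of_boundary hd.adj_sub hd1 hd2
  rwa [e1, e2] at hd

/-! #### Points of the space -/

/-- The radius of a ball. -/
def level (x : V) : ℤ := (B.surj x).choose_spec.choose

/-- A center of a ball. -/
def center (x : V) : F := (B.surj x).choose

theorem ball_center (x : V) : B.ball (B.center x) (B.level x) = x :=
  (B.surj x).choose_spec.choose_spec.symm

@[simp] theorem level_ball (a : F) (n : ℤ) : B.level (B.ball a n) = n :=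
  B.level_eq (B.ball_center _)

theorem level_adj {x y : V} (h : G.Adj x y) :
    B.level y = B.level x + 1 ∨ B.level x = B.level y + 1 := by
  obtain ⟨a, n, ⟨rfl, rfl⟩ | ⟨rfl, rfl⟩⟩ := B.adj_iff.1 h <;> simp

/-- The edge from `ball a n` to `ball a (n + 1)`. -/
def dart (a : F) (n : ℤ) : G.Dart := ⟨(B.ball a n, B.ball a (n + 1)), B.adj_ball a n⟩

theorem edgePt_zero (d : G.Dart) : edgePt G d 0 = pt G d.fst := Quot.sound (GlueRel.origin d)

theorem edgePt_symm (d : G.Dart) (t : unitInterval) :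
    edgePt G d t = edgePt G d.symm (unitInterval.symm t) := Quot.sound (GlueRel.flip d t)

theorem edgePt_one (d : G.Dart) : edgePt G d 1 = pt G d.snd := by
  rw [edgePt_symm, unitInterval.symm_one, edgePt_zero]
  rfl

/-- The point of height `s` on the line `n ↦ ball a n`. -/
def line (a : F) (s : ℝ) : Space G :=
  edgePt G (B.dart a ⌊s⌋) ⟨Int.fract s, Int.fract_nonneg s, (Int.fract_lt_one s).le⟩

theorem line_intCast (a : F) (n : ℤ) : B.line a n = pt G (B.ball a n) := by
  have : B.line a n = edgePt G (B.dart a n) 0 := by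
    unfold line
    congr 2
    · simp
    · simp
  rw [this, edgePt_zero]
  rfl

theorem edgePt_dart (a : F) (n : ℤ) (t : unitInterval) :
    edgePt G (B.dart a n) t = B.line a (n + t) := by
  -- The value `t = 1` is separate because the floor in `line` then jumps to the next edge.
  rcases eq_or_ne t 1 with rfl | ht
  · rw [edgePt_one]
    have := B.line_intCast a (n + 1)
    push_cast at this
    rw [Set.Icc.coe_one, this]
    rfl
  · have h1 : (t : ℝ) < 1 := lt_of_le_of_ne t.2.2 fun h => ht (Subtype.ext h)
    have hf : ⌊(n : ℝ) + t⌋ = n := by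
      rw [Int.floor_intCast_add, Int.floor_eq_zero_iff.2 ⟨t.2.1, h1⟩, add_zero]
    have hr : Int.fract ((n : ℝ) + t) = t := by
      rw [Int.fract, hf]
      ring
    unfold line
    congr 2
    · exact hf.symm
    · exact Subtype.ext hr.symm

theorem edgePt_eq_line (d : G.Dart) {a : F} {n m : ℤ} (h1 : d.fst = B.ball a n)
    (h2 : d.snd = B.ball a m) (t : unitInterval) :
    edgePt G d t = B.line a (n + t * (m - n)) := by
  have h := B.level_adj d.adj
  rw [h1, h2, level_ball, level_ball] at h
  rcases h with h | h
  · have : d = B.dart a n := by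
      ext
      · exact h1
      · rw [h2, h]; rfl
    rw [this, edgePt_dart, h]
    congr 1
    push_cast
    ring
  · have : d.symm = B.dart a m := by
      ext
      · exact h2
      · change d.fst = _
        rw [h1, h]; rfl
    rw [edgePt_symm, this, edgePt_dart, h]
    congr 1
    push_cast
    rw [unitInterval.coe_symm_eq]
    ring

theorem exists_dart (d : G.Dart) :
    ∃ (a : F) (n m : ℤ), d.fst = B.ball a n ∧ d.snd = B.ball a m ∧ (m = n + 1 ∨ n = m + 1) := by
  obtain ⟨a, n, ⟨h1, h2⟩ | ⟨h1, h2⟩⟩ := B.adj_iff.1 d.adj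
  · exact ⟨a, n, n + 1, h1, h2, Or.inl rfl⟩
  · exact ⟨a, n + 1, n, h2, h1, Or.inr rfl⟩

theorem exists_line (x : Space G) : ∃ a s, x = B.line a s := by
  obtain ⟨y | ⟨d, t⟩, rfl⟩ := Quot.exists_rep x
  · obtain ⟨a, n, rfl⟩ := B.surj y
    exact ⟨a, n, (B.line_intCast a n).symm⟩
  · obtain ⟨a, n, m, h1, h2, -⟩ := B.exists_dart d
    exact ⟨a, _, B.edgePt_eq_line d h1 h2 t⟩

/-- The height of a point of the space. -/
def height : Space G → ℝ :=
  Quot.lift (Sum.elim (fun x => (B.level x : ℝ))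
    fun p => B.level p.1.fst + (p.2 : ℝ) * (B.level p.1.snd - B.level p.1.fst)) (by
  rintro _ _ (⟨d⟩ | ⟨d, t⟩)
  · simp
  · simp only [Sum.elim_inr, unitInterval.coe_symm_eq]
    change _ = (B.level d.snd : ℝ) + (1 - t) * (B.level d.fst - B.level d.snd)
    ring)

/-- The endpoint of smallest (for `σ = true`) or largest (for `σ = false`) radius of the smallest
cell containing a point of the space. -/
def cellEnd (σ : Bool) : Space G → V :=
  Quot.lift (Sum.elim (fun x => x) fun p => if p.2 = 0 then p.1.fst else if p.2 = 1 then p.1.snd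
    else if decide (B.level p.1.fst < B.level p.1.snd) = σ then p.1.snd else p.1.fst) (by
  rintro _ _ (⟨d⟩ | ⟨d, t⟩)
  · simp
  · have e1 : d.symm.fst = d.snd := rfl
    have e2 : d.symm.snd = d.fst := rfl
    simp only [Sum.elim_inr, unitInterval.symm_eq_zero, unitInterval.symm_eq_one, e1, e2]
    by_cases h0 : t = 0
    · simp [h0]
    by_cases h1 : t = 1
    · simp [h1]
    have h : decide (B.level d.snd < B.level d.fst) = !decide (B.level d.fst < B.level d.snd) := by
      rcases B.level_adj d.adj with h | h <;> simp [h]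
    simp only [h0, h1, if_false, h]
    cases decide (B.level d.fst < B.level d.snd) <;> cases σ <;> simp)

@[simp] theorem height_line (a : F) (s : ℝ) : B.height (B.line a s) = s := by
  change (B.level (B.ball a ⌊s⌋) : ℝ) + Int.fract s *
    (B.level (B.ball a (⌊s⌋ + 1)) - B.level (B.ball a ⌊s⌋)) = s
  simp only [level_ball]
  push_cast
  rw [add_sub_cancel_left, mul_one, Int.floor_add_fract]

@[simp] theorem cellEnd_pt (σ : Bool) (x : V) : B.cellEnd σ (pt G x) = x := rfl

theorem pt_injective (B : BallModel G F) : Function.Injective (pt G) := fun x y h => by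
  simpa using congrArg (B.cellEnd true) h

theorem cellEnd_line (a : F) (s : ℝ) (σ : Bool) :
    B.cellEnd σ (B.line a s) = B.ball a (if σ then ⌈s⌉ else ⌊s⌋) := by
  by_cases hs : ∃ n : ℤ, s = n
  · obtain ⟨n, rfl⟩ := hs
    rw [line_intCast, cellEnd_pt]
    simp
  · have h0 : Int.fract s ≠ 0 := fun h => hs ⟨⌊s⌋, by
      have := Int.floor_add_fract s
      rw [h, add_zero] at this
      exact this.symm⟩
    have hc : ⌈s⌉ = ⌊s⌋ + 1 := by
      rw [Int.ceil_eq_iff]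
      push_cast
      have h1 := Int.floor_add_fract s
      have h2 := Int.fract_nonneg s
      have h3 := Int.fract_lt_one s
      constructor
      · have := lt_of_le_of_ne h2 h0.symm
        linarith
      · linarith
    change (if (⟨Int.fract s, _⟩ : unitInterval) = 0 then _ else
      if (⟨Int.fract s, _⟩ : unitInterval) = 1 then _ else
      if decide (B.level (B.ball a ⌊s⌋) < B.level (B.ball a (⌊s⌋ + 1))) = σ
        then B.ball a (⌊s⌋ + 1) else B.ball a ⌊s⌋) = _
    rw [if_neg (fun h => h0 (congrArg Subtype.val h)),
      if_neg (fun h => (Int.fract_lt_one s).ne (congrArg Subtype.val h)), hc]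
    cases σ <;> simp

/-- Points of a quotient are told apart by functions on it, here `height` and `cellEnd`. The ceiling
appears because the smaller of the two balls bounding a cell determines the larger one. -/
theorem line_eq_iff {a b : F} {s t : ℝ} :
    B.line a s = B.line b t ↔ s = t ∧ B.ball a ⌈s⌉ = B.ball b ⌈s⌉ := by
  constructor
  · intro h
    obtain rfl : s = t := by simpa using congrArg B.height h
    exact ⟨rfl, by simpa [cellEnd_line] using congrArg (B.cellEnd true) h⟩
  · rintro ⟨rfl, h⟩
    by_cases hs : ⌈s⌉ ≤ ⌊s⌋
    · have : s = ⌊s⌋ :=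
        le_antisymm ((Int.le_ceil s).trans (by exact_mod_cast hs)) (Int.floor_le s)
      rw [this, line_intCast, line_intCast]
      congr 1
      exact B.mono h (Int.floor_le_ceil s)
    · have hd : B.dart a ⌊s⌋ = B.dart b ⌊s⌋ := by
        ext
        · exact B.mono h (Int.floor_le_ceil s)
        · exact B.mono h (by omega)
      unfold line
      rw [hd]

/-! #### Topology of the space -/

/-- The topology is generated by all oriented edges. Reversing an edge composes its parametrization
with a continuous flip, so the orientation towards the smaller ball suffices. -/
theorem isClosed_iff {C : Set (Space G)} :
    IsClosed C ↔ ∀ a n, IsClosed (edgePt G (B.dart a n) ⁻¹' C) := by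
  have h : IsClosed C ↔ ∀ d, IsClosed (edgePt G d ⁻¹' C) := by
    simp only [← isClosed_coinduced]
    exact isClosed_iSup_iff
  rw [h]
  refine ⟨fun h a n => h _, fun h d => ?_⟩
  obtain ⟨a, n, m, h1, h2, h3 | h3⟩ := B.exists_dart d
  · have : d = B.dart a n := by
      ext
      · exact h1
      · rw [h2, h3]; rfl
    rw [this]
    exact h a n
  · have : d.symm = B.dart a m := by
      ext
      · exact h2
      · change d.fst = _
        rw [h1, h3]; rfl
    have e : edgePt G d = edgePt G (B.dart a m) ∘ unitInterval.symm := by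
      ext t
      rw [edgePt_symm, this]
      rfl
    rw [e, Set.preimage_comp]
    exact (h a m).preimage unitInterval.continuous_symm

theorem continuous_edgePt (d : G.Dart) : Continuous (edgePt G d) := by
  rw [continuous_iff_coinduced_le]
  exact le_iSup (fun d : G.Dart => TopologicalSpace.coinduced (edgePt G d) inferInstance) d

theorem continuousOn_line (a : F) (n : ℤ) :
    ContinuousOn (B.line a) (Set.Icc (n : ℝ) (n + 1)) := by
  have h : Set.EqOn (B.line a) (fun s => edgePt G (B.dart a n)
      (Set.projIcc 0 1 zero_le_one (s - n))) (Set.Icc (n : ℝ) (n + 1)) := by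
    intro s hs
    have : s - n ∈ Set.Icc (0 : ℝ) 1 := ⟨by linarith [hs.1], by linarith [hs.2]⟩
    simp only [Set.projIcc_of_mem _ this, edgePt_dart]
    congr 1
    ring
  refine ContinuousOn.congr (Continuous.continuousOn ?_) h
  exact (continuous_edgePt _).comp (continuous_projIcc.comp (continuous_id.sub continuous_const))

/-- The closed unit intervals starting at `⌊s⌋ - 1` and `⌊s⌋` together cover a neighborhood of `s`,
even when `s` is an integer. -/
theorem continuous_line (a : F) : Continuous (B.line a) := by
  rw [continuous_iff_continuousAt]
  intro s
  have h1 := B.continuousOn_line a ⌊s⌋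
  have h2 := B.continuousOn_line a (⌊s⌋ - 1)
  have h := h2.union_of_isClosed h1 isClosed_Icc isClosed_Icc
  refine h.continuousAt (Filter.mem_of_superset (Ioo_mem_nhds (a := (⌊s⌋ : ℝ) - 1)
    (b := ⌊s⌋ + 1) (by linarith [Int.floor_le s]) (Int.lt_floor_add_one s)) ?_)
  intro t ht
  push_cast
  rcases le_total t ⌊s⌋ with h | h
  · exact Or.inl ⟨ht.1.le, by linarith⟩
  · exact Or.inr ⟨h, ht.2.le⟩

/-- The points of the subspace attached to an induced subgraph. -/
theorem line_mem_subspaceOf_induce {P : Set V} {a : F} {s : ℝ} :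
    B.line a s ∈ subspaceOf ((⊤ : G.Subgraph).induce P) ↔ B.ball a ⌊s⌋ ∈ P ∧ B.ball a ⌈s⌉ ∈ P := by
  constructor
  · rintro (⟨x, hx, e⟩ | ⟨d, t, ⟨hd1, hd2, -⟩, e⟩)
    · have h1 := congrArg (B.cellEnd true) e
      have h2 := congrArg (B.cellEnd false) e
      simp only [cellEnd_line, cellEnd_pt, if_true] at h1 h2
      rw [h1]
      simp only [Bool.false_eq_true, if_false] at h2
      rw [h2]
      exact ⟨hx, hx⟩
    · have key : ∀ σ, B.cellEnd σ (edgePt G d t) ∈ P := by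
        intro σ
        change (if t = 0 then _ else if t = 1 then _ else if _ then _ else _) ∈ P
        split_ifs <;> assumption
      rw [← e] at key
      have h1 := key true
      have h2 := key false
      simp only [cellEnd_line, if_true, Bool.false_eq_true, if_false] at h1 h2
      exact ⟨h2, h1⟩
  · rintro ⟨h1, h2⟩
    by_cases hs : ⌈s⌉ ≤ ⌊s⌋
    · have : s = ⌊s⌋ :=
        le_antisymm ((Int.le_ceil s).trans (by exact_mod_cast hs)) (Int.floor_le s)
      left
      refine ⟨_, h1, ?_⟩
      conv_lhs => rw [this]
      rw [line_intCast]
    · right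
      have hc : ⌈s⌉ = ⌊s⌋ + 1 := le_antisymm (Int.ceil_le_floor_add_one s) (by omega)
      rw [hc] at h2
      exact ⟨B.dart a ⌊s⌋, ⟨Int.fract s, Int.fract_nonneg s, (Int.fract_lt_one s).le⟩,
        ⟨h1, h2, B.adj_ball a _⟩, rfl⟩

end BallModel

/-! ### Refinements of ball models -/

/-- A ball model `B'` refines the ball model `B` if the balls of `B` are the balls of `B'` of
radius `e * n` with a center in the image of a map `ι`, and the ball of radius `e * n` is the
smallest of these containing a given ball of radius `j` for `e * (n - 1) < j ≤ e * n`. -/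
structure Refinement {V : Type u} {G : SimpleGraph V} {F : Type v} (B : BallModel G F)
    {V' : Type w} {G' : SimpleGraph V'} {F' : Type w'} (B' : BallModel G' F') (e : ℕ) where
  ι : F → F'
  pos : 0 < e
  ball_iff : ∀ {a b : F} {j n : ℤ}, e * (n - 1) < j → j ≤ e * n →
    (B'.ball (ι a) j = B'.ball (ι b) j ↔ B.ball a n = B.ball b n)

namespace Refinement

variable {V : Type u} {G : SimpleGraph V} {F : Type v} {B : BallModel G F}
  {V' : Type w} {G' : SimpleGraph V'} {F' : Type w'} {B' : BallModel G' F'} {e : ℕ}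
  (R : Refinement B B' e)

/-- The map on spaces that sends the line with center `a` to the line with center `ι a` and
multiplies the heights by `e`. -/
def map (x : Space G) : Space G' :=
  B'.line (R.ι (B.exists_line x).choose) (e * (B.exists_line x).choose_spec.choose)

theorem ceil_bounds (R : Refinement B B' e) (s : ℝ) :
    (e : ℤ) * (⌈s⌉ - 1) < ⌈(e : ℝ) * s⌉ ∧ ⌈(e : ℝ) * s⌉ ≤ e * ⌈s⌉ := by
  have he : (0 : ℝ) < e := by exact_mod_cast R.pos
  constructor
  · rw [Int.lt_ceil]
    push_cast
    have := Int.ceil_lt_add_one s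
    nlinarith
  · rw [Int.ceil_le]
    push_cast
    have := Int.le_ceil s
    nlinarith

theorem floor_bounds (R : Refinement B B' e) (s : ℝ) :
    (e : ℤ) * ⌊s⌋ ≤ ⌊(e : ℝ) * s⌋ ∧ ⌊(e : ℝ) * s⌋ < e * (⌊s⌋ + 1) := by
  have he : (0 : ℝ) < e := by exact_mod_cast R.pos
  constructor
  · rw [Int.le_floor]
    push_cast
    have := Int.floor_le s
    nlinarith
  · rw [Int.floor_lt]
    push_cast
    have := Int.lt_floor_add_one s
    nlinarith

/-- The ceiling of `e * s` falls in the window ending at `e * ⌈s⌉`, where `ball_iff` compares the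
two models. This gives both well-definedness and injectivity of `map`. -/
theorem line_eq_iff {a b : F} {s t : ℝ} :
    B'.line (R.ι a) (e * s) = B'.line (R.ι b) (e * t) ↔ B.line a s = B.line b t := by
  have he : (e : ℝ) ≠ 0 := by exact_mod_cast R.pos.ne'
  rw [B.line_eq_iff, B'.line_eq_iff, mul_right_inj' he,
    R.ball_iff (R.ceil_bounds s).1 (R.ceil_bounds s).2]

/-- The definition of `map` chooses a line through the point; the result does not depend on that
choice. -/
theorem map_line (a : F) (s : ℝ) : R.map (B.line a s) = B'.line (R.ι a) (e * s) :=
  R.line_eq_iff.2 (B.exists_line (B.line a s)).choose_spec.choose_spec.symm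

theorem map_pt (a : F) (n : ℤ) :
    R.map (pt G (B.ball a n)) = pt G' (B'.ball (R.ι a) (e * n)) := by
  rw [← B.line_intCast, map_line, ← B'.line_intCast]
  push_cast
  rfl

theorem map_injective : Function.Injective R.map := by
  intro x y h
  obtain ⟨a, s, rfl⟩ := B.exists_line x
  obtain ⟨b, t, rfl⟩ := B.exists_line y
  rwa [map_line, map_line, line_eq_iff] at h

/-- The vertices of the image. -/
def image : Set V' := {x | ∃ a n, x = B'.ball (R.ι a) n}

theorem ball_mem_image_iff {b : F'} {n : ℤ} :
    B'.ball b n ∈ R.image ↔ ∃ a, B'.ball b n = B'.ball (R.ι a) n := by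
  constructor
  · rintro ⟨a, m, h⟩
    obtain rfl := B'.level_eq h
    exact ⟨a, h⟩
  · rintro ⟨a, h⟩
    exact ⟨a, n, h⟩

theorem mem_subspaceOf_image_iff {x : Space G'} :
    x ∈ subspaceOf ((⊤ : G'.Subgraph).induce R.image) ↔ ∃ a s, x = B'.line (R.ι a) s := by
  obtain ⟨b, s, rfl⟩ := B'.exists_line x
  rw [BallModel.line_mem_subspaceOf_induce]
  constructor
  · rintro ⟨-, h⟩
    obtain ⟨a, h⟩ := R.ball_mem_image_iff.1 h
    exact ⟨a, s, B'.line_eq_iff.2 ⟨rfl, h⟩⟩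
  · rintro ⟨a, t, h⟩
    obtain ⟨rfl, hb⟩ := B'.line_eq_iff.1 h
    exact ⟨R.ball_mem_image_iff.2 ⟨a, B'.mono hb (Int.floor_le_ceil s)⟩,
      R.ball_mem_image_iff.2 ⟨a, hb⟩⟩

theorem range_map : Set.range R.map = subspaceOf ((⊤ : G'.Subgraph).induce R.image) := by
  have he : (e : ℝ) ≠ 0 := by exact_mod_cast R.pos.ne'
  ext x
  rw [mem_subspaceOf_image_iff]
  constructor
  · rintro ⟨y, rfl⟩
    obtain ⟨a, s, rfl⟩ := B.exists_line y
    exact ⟨a, _, R.map_line a s⟩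
  · rintro ⟨a, s, rfl⟩
    exact ⟨B.line a (s / e), by rw [map_line, mul_div_cancel₀ _ he]⟩

theorem continuous_map : Continuous R.map := by
  rw [continuous_iff_isClosed]
  intro C hC
  rw [B.isClosed_iff]
  intro a n
  have h : edgePt G (B.dart a n) ⁻¹' (R.map ⁻¹' C) =
      (fun t : unitInterval => B'.line (R.ι a) (e * (n + t))) ⁻¹' C := by
    ext t
    rw [Set.mem_preimage, Set.mem_preimage, Set.mem_preimage, B.edgePt_dart, map_line]
  rw [h]
  exact hC.preimage ((B'.continuous_line _).comp (by fun_prop))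

/-- Closedness is tested edge by edge. If the smaller end of the edge has a center in the image of
`ι`, then the edge is covered by a line and `map` is inverted there by dividing heights by `e`.
Otherwise the image meets the edge at most in its larger end. -/
theorem isClosedMap_map : IsClosedMap R.map := by
  have he : (e : ℝ) ≠ 0 := by exact_mod_cast R.pos.ne'
  intro C hC
  rw [B'.isClosed_iff]
  intro b n
  by_cases hb : B'.ball b (n + 1) ∈ R.image
  · obtain ⟨a, ha⟩ := R.ball_mem_image_iff.1 hb
    have hd : B'.dart b n = B'.dart (R.ι a) n := by
      ext
      · exact B'.mono ha (by omega)
      · exact ha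
    have h : edgePt G' (B'.dart b n) ⁻¹' (R.map '' C) =
        (fun t : unitInterval => B.line a ((n + t) / e)) ⁻¹' C := by
      ext t
      have : edgePt G' (B'.dart b n) t = R.map (B.line a ((n + t) / e)) := by
        rw [hd, B'.edgePt_dart, map_line, mul_div_cancel₀ _ he]
      rw [Set.mem_preimage, Set.mem_preimage, this, R.map_injective.mem_set_image]
    rw [h]
    exact hC.preimage ((B.continuous_line _).comp (by fun_prop))
  -- Any point of the edge with `t > 0` has its height rounded up to `n + 1`; if it lay in the
  -- image, so would `ball b (n + 1)`.
  · refine Set.Subsingleton.isClosed (Set.subsingleton_of_forall_eq 0 fun t ht => ?_)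
    by_contra h0
    have hpos : (0 : ℝ) < t := lt_of_le_of_ne t.2.1 fun h => h0 (Subtype.ext h.symm)
    have hr : edgePt G' (B'.dart b n) t ∈ Set.range R.map := Set.image_subset_range _ _ ht
    rw [range_map, B'.edgePt_dart, BallModel.line_mem_subspaceOf_induce] at hr
    have hc : ⌈(n : ℝ) + t⌉ = n + 1 := by
      rw [Int.ceil_eq_iff]
      push_cast
      constructor
      · linarith
      · linarith [t.2.2]
    rw [hc] at hr
    exact hb hr.2

theorem isEmbedding_map : Topology.IsEmbedding R.map :=
  (Topology.IsClosedEmbedding.of_continuous_injective_isClosedMap R.continuous_map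
    R.map_injective R.isClosedMap_map).isEmbedding

theorem coe_frac {n k : ℕ} {t : ℝ} (hn : 0 < n) (hk : k < n) (h0 : 0 ≤ t) (h1 : t ≤ 1) :
    (frac n k t : ℝ) = (k + t) / n := by
  have hn' : (0 : ℝ) < n := by exact_mod_cast hn
  have hk' : (k : ℝ) + 1 ≤ n := by exact_mod_cast hk
  have : ((k : ℝ) + t) / n ∈ Set.Icc (0 : ℝ) 1 := by
    refine ⟨by positivity, ?_⟩
    rw [div_le_one hn']
    linarith
  rw [frac, Set.projIcc_of_mem _ this]

theorem frac_succ {n k : ℕ} : frac n (k + 1) 0 = frac n k 1 := by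
  simp [frac]

theorem map_edgePt {d : G.Dart} {a : F} {n m : ℤ} (h1 : d.fst = B.ball a n)
    (h2 : d.snd = B.ball a m) {k : ℕ} (hk : k < e) {t : ℝ} (ht0 : 0 ≤ t) (ht1 : t ≤ 1) :
    R.map (edgePt G d (frac e k t)) = B'.line (R.ι a) (e * n + (k + t) * (m - n)) := by
  have he : (e : ℝ) ≠ 0 := by exact_mod_cast R.pos.ne'
  rw [B.edgePt_eq_line d h1 h2, map_line, coe_frac R.pos hk ht0 ht1]
  congr 1
  field_simp

theorem exists_map_subdivisionVertex (x : SubdivisionVertex G e) :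
    ∃ y, R.map x.1 = pt G' y := by
  obtain ⟨x, ⟨y, rfl⟩ | ⟨d, k, hk, rfl⟩⟩ := x
  · obtain ⟨a, n, rfl⟩ := B.surj y
    exact ⟨_, R.map_pt a n⟩
  · obtain ⟨a, n, m, h1, h2, -⟩ := B.exists_dart d
    have hpos := R.pos
    rcases Nat.lt_or_ge k e with hk' | hk'
    · refine ⟨B'.ball (R.ι a) (e * n + k * (m - n)), ?_⟩
      rw [R.map_edgePt h1 h2 hk' le_rfl zero_le_one, ← B'.line_intCast]
      push_cast
      rw [add_zero]
    -- The last cutting point is viewed as the end `t = 1` of the last piece, since `map_edgePt`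
    -- requires `k < e`.
    · obtain rfl : k = (e - 1) + 1 := by omega
      refine ⟨B'.ball (R.ι a) (e * n + ((e - 1 : ℕ) + 1) * (m - n)), ?_⟩
      change R.map (edgePt G d (frac e (e - 1 + 1) 0)) = _
      rw [frac_succ, R.map_edgePt h1 h2 (by omega) zero_le_one le_rfl, ← B'.line_intCast]
      push_cast
      rfl

/-- The `k`-th piece of an edge with end heights `n` and `m` goes to the segment between the
integral heights `e * n + k * (m - n)` and `e * n + (k + 1) * (m - n)`, which is an edge because `m
- n` is `1` or `-1`. -/
theorem isSimplicial : IsSimplicialOnSubdivision G G' e R.map := by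
  choose φ hφ using R.exists_map_subdivisionVertex
  have key : ∀ (d : G.Dart) (k : ℕ), k < e → ∀ x y : SubdivisionVertex G e,
      x.1 = edgePt G d (frac e k 0) → y.1 = edgePt G d (frac e (k + 1) 0) →
      ∃ (a : F') (i j : ℤ), φ x = B'.ball a i ∧ φ y = B'.ball a j ∧ (j = i + 1 ∨ i = j + 1) ∧
        ∀ t : unitInterval, R.map (edgePt G d (frac e k t)) = B'.line a (i + t * (j - i)) := by
    intro d k hk x y hx hy
    obtain ⟨a, n, m, h1, h2, h3⟩ := B.exists_dart d
    refine ⟨R.ι a, e * n + k * (m - n), e * n + (k + 1) * (m - n), ?_, ?_, ?_, ?_⟩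
    · apply B'.pt_injective
      rw [← hφ, hx, R.map_edgePt h1 h2 hk le_rfl zero_le_one, ← B'.line_intCast]
      push_cast
      rw [add_zero]
    · apply B'.pt_injective
      rw [← hφ, hy, frac_succ, R.map_edgePt h1 h2 hk zero_le_one le_rfl, ← B'.line_intCast]
      push_cast
      rfl
    · rcases h3 with rfl | rfl
      · left; ring
      · right; ring
    · intro t
      rw [R.map_edgePt h1 h2 hk t.2.1 t.2.2]
      congr 1
      push_cast
      ring
  have hadj : ∀ (d : G.Dart) (k : ℕ), k < e → ∀ x y : SubdivisionVertex G e,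
      x.1 = edgePt G d (frac e k 0) → y.1 = edgePt G d (frac e (k + 1) 0) →
      G'.Adj (φ x) (φ y) := by
    intro d k hk x y hx hy
    obtain ⟨a, i, j, h1, h2, rfl | rfl, -⟩ := key d k hk x y hx hy
    · rw [h1, h2]; exact B'.adj_ball a i
    · rw [h1, h2]; exact (B'.adj_ball a j).symm
  refine ⟨⟨φ, ?_⟩, hφ, ?_⟩
  · rintro x y ⟨-, ⟨d, k, hk, h1, h2⟩ | ⟨d, k, hk, h1, h2⟩⟩
    · exact hadj d k hk x y h1 h2
    · exact (hadj d k hk y x h1 h2).symm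
  · intro d k hk δ h1 h2 t
    obtain ⟨a, i, j, e1, e2, -, e3⟩ := key d k hk _ _ h1 h2
    rw [e3, B'.edgePt_eq_line _ e1 e2]

/-- The inverse image of an induced subgraph is a subgraph if the endpoints of the image of an
edge belong to the subgraph as soon as one of its inner vertices does. -/
theorem image_subspaceOf_induce {P : Set V'} (hP : B'.Convex P)
    (hfloor : ∀ {a : F} {n j : ℤ}, (e : ℤ) * n ≤ j → j < e * (n + 1) →
      B'.ball (R.ι a) j ∈ P → B'.ball (R.ι a) (e * n) ∈ P)
    (hceil : ∀ {a : F} {n j : ℤ}, (e : ℤ) * (n - 1) < j → j ≤ e * n →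
      B'.ball (R.ι a) j ∈ P → B'.ball (R.ι a) (e * n) ∈ P) :
    ∃ S : G.Subgraph, R.map '' subspaceOf S = subspaceOf ((⊤ : G'.Subgraph).induce P) ∩
      subspaceOf ((⊤ : G'.Subgraph).induce R.image) := by
  have he : (e : ℝ) ≠ 0 := by exact_mod_cast R.pos.ne'
  let Q : Set V := {y | ∃ a n, y = B.ball a n ∧ B'.ball (R.ι a) (e * n) ∈ P}
  have hQ : ∀ a n, B.ball a n ∈ Q ↔ B'.ball (R.ι a) (e * n) ∈ P := by
    intro a n
    constructor
    · rintro ⟨b, m, h1, h2⟩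
      obtain rfl := B.level_eq h1
      have hpos : (0 : ℤ) < e := by exact_mod_cast R.pos
      rwa [(R.ball_iff (by nlinarith) le_rfl).2 h1]
    · exact fun h => ⟨a, n, rfl, h⟩
  have key : ∀ a s, B.line a s ∈ subspaceOf ((⊤ : G.Subgraph).induce Q) ↔
      B'.line (R.ι a) (e * s) ∈ subspaceOf ((⊤ : G'.Subgraph).induce P) := by
    intro a s
    rw [BallModel.line_mem_subspaceOf_induce, BallModel.line_mem_subspaceOf_induce, hQ, hQ]
    obtain ⟨h1, h2⟩ := R.floor_bounds s
    obtain ⟨h3, h4⟩ := R.ceil_bounds s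
    constructor
    · rintro ⟨h5, h6⟩
      -- Convexity, applied to the images of the two ends of the stretched edge, fills in all the
      -- vertices between them.
      obtain ⟨k, hk, -, -, -, h⟩ := hP h5 h6
      have := Int.floor_le_ceil ((e : ℝ) * s)
      exact ⟨h _ (by omega) (by omega), h _ (by omega) (by omega)⟩
    · rintro ⟨h5, h6⟩
      exact ⟨hfloor h1 h2 h5, hceil h3 h4 h6⟩
  refine ⟨(⊤ : G.Subgraph).induce Q, ?_⟩
  ext x
  constructor
  · rintro ⟨y, hy, rfl⟩
    obtain ⟨a, s, rfl⟩ := B.exists_line y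
    rw [map_line]
    exact ⟨(key a s).1 hy, R.mem_subspaceOf_image_iff.2 ⟨a, _, rfl⟩⟩
  · rintro ⟨h1, h2⟩
    obtain ⟨a, s, rfl⟩ := R.mem_subspaceOf_image_iff.1 h2
    have hs : s = e * (s / e) := (mul_div_cancel₀ _ he).symm
    rw [hs] at h1 ⊢
    exact ⟨_, (key a (s / e)).2 h1, R.map_line _ _⟩

/-- The image is stable under enlarging balls, so the path through any common larger ball stays in
it. -/
theorem convex_image : B'.Convex R.image := by
  have hmono : ∀ {b : F'} {n j : ℤ}, B'.ball b n ∈ R.image → j ≤ n → B'.ball b j ∈ R.image := by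
    intro b n j h hj
    rw [ball_mem_image_iff] at h ⊢
    exact h.imp fun a h => B'.mono h hj
  intro a b n m ha hb
  obtain ⟨k, hk⟩ := B'.join a b
  exact ⟨min k (min n m), by omega, by omega, B'.mono hk (by omega),
    fun j _ h => hmono ha h, fun j _ h => hmono hb h⟩

/-- The image is the smallest subtree containing the limit of the balls of increasing size and
the limits of the balls with a center in the image of `ι`. -/
theorem isLeast_image
    (hcomplete : ∀ (c : ℕ → F') (n : ℤ),
      (∀ k : ℕ, B'.ball (c (k + 1)) (n + k) = B'.ball (c k) (n + k)) →
      ∃ x, ∀ k : ℕ, B'.ball x (n + k) = B'.ball (c k) (n + k))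
    (I : (ℕ → V') → Prop) (a₀ : F)
    (hup : I fun k : ℕ => B'.ball (R.ι a₀) (-k))
    (hdown : ∀ a, I fun k : ℕ => B'.ball (R.ι a) k)
    (honly : ∀ x r, I r → SameLimit (fun k : ℕ => B'.ball x k) r → x ∈ Set.range R.ι) :
    IsLeast {S : G'.Subgraph | S.coe.IsTree ∧ ∀ r, IsRay G' r → I r → ContainsLimit S r}
      ((⊤ : G'.Subgraph).induce R.image) := by
  refine ⟨⟨B'.isTree_induce ⟨_, a₀, 0, rfl⟩ R.convex_image, fun r hr hI => ?_⟩, ?_⟩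
  · rcases B'.ray_cases_sameLimit hcomplete hr (R.ι a₀) with h | ⟨x, h⟩
    · refine ⟨_, B'.isRay_up _, h, fun n => ⟨⟨_, _, rfl⟩, ⟨_, _, rfl⟩, ?_⟩⟩
      exact (B'.isRay_up _).2 n
    · obtain ⟨a, rfl⟩ := honly x r hI h
      refine ⟨_, B'.isRay_down _, h, fun n => ⟨⟨_, _, rfl⟩, ⟨_, _, rfl⟩, ?_⟩⟩
      exact (B'.isRay_down _).2 n
  · rintro S ⟨hS, hlim⟩
    have hadj : ∀ a n, S.Adj (B'.ball (R.ι a) (n + 1)) (B'.ball (R.ι a) n) := fun a n =>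
      B'.subgraph_adj_of_containsLimit hS.connected.preconnected
        (hlim _ (B'.isRay_down _) (hdown a)) (hlim _ (B'.isRay_up _) hup) n
    refine ⟨?_, ?_⟩
    · rintro _ ⟨a, n, rfl⟩
      exact (hadj a n).snd_mem
    · rintro x y ⟨hx, hy, h⟩
      obtain ⟨b, n, ⟨rfl, rfl⟩ | ⟨rfl, rfl⟩⟩ := B'.adj_iff.1 h
      · obtain ⟨a, ha⟩ := R.ball_mem_image_iff.1 hy
        rw [ha, B'.mono ha (show n ≤ n + 1 by omega)]
        exact (hadj a n).symm
      · obtain ⟨a, ha⟩ := R.ball_mem_image_iff.1 hx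
        rw [ha, B'.mono ha (show n ≤ n + 1 by omega)]
        exact hadj a n

end Refinement

/-! ### Maximal orders of the algebra of two by two matrices -/

section Matrices

variable (K : Type u) [Field K] [ValuativeRel K] (F : Type v) [Field F] [Algebra K F]

/-- The order of all matrices with integral entries. -/
def integralMatrices : Subring (Matrix (Fin 2) (Fin 2) F) where
  carrier := {N | ∀ i j, N i j ∈ ringOfInt K F}
  mul_mem' := fun {M N} hM hN i j => by
    rw [Matrix.mul_apply]
    exact sum_mem fun k _ => mul_mem (hM i k) (hN k j)
  one_mem' := fun i j => by
    rw [Matrix.one_apply]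
    split_ifs
    exacts [one_mem _, zero_mem _]
  add_mem' := fun hM hN i j => add_mem (hM i j) (hN i j)
  zero_mem' := fun _ _ => zero_mem _
  neg_mem' := fun hM i j => neg_mem (hM i j)

variable {K F}

theorem mem_integralMatrices_iff {N : Matrix (Fin 2) (Fin 2) F} :
    N ∈ integralMatrices K F ↔ N 0 0 ∈ ringOfInt K F ∧ N 0 1 ∈ ringOfInt K F ∧
      N 1 0 ∈ ringOfInt K F ∧ N 1 1 ∈ ringOfInt K F := by
  change (∀ i j, N i j ∈ ringOfInt K F) ↔ _
  simp only [Fin.forall_fin_two]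
  tauto

theorem fin_two_mem_integralMatrices {a b c d : F} (ha : a ∈ ringOfInt K F)
    (hb : b ∈ ringOfInt K F) (hc : c ∈ ringOfInt K F) (hd : d ∈ ringOfInt K F) :
    !![a, b; c, d] ∈ integralMatrices K F :=
  mem_integralMatrices_iff.2 ⟨ha, hb, hc, hd⟩

theorem isOrder_integralMatrices : IsOrder K F (integralMatrices K F) := by
  classical
  have hsum : ∀ N : Matrix (Fin 2) (Fin 2) F,
      N = ∑ i, ∑ j, N i j • Matrix.single i j (1 : F) := by
    intro N
    conv_lhs => rw [Matrix.matrix_eq_sum_single N]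
    simp [Matrix.smul_single]
  have hmem : ∀ i j, Matrix.single i j (1 : F) ∈ integralMatrices K F := by
    intro i j k l
    rw [Matrix.single_apply]
    split_ifs
    exacts [one_mem _, zero_mem _]
  refine ⟨⟨Finset.univ.image fun p : Fin 2 × Fin 2 => Matrix.single p.1 p.2 (1 : F), ?_⟩, ?_⟩
  · apply Set.Subset.antisymm
    · intro N hN
      rw [hsum N]
      refine sum_mem fun i _ => sum_mem fun j _ => ?_
      exact Submodule.smul_mem _ (⟨N i j, hN i j⟩ : ringOfInt K F)
        (Submodule.subset_span (Finset.mem_coe.2 (Finset.mem_image_of_mem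
          (fun p : Fin 2 × Fin 2 => Matrix.single p.1 p.2 (1 : F)) (Finset.mem_univ (i, j)))))
    · intro N hN
      induction hN using Submodule.span_induction with
      | mem N h =>
        simp only [Finset.coe_image, Finset.coe_univ, Set.image_univ, Set.mem_range] at h
        obtain ⟨p, rfl⟩ := h
        exact hmem _ _
      | zero => exact zero_mem _
      | add x y _ _ hx hy => exact add_mem hx hy
      | smul c x _ hx => exact fun i j => mul_mem c.2 (hx i j)
  · rw [eq_top_iff]
    intro N _
    rw [hsum N]
    refine sum_mem fun i _ => sum_mem fun j _ => ?_
    exact Submodule.smul_mem _ _ (Submodule.subset_span (hmem i j))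

/-- An order containing all matrix units contains each entry of its members as a scalar matrix, and
elements of an order are integral. -/
theorem maximal_integralMatrices : Maximal (IsOrder K F) (integralMatrices K F) := by
  refine ⟨isOrder_integralMatrices, fun Λ hΛ hle M hM i j => ?_⟩
  obtain ⟨⟨s, hs⟩, -⟩ := hΛ
  have hsingle : ∀ k l, Matrix.single k l (1 : F) ∈ Λ := by
    intro k l
    apply hle
    intro k' l'
    rw [Matrix.single_apply]
    split_ifs
    exacts [one_mem _, zero_mem _]
  -- Matrix units on both sides move the entry `M i j` to each diagonal place; the sum is the scalar
  -- matrix.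
  have hscalar : algebraMap F (Matrix (Fin 2) (Fin 2) F) (M i j) ∈ Λ := by
    have e : algebraMap F (Matrix (Fin 2) (Fin 2) F) (M i j) =
        ∑ k, Matrix.single k i 1 * M * Matrix.single j k 1 := by
      simp only [Matrix.single_mul_mul_single, one_mul, mul_one]
      ext k l
      fin_cases k <;> fin_cases l <;> simp [Matrix.algebraMap_matrix_apply]
    rw [e]
    exact sum_mem fun k _ => mul_mem (mul_mem (hsingle k i) hM) (hsingle j k)
  let S : Subalgebra (ringOfInt K F) (Matrix (Fin 2) (Fin 2) F) :=
    { Λ with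
      algebraMap_mem' := fun r => by
        have h1 : (1 : Matrix (Fin 2) (Fin 2) F) ∈
            Submodule.span (ringOfInt K F) (s : Set (Matrix (Fin 2) (Fin 2) F)) := by
          have : (1 : Matrix (Fin 2) (Fin 2) F) ∈ (Λ : Set (Matrix (Fin 2) (Fin 2) F)) :=
            one_mem Λ
          rwa [hs] at this
        have h2 := Submodule.smul_mem _ r h1
        rw [← SetLike.mem_coe, ← hs] at h2
        rw [Algebra.algebraMap_eq_smul_one]
        exact h2 }
  have hfg : (Subalgebra.toSubmodule S).FG := by
    refine ⟨s, SetLike.coe_injective ?_⟩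
    rw [← hs]
    rfl
  have h1 : IsIntegral (ringOfInt K F) (algebraMap F (Matrix (Fin 2) (Fin 2) F) (M i j)) :=
    IsIntegral.of_mem_of_fg S hfg _ hscalar
  have h2 : IsIntegral (ringOfInt K F) (M i j) :=
    (isIntegral_algebraMap_iff (algebraMap F (Matrix (Fin 2) (Fin 2) F)).injective).1 h1
  exact isIntegral_trans (R := 𝒪[K]) (A := ringOfInt K F) _ h2

variable (K F) in
/-- The maximal order of all matrices with integral entries. -/
def baseVertex : Vertex K F := ⟨integralMatrices K F, maximal_integralMatrices⟩

/-- Conjugation by an invertible matrix. -/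
def conjAlg (g : GL (Fin 2) F) : Matrix (Fin 2) (Fin 2) F ≃ₐ[F] Matrix (Fin 2) (Fin 2) F :=
  MulSemiringAction.toAlgEquiv F (Matrix (Fin 2) (Fin 2) F) (ConjAct.toConjAct g)

theorem conjAlg_apply (g : GL (Fin 2) F) (M : Matrix (Fin 2) (Fin 2) F) :
    conjAlg g M = g.1 * M * (g⁻¹).1 := rfl

/-- The action of invertible matrices on the vertices, by conjugation. -/
def translate (g : GL (Fin 2) F) (x : Vertex K F) : Vertex K F := x.mapAlg (conjAlg g)

theorem mem_translate_iff {g : GL (Fin 2) F} {x : Vertex K F} {M : Matrix (Fin 2) (Fin 2) F} :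
    M ∈ (translate g x).1 ↔ (g⁻¹).1 * M * g.1 ∈ x.1 := by
  constructor
  · rintro ⟨N, hN, rfl⟩
    have : (g⁻¹).1 * (conjAlg g N) * g.1 = N := by
      rw [conjAlg_apply]
      simp [mul_assoc]
    change (g⁻¹).1 * (conjAlg g N) * g.1 ∈ _
    rw [this]
    exact hN
  · intro h
    refine ⟨_, h, ?_⟩
    change conjAlg g _ = M
    rw [conjAlg_apply]
    simp [mul_assoc]

theorem mem_translate_iff_exists {g : GL (Fin 2) F} {x : Vertex K F}
    {M : Matrix (Fin 2) (Fin 2) F} :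
    M ∈ (translate g x).1 ↔ ∃ N ∈ x.1, M * g.1 = g.1 * N := by
  rw [mem_translate_iff]
  constructor
  · intro h
    exact ⟨_, h, by simp [← mul_assoc]⟩
  · rintro ⟨N, hN, h⟩
    rw [mul_assoc, h, ← mul_assoc]
    simpa using hN

theorem vertex_ext {x y : Vertex K F} (h : ∀ M, M ∈ x.1 ↔ M ∈ y.1) : x = y :=
  Subtype.ext (SetLike.ext h)

theorem translate_mul (g h : GL (Fin 2) F) (x : Vertex K F) :
    translate (g * h) x = translate g (translate h x) := by
  apply vertex_ext
  intro M
  rw [mem_translate_iff, mem_translate_iff, mem_translate_iff, mul_inv_rev]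
  simp [mul_assoc]

theorem translate_one (x : Vertex K F) : translate 1 x = x := by
  apply vertex_ext
  intro M
  rw [mem_translate_iff]
  simp

/-- Scalars and invertible integral matrices stabilize `M₂(𝒪)` under conjugation. The later changes
of coset representative are all reduced to this. -/
theorem translate_baseVertex_eq {g g' : GL (Fin 2) F} {z : F} (hz : z ≠ 0)
    {k k' : Matrix (Fin 2) (Fin 2) F} (hk : k ∈ integralMatrices K F)
    (hk' : k' ∈ integralMatrices K F) (hkk : k * k' = 1) (h : g.1 = z • (g'.1 * k)) :
    translate g (baseVertex K F) = translate g' (baseVertex K F) := by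
  apply vertex_ext
  intro M
  rw [mem_translate_iff_exists, mem_translate_iff_exists]
  have hkk' : k' * k = 1 := mul_eq_one_comm.1 hkk
  constructor
  · rintro ⟨N, hN, e⟩
    refine ⟨k * N * k', mul_mem (mul_mem hk hN) hk', ?_⟩
    rw [h, mul_smul_comm, smul_mul_assoc] at e
    have e' := smul_right_injective _ hz e
    calc M * g'.1 = (M * (g'.1 * k)) * k' := by rw [mul_assoc, mul_assoc, hkk, mul_one]
      _ = _ := by rw [e']; simp only [mul_assoc]
  · rintro ⟨N, hN, e⟩
    refine ⟨k' * N * k, mul_mem (mul_mem hk' hN) hk, ?_⟩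
    rw [h, mul_smul_comm, smul_mul_assoc, ← mul_assoc, e]
    congr 1
    simp only [← mul_assoc]
    rw [mul_assoc g'.1 k k', hkk, mul_one]

end Matrices

/-! ### Vertices as balls, and the Iwasawa decomposition. -/

section Balls

variable {K : Type u} [Field K] [ValuativeRel K] {F : Type v} [Field F] [Algebra K F] {π : F}

namespace IsUniformizer

/-- The matrix of the affine map with image the ball of center `a` and radius `n`. -/
def affine (hπ : IsUniformizer K F π) (a : F) (n : ℤ) : GL (Fin 2) F :=
  ⟨!![π ^ n, a; 0, 1], !![π ^ (-n), -(π ^ (-n) * a); 0, 1], by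
    have := zpow_ne_zero n hπ.ne_zero
    simp [Matrix.one_fin_two, this], by
    have := zpow_ne_zero n hπ.ne_zero
    simp [Matrix.one_fin_two, this]⟩

theorem coe_affine (hπ : IsUniformizer K F π) (a : F) (n : ℤ) :
    (hπ.affine a n).1 = !![π ^ n, a; 0, 1] := rfl

theorem coe_affine_inv (hπ : IsUniformizer K F π) (a : F) (n : ℤ) :
    ((hπ.affine a n)⁻¹).1 = !![π ^ (-n), -(π ^ (-n) * a); 0, 1] := rfl

theorem affine_mul (hπ : IsUniformizer K F π) (a b : F) (n m : ℤ) :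
    hπ.affine a n * hπ.affine b m = hπ.affine (π ^ n * b + a) (n + m) := by
  apply Units.ext
  rw [Units.val_mul, coe_affine, coe_affine, coe_affine, zpow_add₀ hπ.ne_zero]
  simp

/-- The vertex attached to the ball of center `a` and radius `n`, in the coordinates given
by `c`. -/
def ballVertex (hπ : IsUniformizer K F π) (c : GL (Fin 2) F) (a : F) (n : ℤ) : Vertex K F :=
  translate (c * hπ.affine a n) (baseVertex K F)

theorem ballVertex_eq_translate (hπ : IsUniformizer K F π) (c : GL (Fin 2) F) (a : F) (n : ℤ) :
    hπ.ballVertex c a n = translate c (hπ.ballVertex 1 a n) := by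
  rw [ballVertex, ballVertex, one_mul, translate_mul]

/-- Conjugating `M` by the affine matrix gives these four entries. The radius enters only off the
diagonal, with opposite signs, which is the source of every convexity statement about branches. -/
theorem mem_ballVertex_one_iff (hπ : IsUniformizer K F π) {a : F} {n : ℤ}
    {M : Matrix (Fin 2) (Fin 2) F} :
    M ∈ (hπ.ballVertex 1 a n).1 ↔ M 0 0 - a * M 1 0 ∈ ringOfInt K F ∧
      PowDvd (K := K) π n (M 0 1 + (M 0 0 - M 1 1) * a - M 1 0 * a ^ 2) ∧
      PowDvd (K := K) π (-n) (M 1 0) ∧ M 1 0 * a + M 1 1 ∈ ringOfInt K F := by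
  have h := zpow_ne_zero n hπ.ne_zero
  rw [ballVertex, one_mul, mem_translate_iff]
  change _ ∈ integralMatrices K F ↔ _
  have e : ((hπ.affine a n)⁻¹).1 * M * (hπ.affine a n).1 =
      !![M 0 0 - a * M 1 0, π ^ (-n) * (M 0 1 + (M 0 0 - M 1 1) * a - M 1 0 * a ^ 2);
        π ^ n * M 1 0, M 1 0 * a + M 1 1] := by
    rw [coe_affine, coe_affine_inv]
    obtain ⟨p, q, r, s, rfl⟩ : ∃ p q r s, M = !![p, q; r, s] :=
      ⟨_, _, _, _, Matrix.eta_fin_two _⟩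
    ext i j
    fin_cases i <;> fin_cases j <;> simp <;> field_simp <;> ring
  rw [e, mem_integralMatrices_iff, PowDvd, PowDvd, neg_neg]
  rfl

theorem mem_ballVertex_iff (hπ : IsUniformizer K F π) {c : GL (Fin 2) F} {a : F} {n : ℤ}
    {M : Matrix (Fin 2) (Fin 2) F} :
    M ∈ (hπ.ballVertex c a n).1 ↔ (c⁻¹).1 * M * c.1 ∈ (hπ.ballVertex 1 a n).1 := by
  rw [ballVertex_eq_translate, mem_translate_iff]

theorem ballVertex_eq_iff (hπ : IsUniformizer K F π) {c : GL (Fin 2) F} {a b : F} {n m : ℤ} :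
    hπ.ballVertex c a n = hπ.ballVertex c b m ↔ n = m ∧ PowDvd (K := K) π n (a - b) := by
  constructor
  · intro h
    have key : ∀ {a b : F} {n m : ℤ}, hπ.ballVertex 1 a n = hπ.ballVertex 1 b m →
        n ≤ m ∧ PowDvd (K := K) π n (a - b) := by
      intro a b n m h
      have h0 := zpow_ne_zero n hπ.ne_zero
      -- This is the lower left matrix unit conjugated by the affine matrix of `(a, n)`. Its
      -- membership in the order of `(b, m)` gives both the bound on the radius and the congruence
      -- of the centers.
      have hM : !![a * π ^ (-n), -(a * π ^ (-n) * a); π ^ (-n), -(π ^ (-n) * a)] ∈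
          (hπ.ballVertex 1 a n).1 := by
        rw [mem_ballVertex_one_iff]
        simp only [Matrix.of_apply, Matrix.cons_val', Matrix.cons_val_zero, Matrix.cons_val_one,
          Matrix.cons_val_fin_one]
        refine ⟨?_, ?_, ?_, ?_⟩
        · rw [sub_self]; exact zero_mem _
        · convert PowDvd.zero using 1
          ring
        · rw [PowDvd, neg_neg, ← zpow_add₀ hπ.ne_zero, add_neg_cancel, zpow_zero]
          exact one_mem _
        · rw [add_neg_cancel]; exact zero_mem _
      rw [h, mem_ballVertex_one_iff] at hM
      simp only [Matrix.of_apply, Matrix.cons_val', Matrix.cons_val_zero, Matrix.cons_val_one,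
          Matrix.cons_val_fin_one] at hM
      obtain ⟨h1, -, h2, -⟩ := hM
      constructor
      · rw [PowDvd, neg_neg, ← zpow_add₀ hπ.ne_zero, hπ.zpow_mem_iff] at h2
        omega
      · rw [PowDvd]
        convert h1 using 1
        ring
    have h' : hπ.ballVertex 1 a n = hπ.ballVertex 1 b m := by
      have := congrArg (translate c⁻¹) h
      simpa only [ballVertex_eq_translate hπ c, ← translate_mul, inv_mul_cancel,
        translate_one] using this
    obtain ⟨h1, h2⟩ := key h'
    exact ⟨le_antisymm h1 (key h'.symm).1, h2⟩
  · rintro ⟨rfl, h⟩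
    refine translate_baseVertex_eq one_ne_zero (k := !![1, π ^ (-n) * (a - b); 0, 1])
      (k' := !![1, -(π ^ (-n) * (a - b)); 0, 1])
      (fin_two_mem_integralMatrices (one_mem _) h (zero_mem _) (one_mem _))
      (fin_two_mem_integralMatrices (one_mem _) (neg_mem h) (zero_mem _) (one_mem _))
      (by simp [Matrix.one_fin_two]) ?_
    have h0 := zpow_ne_zero n hπ.ne_zero
    rw [one_smul, Units.val_mul, Units.val_mul, mul_assoc, coe_affine, coe_affine]
    congr 1
    simp [h0]

/-- A variant of the Iwasawa decomposition. -/
theorem exists_translate_eq (hπ : IsUniformizer K F π) (g : GL (Fin 2) F) :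
    ∃ a n, (translate g (baseVertex K F) = hπ.ballVertex 1 a n ∧
        translate (g * hπ.affine 0 1) (baseVertex K F) = hπ.ballVertex 1 a (n + 1)) ∨
      (translate g (baseVertex K F) = hπ.ballVertex 1 a (n + 1) ∧
        translate (g * hπ.affine 0 1) (baseVertex K F) = hπ.ballVertex 1 a n) := by
  obtain ⟨p, q, r, s, hg⟩ : ∃ p q r s, g.1 = !![p, q; r, s] := ⟨_, _, _, _, Matrix.eta_fin_two _⟩
  have hdet : p * s - q * r ≠ 0 := by
    have := g.isUnit.map (Matrix.detMonoidHom)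
    change IsUnit (Matrix.det g.1) at this
    rw [hg, Matrix.det_fin_two_of] at this
    exact this.ne_zero
  have hgD : (g * hπ.affine 0 1).1 = !![p * π, q; r * π, s] := by
    rw [Units.val_mul, hg, coe_affine]
    simp
  have hπ0 := hπ.ne_zero
  -- Column reduction uses whichever bottom entry divides the other. If `s` divides `r`, it is the
  -- pivot; if not, `r` is, and `s / r` is divisible by `π`. That extra factor allows the same
  -- reduction after multiplication by `diag(π, 1)`, so both ends of an edge receive the same
  -- center.
  by_cases hA : s ≠ 0 ∧ r / s ∈ ringOfInt K F
  · obtain ⟨hs, hrs⟩ := hA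
    have hδ : (p * s - q * r) / s ^ 2 ≠ 0 := div_ne_zero hdet (pow_ne_zero 2 hs)
    obtain ⟨n, u, hu, hu', hu0, hδu⟩ := hπ.exists_eq hδ
    have hp : p = s * (π ^ n * u) + q * (r / s) := by
      rw [← hδu]
      field_simp
      ring
    refine ⟨q / s, n, Or.inl ⟨?_, ?_⟩⟩
    · refine translate_baseVertex_eq hs (k := !![u, 0; r / s, 1])
        (k' := !![u⁻¹, 0; -(r / s) * u⁻¹, 1])
        (fin_two_mem_integralMatrices hu (zero_mem _) hrs (one_mem _))
        (fin_two_mem_integralMatrices hu' (zero_mem _) (mul_mem (neg_mem hrs) hu') (one_mem _))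
        (by simp [Matrix.one_fin_two, hu0]) ?_
      rw [one_mul, hg, coe_affine, hp]
      ext i j
      fin_cases i <;> fin_cases j <;> simp <;> field_simp
    · refine translate_baseVertex_eq hs (k := !![u, 0; π * (r / s), 1])
        (k' := !![u⁻¹, 0; -(π * (r / s)) * u⁻¹, 1])
        (fin_two_mem_integralMatrices hu (zero_mem _) (mul_mem hπ.mem hrs) (one_mem _))
        (fin_two_mem_integralMatrices hu' (zero_mem _)
          (mul_mem (neg_mem (mul_mem hπ.mem hrs)) hu') (one_mem _))
        (by simp [Matrix.one_fin_two, hu0]) ?_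
      rw [one_mul, hgD, coe_affine, hp, zpow_add_one₀ hπ0]
      ext i j
      fin_cases i <;> fin_cases j <;> simp <;> field_simp
  · have hr : r ≠ 0 := by
      rintro rfl
      refine hA ⟨?_, by rw [zero_div]; exact zero_mem _⟩
      rintro rfl
      simp at hdet
    have hsr : PowDvd (K := K) π 1 (s / r) := by
      rcases eq_or_ne s 0 with rfl | hs
      · rw [zero_div]; exact PowDvd.zero
      · obtain ⟨n, h1, h2⟩ := hπ.exists_ord (div_ne_zero hs hr)
        rw [h1]
        by_contra hn
        apply hA
        refine ⟨hs, ?_⟩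
        rw [← inv_div, ← powDvd_zero_iff (π := π), h2]
        omega
    have hsr0 : s / r ∈ ringOfInt K F := by
      rw [← powDvd_zero_iff (π := π)]
      exact hπ.powDvd_mono hsr zero_le_one
    have hδ : -(p * s - q * r) / r ^ 2 ≠ 0 := div_ne_zero (neg_ne_zero.2 hdet) (pow_ne_zero 2 hr)
    obtain ⟨n, u, hu, hu', hu0, hδu⟩ := hπ.exists_eq hδ
    have hq : q = r * (π ^ n * u) + p * (s / r) := by
      rw [← hδu]
      field_simp
      ring
    refine ⟨p / r, n - 1, Or.inr ⟨?_, ?_⟩⟩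
    · refine translate_baseVertex_eq hr (k := !![0, u; 1, s / r])
        (k' := !![-(s / r) * u⁻¹, 1; u⁻¹, 0])
        (fin_two_mem_integralMatrices (zero_mem _) hu (one_mem _) hsr0)
        (fin_two_mem_integralMatrices (mul_mem (neg_mem hsr0) hu') (one_mem _) hu' (zero_mem _))
        (by simp [Matrix.one_fin_two, hu0]) ?_
      rw [one_mul, hg, coe_affine, hq, sub_add_cancel]
      ext i j
      fin_cases i <;> fin_cases j <;> simp <;> field_simp
    · rw [PowDvd, zpow_neg_one] at hsr
      refine translate_baseVertex_eq (mul_ne_zero hr hπ0) (k := !![0, u; 1, π⁻¹ * (s / r)])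
        (k' := !![-(π⁻¹ * (s / r)) * u⁻¹, 1; u⁻¹, 0])
        (fin_two_mem_integralMatrices (zero_mem _) hu (one_mem _) hsr)
        (fin_two_mem_integralMatrices (mul_mem (neg_mem hsr) hu') (one_mem _) hu' (zero_mem _))
        (by simp [Matrix.one_fin_two, hu0]) ?_
      rw [one_mul, hgD, coe_affine, hq, zpow_sub_one₀ hπ0]
      ext i j
      fin_cases i <;> fin_cases j <;> simp <;> field_simp

end IsUniformizer

end Balls

/-! ### The ball model of the Bruhat–Tits tree -/

section Lattices

variable {K : Type u} [Field K] [ValuativeRel K] {F : Type v} [Field F] [Algebra K F] {π : F}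

namespace IsUniformizer

theorem div_mem_or (hπ : IsUniformizer K F π) {x y : F} (hx : x ≠ 0) (hy : y ≠ 0) :
    x / y ∈ ringOfInt K F ∨ y / x ∈ ringOfInt K F := by
  obtain ⟨n, h1, h2⟩ := hπ.exists_ord (div_ne_zero hx hy)
  rw [← inv_div x y, ← powDvd_zero_iff (π := π), ← powDvd_zero_iff (π := π), h1, h2]
  omega

/-- A finite family of elements, not all zero, has a member dividing all of them. -/
theorem exists_forall_div_mem (hπ : IsUniformizer K F π) {ι : Type*} (T : Finset ι) (c : ι → F)
    (h : ∃ t ∈ T, c t ≠ 0) :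
    ∃ t₀ ∈ T, c t₀ ≠ 0 ∧ ∀ t ∈ T, c t / c t₀ ∈ ringOfInt K F := by
  classical
  induction T using Finset.induction_on with
  | empty => simp at h
  | insert a T _ ih =>
    by_cases hT : ∃ t ∈ T, c t ≠ 0
    · obtain ⟨t₀, h1, h2, h3⟩ := ih hT
      by_cases ha : c a / c t₀ ∈ ringOfInt K F
      · refine ⟨t₀, Finset.mem_insert_of_mem h1, h2, fun t ht => ?_⟩
        rcases Finset.mem_insert.1 ht with rfl | ht
        exacts [ha, h3 t ht]
      · have ha0 : c a ≠ 0 := fun h0 => ha (by rw [h0, zero_div]; exact zero_mem _)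
        have h4 := (hπ.div_mem_or ha0 h2).resolve_left ha
        refine ⟨a, Finset.mem_insert_self _ _, ha0, fun t ht => ?_⟩
        rcases Finset.mem_insert.1 ht with rfl | ht
        · rw [div_self ha0]; exact one_mem _
        · have := mul_mem (h3 t ht) h4
          rwa [div_mul_div_cancel₀ h2] at this
    · push Not at hT
      obtain ⟨t, ht, ht0⟩ := h
      rcases Finset.mem_insert.1 ht with rfl | ht
      · refine ⟨t, Finset.mem_insert_self _ _, ht0, fun t' ht' => ?_⟩
        rcases Finset.mem_insert.1 ht' with rfl | ht'
        · rw [div_self ht0]; exact one_mem _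
        · rw [hT t' ht', zero_div]; exact zero_mem _
      · exact absurd (hT t ht) ht0

/-- A finitely generated submodule of the plane that contains the standard basis is free. -/
theorem exists_basis_of_span (hπ : IsUniformizer K F π) (T : Finset (Fin 2 → F))
    (hT : ∀ i, Pi.single i 1 ∈ Submodule.span (ringOfInt K F) (T : Set (Fin 2 → F))) :
    ∃ g : GL (Fin 2) F, ∀ v, v ∈ Submodule.span (ringOfInt K F) (T : Set (Fin 2 → F)) ↔
      ∃ w : Fin 2 → F, (∀ i, w i ∈ ringOfInt K F) ∧ v = g.1.mulVec w := by
  set N := Submodule.span (ringOfInt K F) (T : Set (Fin 2 → F))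
  have h1 : ∃ t ∈ T, t 1 ≠ 0 := by
    by_contra! h
    have : ∀ v ∈ N, v 1 = 0 := by
      intro v hv
      induction hv using Submodule.span_induction with
      | mem v hv => exact h v hv
      | zero => rfl
      | add x y _ _ hx hy => rw [Pi.add_apply, hx, hy, add_zero]
      | smul c x _ hx => rw [Pi.smul_apply, hx, smul_zero]
    simpa using this _ (hT 1)
  -- Hermite normal form: `t₀` has the second coordinate of least order. After its multiples are
  -- subtracted, `t₁` has the first coordinate of least order, and `(d, 0)` together with `t₀` is
  -- the basis.
  obtain ⟨t₀, ht₀, h0, hdiv⟩ := hπ.exists_forall_div_mem T (fun t => t 1) h1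
  have h2 : ∃ t ∈ T, t 0 - t 1 / t₀ 1 * t₀ 0 ≠ 0 := by
    by_contra! h
    have : ∀ v ∈ N, v 0 - v 1 / t₀ 1 * t₀ 0 = 0 := by
      intro v hv
      induction hv using Submodule.span_induction with
      | mem v hv => exact h v hv
      | zero => simp
      | add x y _ _ hx hy =>
        simp only [Pi.add_apply]
        linear_combination hx + hy
      | smul c x _ hx =>
        change (c : F) * x 0 - (c : F) * x 1 / t₀ 1 * t₀ 0 = 0
        linear_combination (c : F) * hx
    simpa using this _ (hT 0)
  obtain ⟨t₁, ht₁, hd, hdiv'⟩ :=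
    hπ.exists_forall_div_mem T (fun t => t 0 - t 1 / t₀ 1 * t₀ 0) h2
  set d := t₁ 0 - t₁ 1 / t₀ 1 * t₀ 0 with hd_def
  have hdet : Matrix.det !![d, t₀ 0; 0, t₀ 1] ≠ 0 := by
    rw [Matrix.det_fin_two_of]
    simpa using ⟨hd, h0⟩
  refine ⟨Matrix.GeneralLinearGroup.mkOfDetNeZero _ hdet, fun v => ?_⟩
  have hg : ∀ w : Fin 2 → F, (Matrix.GeneralLinearGroup.mkOfDetNeZero _ hdet).1.mulVec w =
      ![d * w 0 + t₀ 0 * w 1, t₀ 1 * w 1] := by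
    intro w
    change Matrix.mulVec !![d, t₀ 0; 0, t₀ 1] w = _
    ext i
    fin_cases i <;> simp [Matrix.mulVec, dotProduct, Fin.sum_univ_two]
  constructor
  · intro hv
    refine ⟨![(v 0 - v 1 / t₀ 1 * t₀ 0) / d, v 1 / t₀ 1], ?_, ?_⟩
    · rw [Fin.forall_fin_two]
      simp only [Matrix.cons_val_zero, Matrix.cons_val_one]
      induction hv using Submodule.span_induction with
      | mem v hv => exact ⟨hdiv' v hv, hdiv v hv⟩
      | zero => simp [zero_mem]
      | add x y _ _ hx hy =>
        simp only [Pi.add_apply]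
        refine ⟨?_, ?_⟩
        · convert add_mem hx.1 hy.1 using 1
          ring
        · convert add_mem hx.2 hy.2 using 1
          ring
      | smul c x _ hx =>
        change ((c : F) * x 0 - (c : F) * x 1 / t₀ 1 * t₀ 0) / d ∈ _ ∧ (c : F) * x 1 / t₀ 1 ∈ _
        refine ⟨?_, ?_⟩
        · convert mul_mem c.2 hx.1 using 1
          ring
        · convert mul_mem c.2 hx.2 using 1
          ring
    · rw [hg]
      ext i
      fin_cases i
      · simp only [Matrix.cons_val_zero, Matrix.cons_val_one, Fin.zero_eta, Fin.isValue]
        field_simp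
        ring
      · simp only [Matrix.cons_val_zero, Matrix.cons_val_one, Fin.mk_one, Fin.isValue]
        field_simp
  · rintro ⟨w, hw, rfl⟩
    rw [hg]
    have e : (![d * w 0 + t₀ 0 * w 1, t₀ 1 * w 1] : Fin 2 → F) =
        (⟨w 0, hw 0⟩ : ringOfInt K F) • (t₁ - (⟨t₁ 1 / t₀ 1, hdiv t₁ ht₁⟩ : ringOfInt K F) • t₀) +
          (⟨w 1, hw 1⟩ : ringOfInt K F) • t₀ := by
      ext i
      fin_cases i
      · change d * w 0 + t₀ 0 * w 1 = w 0 * (t₁ 0 - t₁ 1 / t₀ 1 * t₀ 0) + w 1 * t₀ 0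
        rw [hd_def]; ring
      · change t₀ 1 * w 1 = w 0 * (t₁ 1 - t₁ 1 / t₀ 1 * t₀ 1) + w 1 * t₀ 1
        field_simp
        ring
    rw [e]
    have m0 : t₀ ∈ N := Submodule.subset_span ht₀
    have m1 : t₁ ∈ N := Submodule.subset_span ht₁
    exact add_mem (Submodule.smul_mem _ _ (sub_mem m1 (Submodule.smul_mem _ _ m0)))
      (Submodule.smul_mem _ _ m0)

/-- A ring of matrices which is finitely generated as a module is contained in a vertex. -/
theorem exists_translate_le (hπ : IsUniformizer K F π) (Λ : Subring (Matrix (Fin 2) (Fin 2) F))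
    (hΛ : ∃ s : Finset (Matrix (Fin 2) (Fin 2) F), (Λ : Set (Matrix (Fin 2) (Fin 2) F)) =
      Submodule.span (ringOfInt K F) (s : Set (Matrix (Fin 2) (Fin 2) F))) :
    ∃ g : GL (Fin 2) F, Λ ≤ (translate g (baseVertex K F)).1 := by
  classical
  obtain ⟨s, hs⟩ := hΛ
  have hmem : ∀ M, M ∈ Λ ↔ M ∈ Submodule.span (ringOfInt K F)
      (s : Set (Matrix (Fin 2) (Fin 2) F)) := fun M => by
    rw [← SetLike.mem_coe, hs, SetLike.mem_coe]
  -- The columns of the generators span the lattice `Λ 𝒪²`. It is stable under `Λ` and contains the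
  -- standard basis because `1 ∈ Λ`; in a basis of it, `Λ` has integral entries.
  let T : Finset (Fin 2 → F) :=
    (s ×ˢ Finset.univ).image fun p : Matrix (Fin 2) (Fin 2) F × Fin 2 => fun k => p.1 k p.2
  set N := Submodule.span (ringOfInt K F) (T : Set (Fin 2 → F)) with hN
  have hcol : ∀ M ∈ Λ, ∀ j, (fun k => M k j) ∈ N := by
    intro M hM j
    rw [hmem] at hM
    induction hM using Submodule.span_induction with
    | mem M hM =>
      refine Submodule.subset_span (Finset.mem_coe.2 (Finset.mem_image.2 ⟨(M, j), ?_, rfl⟩))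
      exact Finset.mem_product.2 ⟨hM, Finset.mem_univ _⟩
    | zero => exact zero_mem _
    | add x y _ _ hx hy => exact add_mem hx hy
    | smul c x _ hx => exact Submodule.smul_mem _ _ hx
  have hstab : ∀ M ∈ Λ, ∀ v ∈ N, M.mulVec v ∈ N := by
    intro M hM v hv
    induction hv using Submodule.span_induction with
    | mem v hv =>
      obtain ⟨⟨M', j⟩, h1, rfl⟩ := Finset.mem_image.1 (Finset.mem_coe.1 hv)
      have h2 : M' ∈ Λ := (hmem M').2 (Submodule.subset_span (Finset.mem_product.1 h1).1)
      exact hcol (M * M') (mul_mem hM h2) j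
    | zero => rw [Matrix.mulVec_zero]; exact zero_mem _
    | add x y _ _ hx hy => rw [Matrix.mulVec_add]; exact add_mem hx hy
    | smul c x _ hx =>
      have : M.mulVec (c • x) = c • M.mulVec x := Matrix.mulVec_smul M (c : F) x
      rw [this]
      exact Submodule.smul_mem _ _ hx
  obtain ⟨g, hg⟩ := hπ.exists_basis_of_span T fun i => by
    have := hcol 1 (one_mem _) i
    convert this using 1
    ext k
    rw [Matrix.one_apply, Pi.single_apply]
  refine ⟨g, fun M hM => ?_⟩
  have hgcol : ∀ j, ∃ w : Fin 2 → F, (∀ i, w i ∈ ringOfInt K F) ∧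
      M.mulVec (fun k => g.1 k j) = g.1.mulVec w := by
    intro j
    refine (hg _).1 (hstab M hM _ ((hg _).2 ⟨Pi.single j 1, fun i => ?_, ?_⟩))
    · rw [Pi.single_apply]
      split_ifs
      exacts [one_mem _, zero_mem _]
    · rw [Matrix.mulVec_single_one]
      rfl
  choose w hw hMw using hgcol
  rw [mem_translate_iff_exists]
  refine ⟨Matrix.of fun i j => w j i, fun i j => hw j i, ?_⟩
  ext i j
  exact congrFun (hMw j) i

/-- A maximal order lies in some conjugate of `M₂(𝒪)`, hence equals it, and the Iwasawa
decomposition writes that conjugate as a ball. -/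
theorem exists_ballVertex_eq (hπ : IsUniformizer K F π) (c : GL (Fin 2) F) (x : Vertex K F) :
    ∃ a n, x = hπ.ballVertex c a n := by
  obtain ⟨g, hg⟩ := hπ.exists_translate_le (translate c⁻¹ x).1 (translate c⁻¹ x).2.1.1
  have h1 : translate c⁻¹ x = translate g (baseVertex K F) := by
    refine vertex_ext fun M => ⟨fun h => hg h, fun h => ?_⟩
    exact (translate c⁻¹ x).2.2 (translate g (baseVertex K F)).2.1 hg h
  obtain ⟨a, n, ⟨h2, -⟩ | ⟨h2, -⟩⟩ := hπ.exists_translate_eq g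
  · refine ⟨a, n, ?_⟩
    rw [ballVertex_eq_translate, ← h2, ← h1, ← translate_mul, mul_inv_cancel, translate_one]
  · refine ⟨a, n + 1, ?_⟩
    rw [ballVertex_eq_translate, ← h2, ← h1, ← translate_mul, mul_inv_cancel, translate_one]

theorem exists_ballVertex_ge (hπ : IsUniformizer K F π) (c : GL (Fin 2) F)
    (Λ : Subring (Matrix (Fin 2) (Fin 2) F))
    (hΛ : ∃ s : Finset (Matrix (Fin 2) (Fin 2) F), (Λ : Set (Matrix (Fin 2) (Fin 2) F)) =
      Submodule.span (ringOfInt K F) (s : Set (Matrix (Fin 2) (Fin 2) F))) :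
    ∃ a n, Λ ≤ (hπ.ballVertex c a n).1 := by
  obtain ⟨g, hg⟩ := hπ.exists_translate_le Λ hΛ
  obtain ⟨a, n, h⟩ := hπ.exists_ballVertex_eq c (translate g (baseVertex K F))
  exact ⟨a, n, h ▸ hg⟩

theorem mem_ballVertex_one_zero_one_iff (hπ : IsUniformizer K F π) {n : ℤ}
    {M : Matrix (Fin 2) (Fin 2) F} :
    M ∈ (hπ.ballVertex 1 0 n).1 ↔ M ∈ stdOrder K F π n := by
  rw [mem_ballVertex_one_iff]
  simp only [zero_mul, sub_zero, mul_zero, add_zero, zero_add, PowDvd, neg_neg, ne_eq,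
    OfNat.ofNat_ne_zero, not_false_eq_true, zero_pow]
  rfl

theorem mem_stdOrder_iff (hπ : IsUniformizer K F π) {ϖ : ringOfInt K F} (hϖ : Irreducible ϖ)
    {n : ℤ} {M : Matrix (Fin 2) (Fin 2) F} :
    M ∈ stdOrder K F ϖ n ↔ M ∈ stdOrder K F π n := by
  obtain ⟨u, h1, h2, h0, hu⟩ := (hπ.irreducible_iff ϖ).1 hϖ
  have hz : ∀ m : ℤ, u ^ m ∈ ringOfInt K F := zpow_mem_of_inv_mem h1 h2
  have key : ∀ (m : ℤ) (x : F), (ϖ : F) ^ m * x ∈ ringOfInt K F ↔ π ^ m * x ∈ ringOfInt K F := by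
    intro m x
    rw [hu, mul_zpow]
    constructor
    · intro h
      have := mul_mem (hz (-m)) h
      rwa [mul_assoc, mul_left_comm, ← mul_assoc (u ^ (-m)), ← zpow_add₀ h0, neg_add_cancel,
        zpow_zero, one_mul] at this
    · intro h
      have := mul_mem (hz m) h
      rwa [← mul_assoc, mul_comm (u ^ m)] at this
  change (_ ∧ _ ∧ _ ∧ _) ↔ (_ ∧ _ ∧ _ ∧ _)
  rw [key, key]

theorem ballVertex_eq_translate_mul (hπ : IsUniformizer K F π) (g : GL (Fin 2) F) (n : ℤ) :
    translate (g * hπ.affine 0 n) (baseVertex K F) = translate g (hπ.ballVertex 1 0 n) := by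
  rw [ballVertex, one_mul, translate_mul]

/-- The ball model of the Bruhat–Tits tree in the coordinates given by `c`. -/
def ballModel (hπ : IsUniformizer K F π) (c : GL (Fin 2) F) : BallModel (bruhatTits K F) F where
  ball := hπ.ballVertex c
  surj := hπ.exists_ballVertex_eq c
  level_eq := fun h => (hπ.ballVertex_eq_iff.1 h).1
  mono := fun h hm => hπ.ballVertex_eq_iff.2
    ⟨rfl, hπ.powDvd_mono (hπ.ballVertex_eq_iff.1 h).2 hm⟩
  join := fun a b => by
    rcases eq_or_ne (a - b) 0 with h | h
    · rw [sub_eq_zero.1 h]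
      exact ⟨0, rfl⟩
    · obtain ⟨n, hn, -⟩ := hπ.exists_ord h
      exact ⟨n, hπ.ballVertex_eq_iff.2 ⟨rfl, (hn n).2 le_rfl⟩⟩
  adj_iff := by
    have hconj : ∀ {g : GL (Fin 2) F} {x : Vertex K F} {n : ℤ} {ϖ : ringOfInt K F},
        Irreducible ϖ → ((∀ M : Matrix (Fin 2) (Fin 2) F,
          (M ∈ x.1 ↔ (g⁻¹).1 * M * g.1 ∈ stdOrder K F ϖ n)) ↔
            x = translate (g * hπ.affine 0 n) (baseVertex K F)) := by
      intro g x n ϖ hϖ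
      rw [ballVertex_eq_translate_mul]
      simp only [hπ.mem_stdOrder_iff hϖ, ← hπ.mem_ballVertex_one_zero_one_iff,
        ← mem_translate_iff]
      exact ⟨fun h => vertex_ext h, fun h M => by rw [h]⟩
    have haff : hπ.affine 0 0 = 1 := by
      apply Units.ext
      rw [coe_affine]
      simp [Matrix.one_fin_two]
    -- Adjacency in group terms: `x` and `y` come from `g` and `g * diag(π, 1)`. The choice of
    -- irreducible element in the definition does not matter.
    have hR : ∀ {x y : Vertex K F}, (∃ (g : GL (Fin 2) F) (ϖ : ringOfInt K F), Irreducible ϖ ∧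
        ∀ M : Matrix (Fin 2) (Fin 2) F, (M ∈ x.1 ↔ (g⁻¹).1 * M * g.1 ∈ stdOrder K F ϖ 0) ∧
          (M ∈ y.1 ↔ (g⁻¹).1 * M * g.1 ∈ stdOrder K F ϖ 1)) ↔
        ∃ g : GL (Fin 2) F, x = translate g (baseVertex K F) ∧
          y = translate (g * hπ.affine 0 1) (baseVertex K F) := by
      intro x y
      have hirr : Irreducible (⟨π, hπ.mem⟩ : ringOfInt K F) :=
        (hπ.irreducible_iff _).2 ⟨1, one_mem _, by simp [one_mem], one_ne_zero, by simp⟩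
      constructor
      · rintro ⟨g, ϖ, hϖ, h⟩
        have h1 := (hconj hϖ).1 fun M => (h M).1
        rw [haff, mul_one] at h1
        exact ⟨g, h1, (hconj hϖ).1 fun M => (h M).2⟩
      · rintro ⟨g, h1, h2⟩
        refine ⟨g, ⟨π, hπ.mem⟩, hirr, fun M => ⟨?_, ?_⟩⟩
        · rw [← mul_one g, ← haff] at h1
          exact (hconj hirr).2 h1 M
        · exact (hconj hirr).2 h2 M
    have hR' : ∀ {x y : Vertex K F}, (∃ g : GL (Fin 2) F, x = translate g (baseVertex K F) ∧
          y = translate (g * hπ.affine 0 1) (baseVertex K F)) →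
        ∃ a n, (x = hπ.ballVertex c a n ∧ y = hπ.ballVertex c a (n + 1)) ∨
          (y = hπ.ballVertex c a n ∧ x = hπ.ballVertex c a (n + 1)) := by
      rintro x y ⟨g, rfl, rfl⟩
      have e : ∀ h : GL (Fin 2) F, translate (g * h) (baseVertex K F) =
          translate c (translate (c⁻¹ * g * h) (baseVertex K F)) := by
        intro h
        rw [← translate_mul, mul_assoc, mul_inv_cancel_left]
      have e' := e 1
      rw [mul_one, mul_one] at e'
      obtain ⟨a, n, ⟨h1, h2⟩ | ⟨h1, h2⟩⟩ := hπ.exists_translate_eq (c⁻¹ * g)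
      · refine ⟨a, n, Or.inl ⟨?_, ?_⟩⟩
        · rw [ballVertex_eq_translate, e', h1]
        · rw [ballVertex_eq_translate, e, h2]
      · refine ⟨a, n, Or.inr ⟨?_, ?_⟩⟩
        · rw [ballVertex_eq_translate, e, h2]
        · rw [ballVertex_eq_translate, e', h1]
    have hball : ∀ a n, ∃ g : GL (Fin 2) F, hπ.ballVertex c a n = translate g (baseVertex K F) ∧
        hπ.ballVertex c a (n + 1) = translate (g * hπ.affine 0 1) (baseVertex K F) := by
      intro a n
      refine ⟨c * hπ.affine a n, rfl, ?_⟩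
      rw [mul_assoc, affine_mul, mul_zero, zero_add]
      rfl
    intro x y
    rw [bruhatTits, SimpleGraph.fromRel_adj, hR, hR]
    constructor
    · rintro ⟨-, h | h⟩
      · exact hR' h
      · obtain ⟨a, n, h⟩ := hR' h
        exact ⟨a, n, h.symm⟩
    · rintro ⟨a, n, ⟨rfl, rfl⟩ | ⟨rfl, rfl⟩⟩
      · refine ⟨fun h => ?_, Or.inl (hball a n)⟩
        have := (hπ.ballVertex_eq_iff.1 h).1
        omega
      · refine ⟨fun h => ?_, Or.inr (hball a n)⟩
        have := (hπ.ballVertex_eq_iff.1 h).1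
        omega

theorem ball_ballModel (hπ : IsUniformizer K F π) (c : GL (Fin 2) F) (a : F) (n : ℤ) :
    (hπ.ballModel c).ball a n = hπ.ballVertex c a n := rfl

/-- If a matrix belongs to two concentric balls then it belongs to all balls between. -/
theorem mem_ballVertex_between (hπ : IsUniformizer K F π) {a : F} {k j n : ℤ}
    {M : Matrix (Fin 2) (Fin 2) F} (hk : M ∈ (hπ.ballVertex 1 a k).1)
    (hn : M ∈ (hπ.ballVertex 1 a n).1) (h1 : k ≤ j) (h2 : j ≤ n) :
    M ∈ (hπ.ballVertex 1 a j).1 := by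
  rw [mem_ballVertex_one_iff] at hk hn ⊢
  exact ⟨hk.1, hπ.powDvd_mono hn.2.1 h2, hπ.powDvd_mono hk.2.2.1 (by omega), hk.2.2.2⟩

/-- For disjoint balls, subtracting the first conditions at `a` and `b` shows that `(a - b) * M 1 0`
is integral. This is exactly the lower left condition at the smallest ball containing both. For
nested balls the larger one serves. -/
theorem exists_join (hπ : IsUniformizer K F π) (a b : F) (n m : ℤ) :
    ∃ k, k ≤ n ∧ k ≤ m ∧ PowDvd (K := K) π k (a - b) ∧
      ∀ M : Matrix (Fin 2) (Fin 2) F, M ∈ (hπ.ballVertex 1 a n).1 →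
        M ∈ (hπ.ballVertex 1 b m).1 → M ∈ (hπ.ballVertex 1 a k).1 := by
  by_cases hmin : PowDvd (K := K) π (min n m) (a - b)
  · refine ⟨min n m, min_le_left _ _, min_le_right _ _, hmin, fun M h1 h2 => ?_⟩
    rcases min_choice n m with h | h
    · rw [h]; exact h1
    · rw [h] at hmin ⊢
      rwa [hπ.ballVertex_eq_iff.2 ⟨rfl, hmin⟩]
  · have hab : a - b ≠ 0 := fun h => hmin (by rw [h]; exact PowDvd.zero)
    obtain ⟨k, hk, hk'⟩ := hπ.exists_ord hab
    have hlt : k < min n m := by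
      rw [hk] at hmin
      omega
    refine ⟨k, by omega, by omega, (hk k).2 le_rfl, fun M h1 h2 => ?_⟩
    rw [mem_ballVertex_one_iff] at h1 h2 ⊢
    refine ⟨h1.1, hπ.powDvd_mono h1.2.1 (by omega), ?_, h1.2.2.2⟩
    have h3 : (a - b) * M 1 0 ∈ ringOfInt K F := by
      convert sub_mem h2.1 h1.1 using 1
      ring
    have h4 := hπ.powDvd_mul_of_mem ((hk' (-k)).2 le_rfl) h3
    rwa [inv_mul_cancel_left₀ hab] at h4

theorem convex_setOf_subset (hπ : IsUniformizer K F π) (c : GL (Fin 2) F)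
    (X : Set (Matrix (Fin 2) (Fin 2) F)) :
    (hπ.ballModel c).Convex {Λ : Vertex K F | X ⊆ Λ.1} := by
  intro a b n m ha hb
  obtain ⟨k, h1, h2, h3, h4⟩ := hπ.exists_join a b n m
  have hab : hπ.ballVertex 1 a k = hπ.ballVertex 1 b k := hπ.ballVertex_eq_iff.2 ⟨rfl, h3⟩
  have key : ∀ M ∈ X, (c⁻¹).1 * M * c.1 ∈ (hπ.ballVertex 1 a n).1 ∧
      (c⁻¹).1 * M * c.1 ∈ (hπ.ballVertex 1 b m).1 ∧
      (c⁻¹).1 * M * c.1 ∈ (hπ.ballVertex 1 a k).1 := fun M hM => by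
    have e1 := hπ.mem_ballVertex_iff.1 (ha hM)
    have e2 := hπ.mem_ballVertex_iff.1 (hb hM)
    exact ⟨e1, e2, h4 _ e1 e2⟩
  refine ⟨k, h1, h2, hπ.ballVertex_eq_iff.2 ⟨rfl, h3⟩, fun j hj hj' M hM => ?_,
    fun j hj hj' M hM => ?_⟩
  · obtain ⟨e1, -, e3⟩ := key M hM
    exact hπ.mem_ballVertex_iff.2 (hπ.mem_ballVertex_between e3 e1 hj hj')
  · obtain ⟨-, e2, e3⟩ := key M hM
    rw [hab] at e3
    exact hπ.mem_ballVertex_iff.2 (hπ.mem_ballVertex_between e3 e2 hj hj')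

theorem ballVertex_complete (hπ : IsUniformizer K F π) [TopologicalSpace K]
    [IsNonarchimedeanLocalField K] [FiniteDimensional K F] (b : GL (Fin 2) F) (c : ℕ → F) (n : ℤ)
    (h : ∀ k : ℕ, (hπ.ballModel b).ball (c (k + 1)) (n + k) =
      (hπ.ballModel b).ball (c k) (n + k)) :
    ∃ x, ∀ k : ℕ, (hπ.ballModel b).ball x (n + k) = (hπ.ballModel b).ball (c k) (n + k) := by
  obtain ⟨x, hx⟩ := hπ.exists_limit c n fun k => (hπ.ballVertex_eq_iff.1 (h k)).2
  exact ⟨x, fun k => hπ.ballVertex_eq_iff.2 ⟨rfl, hx k⟩⟩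

end IsUniformizer

end Lattices

/-! ### Extensions of fields -/

section Extension

variable {K : Type u} [Field K] [ValuativeRel K] {F : Type v} [Field F] [Algebra K F]
  {F' : Type w} [Field F'] [Algebra K F'] {π : F} {π' : F'}

namespace IsUniformizer

/-- Here `e` is the order of `ι π`, so orders of elements `ι x` are multiples of `e`. Divisibility
by `π' ^ j` is therefore constant for `j` in a window of length `e`. -/
theorem exists_ramification (hπ : IsUniformizer K F π) (hπ' : IsUniformizer K F' π')
    (ι : F →+* F') (hι : ∀ x, ι x ∈ ringOfInt K F' ↔ x ∈ ringOfInt K F) :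
    ∃ e : ℕ, 0 < e ∧ (∃ u : F', u ∈ ringOfInt K F' ∧ u⁻¹ ∈ ringOfInt K F' ∧ u ≠ 0 ∧
      ι π = π' ^ e * u) ∧ ∀ (x : F) (j n : ℤ), e * (n - 1) < j → j ≤ e * n →
        (PowDvd (K := K) π' j (ι x) ↔ PowDvd (K := K) π n x) := by
  have hne : ι π ≠ 0 := (map_ne_zero ι).2 hπ.ne_zero
  obtain ⟨m, u, hu, hu', hu0, hm⟩ := hπ'.exists_eq hne
  have hm0 : 0 < m := by
    by_contra! h
    apply hπ.inv_notMem
    rw [← hι, map_inv₀, hm, mul_inv, ← zpow_neg]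
    exact mul_mem (hπ'.zpow_mem_iff.2 (by omega)) hu'
  lift m to ℕ using hm0.le
  refine ⟨m, by exact_mod_cast hm0, ⟨u, hu, hu', hu0, by rw [hm, zpow_natCast]⟩,
    fun x j n h1 h2 => ?_⟩
  rcases eq_or_ne x 0 with rfl | hx
  · rw [map_zero]
    exact ⟨fun _ => PowDvd.zero, fun _ => PowDvd.zero⟩
  obtain ⟨k, t, ht, ht', ht0, rfl⟩ := hπ.exists_eq hx
  have e1 : ι (π ^ k * t) = π' ^ ((m : ℤ) * k) * (u ^ k * ι t) := by
    rw [map_mul, map_zpow₀, hm, mul_zpow, zpow_mul]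
    ring
  have hv : u ^ k * ι t ∈ ringOfInt K F' := mul_mem (zpow_mem_of_inv_mem hu hu' k) ((hι t).2 ht)
  have hv' : (u ^ k * ι t)⁻¹ ∈ ringOfInt K F' := by
    rw [mul_inv, ← zpow_neg, ← map_inv₀]
    exact mul_mem (zpow_mem_of_inv_mem hu hu' _) ((hι _).2 ht')
  rw [e1, hπ'.powDvd_iff_le hv hv' (mul_ne_zero (zpow_ne_zero _ hu0) ((map_ne_zero ι).2 ht0)),
    hπ.powDvd_iff_le ht ht' ht0]
  constructor
  · intro h
    by_contra! hk
    nlinarith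
  · intro h
    nlinarith

/-- An automorphism preserves integrality, so the previous result applies to it with the same
uniformizer on both sides. Were `e` greater than `1`, the exponents `1` and `2` would share a
window, and evaluating at `τ.symm π` would make `π` divisible by `π ^ 2`. -/
theorem powDvd_algEquiv_iff (hπ : IsUniformizer K F π) (τ : F ≃ₐ[K] F) {x : F} {n : ℤ} :
    PowDvd (K := K) π n (τ x) ↔ PowDvd (K := K) π n x := by
  have hτ : ∀ x, (τ : F →+* F) x ∈ ringOfInt K F ↔ x ∈ ringOfInt K F := fun x =>
    isIntegral_algHom_iff (τ.toAlgHom.restrictScalars 𝒪[K]) τ.injective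
  obtain ⟨e, he, -, h⟩ := hπ.exists_ramification hπ τ hτ
  have he1 : e = 1 := by
    by_contra hne
    have hy := h (τ.symm π) 1 1 (by simp) (by simp; omega)
    have hy' := h (τ.symm π) 2 1 (by simp) (by simp; omega)
    rw [← hy] at hy'
    have e0 : (τ : F →+* F) (τ.symm π) = π := τ.apply_symm_apply π
    have key : ∀ m, PowDvd (K := K) π m π ↔ m ≤ 1 := fun m => by
      simpa using hπ.powDvd_iff_le (m := m) (n := 1) (one_mem _)
        (by rw [inv_one]; exact one_mem _) one_ne_zero
    rw [e0, key, key] at hy'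
    omega
  subst he1
  exact h x n n (by simp) (by simp)

end IsUniformizer

theorem algebraMap_mem_ringOfInt_iff [Algebra F F'] [IsScalarTower K F F'] (x : F) :
    algebraMap F F' x ∈ ringOfInt K F' ↔ x ∈ ringOfInt K F :=
  isIntegral_algHom_iff ((IsScalarTower.toAlgHom K F F').restrictScalars 𝒪[K])
    (algebraMap F F').injective

theorem mem_maxIdeal_pow_iff [TopologicalSpace K] [IsNonarchimedeanLocalField K]
    [FiniteDimensional K F] [Algebra.IsSeparable K F] (hπ : IsUniformizer K F π)
    (x : ringOfInt K F) (n : ℕ) : x ∈ maxIdeal K F ^ n ↔ PowDvd (K := K) π n (x : F) := by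
  have := isDiscreteValuationRing_ringOfInt K F
  have hirr : Irreducible (⟨π, hπ.mem⟩ : ringOfInt K F) :=
    (hπ.irreducible_iff _).2 ⟨1, one_mem _, by simp [one_mem], one_ne_zero, by simp⟩
  rw [maxIdeal, IsLocalRing.jacobson_eq_maximalIdeal ⊥ bot_ne_top, hirr.maximalIdeal_eq,
    Ideal.span_singleton_pow, Ideal.mem_span_singleton]
  constructor
  · rintro ⟨y, rfl⟩
    change π ^ (-(n : ℤ)) * (π ^ n * (y : F)) ∈ ringOfInt K F
    rw [← mul_assoc, ← zpow_natCast, ← zpow_add₀ hπ.ne_zero, neg_add_cancel, zpow_zero, one_mul]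
    exact y.2
  · intro h
    refine ⟨⟨_, h⟩, Subtype.ext ?_⟩
    change (x : F) = π ^ n * (π ^ (-(n : ℤ)) * x)
    rw [← mul_assoc, ← zpow_natCast, ← zpow_add₀ hπ.ne_zero, add_neg_cancel, zpow_zero, one_mul]

theorem ramIdx_eq [TopologicalSpace K] [IsNonarchimedeanLocalField K]
    [FiniteDimensional K F] [Algebra.IsSeparable K F] [FiniteDimensional K F']
    [Algebra.IsSeparable K F'] [Algebra F F'] [IsScalarTower K F F']
    (hπ : IsUniformizer K F π) (hπ' : IsUniformizer K F' π') {e : ℕ} (he : 0 < e)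
    (h : ∀ (x : F) (j n : ℤ), e * (n - 1) < j → j ≤ e * n →
      (PowDvd (K := K) π' j (algebraMap F F' x) ↔ PowDvd (K := K) π n x)) :
    ramIdx K F F' = e := by
  have hset : {n : ℕ | ∀ x ∈ maxIdeal K F, ∀ y : ringOfInt K F',
      (y : F') = algebraMap F F' (x : F) → y ∈ maxIdeal K F' ^ n} = Set.Iic e := by
    ext n
    rw [Set.mem_ofPred_eq, Set.mem_Iic]
    constructor
    · intro hn
      have h1 : (⟨π, hπ.mem⟩ : ringOfInt K F) ∈ maxIdeal K F := by
        rw [← pow_one (maxIdeal K F), mem_maxIdeal_pow_iff hπ]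
        simp [PowDvd, hπ.ne_zero, one_mem]
      have h2 := hn _ h1 ⟨algebraMap F F' π, (algebraMap_mem_ringOfInt_iff π).2 hπ.mem⟩ rfl
      rw [mem_maxIdeal_pow_iff hπ'] at h2
      by_contra! hlt
      -- The exponent `e + 1` lies in the window of `n = 2`, so a larger power would make `π`
      -- divisible by its square.
      have h3 := (h π (e + 1) 2 (by push_cast; linarith) (by
        have : (1 : ℤ) ≤ e := by exact_mod_cast he
        linarith)).1 (hπ'.powDvd_mono h2 (by exact_mod_cast hlt))
      rw [PowDvd] at h3
      apply hπ.inv_notMem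
      convert h3 using 1
      rw [← zpow_add_one₀ hπ.ne_zero, ← zpow_neg_one]
      rfl
    · intro hn x hx y hy
      rw [← pow_one (maxIdeal K F), mem_maxIdeal_pow_iff hπ] at hx
      rw [mem_maxIdeal_pow_iff hπ', hy]
      have := (h x e 1 (by simpa using he) (by simp)).2 (by exact_mod_cast hx)
      exact hπ'.powDvd_mono this (by exact_mod_cast hn)
  rw [ramIdx, hset, csSup_Iic]

variable [Algebra F F']

/-- The integers `k` and `l` are `j / e` rounded up and down. The lower left condition carries `-j`,
which turns rounding up into rounding down. -/
theorem map_mem_ballVertex_one_iff (hπ' : IsUniformizer K F' π') {e : ℕ}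
    (h : ∀ (x : F) (j n : ℤ), e * (n - 1) < j → j ≤ e * n →
      (PowDvd (K := K) π' j (algebraMap F F' x) ↔ PowDvd (K := K) π n x))
    {a : F} {j k l : ℤ} (hk : e * (k - 1) < j) (hk' : j ≤ e * k) (hl : e * l ≤ j)
    (hl' : j < e * (l + 1)) {M : Matrix (Fin 2) (Fin 2) F} :
    M.map (algebraMap F F') ∈ (hπ'.ballVertex 1 (algebraMap F F' a) j).1 ↔
      M 0 0 - a * M 1 0 ∈ ringOfInt K F ∧
      PowDvd (K := K) π k (M 0 1 + (M 0 0 - M 1 1) * a - M 1 0 * a ^ 2) ∧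
      PowDvd (K := K) π (-l) (M 1 0) ∧ M 1 0 * a + M 1 1 ∈ ringOfInt K F := by
  have he : 0 < e := by
    rcases Nat.eq_zero_or_pos e with rfl | he
    · simp at hk hk'; omega
    · exact he
  have h0 : ∀ x, algebraMap F F' x ∈ ringOfInt K F' ↔ x ∈ ringOfInt K F := fun x => by
    rw [← powDvd_zero_iff (π := π'), ← powDvd_zero_iff (π := π)]
    exact h x 0 0 (by simpa using he) (by simp)
  rw [hπ'.mem_ballVertex_one_iff, ← h _ j k hk hk', ← h _ (-j) (-l) (by linarith) (by linarith),
    ← h0, ← h0]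
  simp only [Matrix.map_apply, map_sub, map_add, map_mul, map_pow]

end Extension

/-! ### Automorphisms of the matrix algebra. -/

section SkolemNoether

/-- Every automorphism of the algebra of two by two matrices is inner. -/
theorem exists_conj_of_algHom {F : Type v} [Field F]
    (φ : Matrix (Fin 2) (Fin 2) F →ₐ[F] Matrix (Fin 2) (Fin 2) F) :
    ∃ c : GL (Fin 2) F, ∀ M, φ M = (c⁻¹).1 * M * c.1 := by
  have hinj : Function.Injective φ := φ.toRingHom.injective
  have hbij : Function.Bijective φ :=
    ⟨hinj, LinearMap.surjective_of_injective (f := φ.toLinearMap) hinj⟩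
  let ψ := AlgEquiv.ofBijective φ hbij
  let ε : Matrix (Fin 2) (Fin 2) F ≃ₐ[F] Module.End F (Fin 2 → F) := Matrix.toLinAlgEquiv'
  obtain ⟨T, hT⟩ := ((ε.symm.trans ψ).trans ε).eq_linearEquivConjAlgEquiv
  let c : Matrix (Fin 2) (Fin 2) F := ε.symm T.symm.toLinearMap
  let c' : Matrix (Fin 2) (Fin 2) F := ε.symm T.toLinearMap
  have hcc : c * c' = 1 := by
    rw [← map_mul, ← map_one ε.symm]
    congr 1
    ext v
    simp
  refine ⟨⟨c, c', hcc, mul_eq_one_comm.1 hcc⟩, fun M => ?_⟩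
  change φ M = c' * M * c
  apply ε.injective
  have h := congrArg (fun F => F (ε M)) hT
  simp only [AlgEquiv.trans_apply, AlgEquiv.symm_apply_apply] at h
  rw [map_mul, map_mul]
  change ε (φ M) = _ at h
  rw [h, AlgEquiv.apply_symm_apply, AlgEquiv.apply_symm_apply, LinearEquiv.conjAlgEquiv_apply]
  rfl

end SkolemNoether

/-! ### The twisted Galois action in adapted coordinates. -/

section Twisted

variable {K : Type u} [Field K] {L : Type v} [Field L] [Algebra K L]
  {A : Type w} [Ring A] [Algebra K A]

/-- The two trivializations of the algebra over `L` differ by an inner automorphism. -/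
theorem exists_conj (f : L ⊗[K] A ≃ₐ[L] Matrix (Fin 2) (Fin 2) L) (E : IntermediateField K L)
    (g : E ⊗[K] A ≃ₐ[E] Matrix (Fin 2) (Fin 2) E) :
    ∃ c : GL (Fin 2) L, ∀ y, f (inclusionMap A E y) =
      c.1 * (g y).map (algebraMap E L) * (c⁻¹).1 := by
  let γ : A →ₐ[K] Matrix (Fin 2) (Fin 2) L :=
    ((IsScalarTower.toAlgHom K E L).mapMatrix.comp (g.toAlgHom.restrictScalars K)).comp
      Algebra.TensorProduct.includeRight
  -- This is the extension of `g` to `L`; composed with the inverse of `f` it is an endomorphism of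
  -- `M₂(L)`, hence inner.
  let ψ : L ⊗[K] A →ₐ[L] Matrix (Fin 2) (Fin 2) L :=
    Algebra.TensorProduct.lift (Algebra.ofId L _) γ fun x y => Algebra.commutes x (γ y)
  have hψ : ∀ y, ψ (inclusionMap A E y) = (g y).map (algebraMap E L) := by
    intro y
    induction y using TensorProduct.induction_on with
    | zero => rw [map_zero, map_zero, map_zero, Matrix.map_zero _ (map_zero _)]
    | tmul e a =>
      have h1 : ψ (inclusionMap A E (e ⊗ₜ a)) = algebraMap L _ (e : L) * γ a :=
        Algebra.TensorProduct.lift_tmul ..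
      have h2 : γ a = (g (1 ⊗ₜ a)).map (algebraMap E L) := rfl
      have h3 : (e ⊗ₜ[K] a : E ⊗[K] A) = e • (1 ⊗ₜ[K] a) := by
        rw [TensorProduct.smul_tmul', smul_eq_mul, mul_one]
      rw [h1, h2, h3, map_smul, ← Algebra.smul_def]
      ext i j
      simp only [Matrix.smul_apply, Matrix.map_apply, smul_eq_mul, map_mul]
      rfl
    | add x y hx hy =>
      rw [map_add, map_add, hx, hy, map_add, Matrix.map_add _ (map_add _)]
  obtain ⟨c, hc⟩ := exists_conj_of_algHom (ψ.comp f.symm.toAlgHom)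
  refine ⟨c, fun y => ?_⟩
  have h := hc (f (inclusionMap A E y))
  change ψ (f.symm (f (inclusionMap A E y))) = _ at h
  rw [AlgEquiv.symm_apply_apply, hψ] at h
  rw [h]
  simp [mul_assoc]

theorem galAlgebra_inclusionMap {E : IntermediateField K L} {τ : L ≃ₐ[K] L}
    (hτ : τ ∈ E.fixingSubgroup) (y : E ⊗[K] A) :
    galAlgebra A τ (inclusionMap A E y) = inclusionMap A E y := by
  induction y using TensorProduct.induction_on with
  | zero => simp
  | tmul e a =>
    have : τ (e : L) = e := (IntermediateField.mem_fixingSubgroup_iff E τ).1 hτ _ e.2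
    simp [galAlgebra, inclusionMap, this]
  | add x y hx hy => rw [map_add, map_add, hx, hy]

theorem matrix_induction {E : IntermediateField K L} {p : Matrix (Fin 2) (Fin 2) L → Prop}
    (hadd : ∀ M N, p M → p N → p (M + N))
    (hsmul : ∀ (c : L) (M : Matrix (Fin 2) (Fin 2) E), p (c • M.map (algebraMap E L)))
    (N : Matrix (Fin 2) (Fin 2) L) : p N := by
  have e : N = (N 0 0 • (Matrix.single 0 0 (1 : E)).map (algebraMap E L) +
      N 0 1 • (Matrix.single 0 1 (1 : E)).map (algebraMap E L)) +
      (N 1 0 • (Matrix.single 1 0 (1 : E)).map (algebraMap E L) +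
      N 1 1 • (Matrix.single 1 1 (1 : E)).map (algebraMap E L)) := by
    ext i j
    fin_cases i <;> fin_cases j <;> simp
  rw [e]
  exact hadd _ _ (hadd _ _ (hsmul _ _) (hsmul _ _)) (hadd _ _ (hsmul _ _) (hsmul _ _))

/-- The twisted action on matrices is the Galois action on `L ⊗ A` transported through `f`: the
cocycle is built to give this. -/
theorem cocycle_galMatrix (f : L ⊗[K] A ≃ₐ[L] Matrix (Fin 2) (Fin 2) L) (τ : L ≃ₐ[K] L)
    (N : Matrix (Fin 2) (Fin 2) L) :
    cocycle f τ (galMatrix τ N) = f (galAlgebra A τ (f.symm N)) := by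
  have h1 : galTriv f τ (galAlgebra A τ (f.symm N)) = galMatrix τ N := by
    change galMatrix τ (f (galAlgebra A τ.symm (galAlgebra A τ (f.symm N)))) = _
    have h2 : galAlgebra A τ.symm (galAlgebra A τ (f.symm N)) = f.symm N :=
      (galAlgebra A τ).symm_apply_apply _
    rw [h2, AlgEquiv.apply_symm_apply]
  rw [← h1, cocycle, AlgEquiv.trans_apply, AlgEquiv.symm_apply_apply]

/-- Both sides are `τ`-semilinear, so it suffices to compare them on matrices over `E`, which span.
These correspond to elements of `E ⊗ A`, fixed by `Gal(L/E)`. -/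
theorem cocycle_galMatrix_conj (f : L ⊗[K] A ≃ₐ[L] Matrix (Fin 2) (Fin 2) L)
    {E : IntermediateField K L} (g : E ⊗[K] A ≃ₐ[E] Matrix (Fin 2) (Fin 2) E) {c : GL (Fin 2) L}
    (hc : ∀ y, f (inclusionMap A E y) = c.1 * (g y).map (algebraMap E L) * (c⁻¹).1)
    {τ : L ≃ₐ[K] L} (hτ : τ ∈ E.fixingSubgroup) (N : Matrix (Fin 2) (Fin 2) L) :
    cocycle f τ (galMatrix τ (c.1 * N * (c⁻¹).1)) = c.1 * galMatrix τ N * (c⁻¹).1 := by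
  rw [cocycle_galMatrix]
  induction N using matrix_induction (E := E) with
  | hadd M N hM hN => simp only [mul_add, add_mul, map_add, hM, hN]
  | hsmul l M =>
    have h1 : c.1 * (l • M.map (algebraMap E L)) * (c⁻¹).1 =
        l • f (inclusionMap A E (g.symm M)) := by
      rw [hc, AlgEquiv.apply_symm_apply, mul_smul_comm, smul_mul_assoc]
    have h2 : galMatrix τ (l • M.map (algebraMap E L)) = τ l • M.map (algebraMap E L) := by
      rw [galMatrix_smul]
      congr 1
      ext i j
      exact (IntermediateField.mem_fixingSubgroup_iff E τ).1 hτ _ (M i j).2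
    rw [h1, h2, map_smul, AlgEquiv.symm_apply_apply, galAlgebra_smul, galAlgebra_inclusionMap hτ,
      map_smul, hc, AlgEquiv.apply_symm_apply, mul_smul_comm, smul_mul_assoc]

variable [ValuativeRel K]

/-- In the coordinates `c` the action is entrywise and preserves orders of divisibility, so the four
membership conditions are carried from `a` to `τ a`. Only one inclusion is computed; maximality
gives equality. -/
theorem twistedAct_ballVertex {π : L} (hπ : IsUniformizer K L π)
    (f : L ⊗[K] A ≃ₐ[L] Matrix (Fin 2) (Fin 2) L)
    {E : IntermediateField K L} (g : E ⊗[K] A ≃ₐ[E] Matrix (Fin 2) (Fin 2) E) {c : GL (Fin 2) L}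
    (hc : ∀ y, f (inclusionMap A E y) = c.1 * (g y).map (algebraMap E L) * (c⁻¹).1)
    {τ : L ≃ₐ[K] L} (hτ : τ ∈ E.fixingSubgroup) (a : L) (n : ℤ) :
    twistedAct f τ (hπ.ballVertex c a n) = hπ.ballVertex c (τ a) n := by
  have hle : (twistedAct f τ (hπ.ballVertex c a n)).1 ≤ (hπ.ballVertex c (τ a) n).1 := by
    rintro _ ⟨_, ⟨M, hM, rfl⟩, rfl⟩
    have hM' := hπ.mem_ballVertex_iff.1 hM
    set N := (c⁻¹).1 * M * c.1
    have hMN : M = c.1 * N * (c⁻¹).1 := by simp [N, mul_assoc]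
    change cocycle f τ (galMatrix τ M) ∈ _
    rw [hMN, cocycle_galMatrix_conj f g hc hτ, hπ.mem_ballVertex_iff]
    have e : (c⁻¹).1 * (c.1 * galMatrix τ N * (c⁻¹).1) * c.1 = galMatrix τ N := by
      simp [mul_assoc]
    rw [e]
    rw [hπ.mem_ballVertex_one_iff] at hM' ⊢
    rw [← powDvd_zero_iff (π := π), ← powDvd_zero_iff (π := π)] at hM' ⊢
    have hent : ∀ i j, galMatrix τ N i j = τ (N i j) := fun i j => rfl
    simp only [hent, ← map_mul, ← map_sub, ← map_add, ← map_pow, hπ.powDvd_algEquiv_iff]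
    exact hM'
  have hmax := (twistedAct f τ (hπ.ballVertex c a n)).2.2 (hπ.ballVertex c (τ a) n).2.1 hle
  exact vertex_ext fun M => ⟨fun h => hle h, fun h => hmax h⟩

end Twisted

/-! ### The twisted form -/

section Main

variable {K : Type u} [Field K] [ValuativeRel K] {L : Type v} [Field L] [Algebra K L]
  {A : Type w} [Ring A] [Algebra K A]

/-! ### Orders generated over an extension, and transport of maximal orders. -/

theorem smul_mem_vertex {F : Type v} [Field F] [Algebra K F] (x : Vertex K F) {c : F}
    (hc : c ∈ ringOfInt K F) {M : Matrix (Fin 2) (Fin 2) F} (hM : M ∈ x.1) : c • M ∈ x.1 := by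
  obtain ⟨⟨s, hs⟩, -⟩ := x.2.1
  rw [← SetLike.mem_coe, hs] at hM ⊢
  exact Submodule.smul_mem _ (⟨c, hc⟩ : ringOfInt K F) hM

/-- The generators `1 ⊗ a` are closed under multiplication, so the algebra they generate is their
linear span. -/
theorem generatedOrder_coe (F : Type v) [Field F] [Algebra K F] (𝔥 : Subring A) :
    (generatedOrder (K := K) F 𝔥 : Set (F ⊗[K] A)) =
      Submodule.span (ringOfInt K F) ((fun a : A => (1 : F) ⊗ₜ[K] a) '' 𝔥) := by
  have h1 : (Submonoid.closure ((fun a : A => (1 : F) ⊗ₜ[K] a) '' 𝔥) : Set (F ⊗[K] A)) =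
      (fun a : A => (1 : F) ⊗ₜ[K] a) '' 𝔥 := by
    have : (fun a : A => (1 : F) ⊗ₜ[K] a) '' 𝔥 =
        (𝔥.toSubmonoid.map (Algebra.TensorProduct.includeRight : A →ₐ[K] F ⊗[K] A) :
          Set (F ⊗[K] A)) := rfl
    rw [this, Submonoid.closure_eq]
  have h2 := Algebra.adjoin_eq_span (ringOfInt K F) ((fun a : A => (1 : F) ⊗ₜ[K] a) '' 𝔥)
  rw [h1] at h2
  rw [← h2]
  rfl

theorem generatedOrder_fg (F : Type v) [Field F] [Algebra K F] (𝔥 : Subring A)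
    (h𝔥 : IsOrder K K 𝔥) : ∃ s : Finset (F ⊗[K] A), (generatedOrder (K := K) F 𝔥 :
      Set (F ⊗[K] A)) = Submodule.span (ringOfInt K F) (s : Set (F ⊗[K] A)) := by
  classical
  obtain ⟨⟨s, hs⟩, -⟩ := h𝔥
  refine ⟨s.image fun a => (1 : F) ⊗ₜ[K] a, ?_⟩
  rw [generatedOrder_coe, SetLike.coe_set_eq, Finset.coe_image]
  apply le_antisymm
  · rw [Submodule.span_le]
    rintro _ ⟨a, ha, rfl⟩
    rw [hs] at ha
    induction ha using Submodule.span_induction with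
    | mem a ha => exact Submodule.subset_span ⟨a, ha, rfl⟩
    | zero => simp
    | add x y _ _ hx hy =>
      beta_reduce
      rw [TensorProduct.tmul_add]
      exact add_mem hx hy
    | smul c x _ hx =>
      have hc : algebraMap K F (c : K) ∈ ringOfInt K F := (algebraMap_mem_ringOfInt_iff _).2 c.2
      have e : (1 : F) ⊗ₜ[K] (c • x) =
          (⟨_, hc⟩ : ringOfInt K F) • ((1 : F) ⊗ₜ[K] x) := by
        change (1 : F) ⊗ₜ[K] ((c : K) • x) = algebraMap K F (c : K) • ((1 : F) ⊗ₜ[K] x)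
        rw [TensorProduct.tmul_smul, algebraMap_smul]
      beta_reduce
      rw [e]
      exact Submodule.smul_mem _ _ hx
  · apply Submodule.span_mono
    apply Set.image_mono
    rw [hs]
    exact Submodule.subset_span

theorem image_generatedOrder_subset_iff (f : L ⊗[K] A ≃ₐ[L] Matrix (Fin 2) (Fin 2) L)
    (𝔥 : Subring A) (x : Vertex K L) :
    f '' (generatedOrder (K := K) L 𝔥) ⊆ x.1 ↔ ∀ a ∈ 𝔥, f (1 ⊗ₜ[K] a) ∈ x.1 := by
  rw [generatedOrder_coe]
  constructor
  · intro h a ha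
    exact h ⟨_, Submodule.subset_span ⟨a, ha, rfl⟩, rfl⟩
  · rintro h _ ⟨y, hy, rfl⟩
    rw [SetLike.mem_coe] at hy ⊢
    induction hy using Submodule.span_induction with
    | mem y hy =>
      obtain ⟨a, ha, rfl⟩ := hy
      exact h a ha
    | zero => rw [map_zero]; exact zero_mem _
    | add y z _ _ hy hz => rw [map_add]; exact add_mem hy hz
    | smul c y _ hy =>
      have : f (c • y) = (c : L) • f y := map_smul f (c : L) y
      rw [this]
      exact smul_mem_vertex x c.2 hy

theorem mem_mapAlg_iff {F : Type v} [Field F] [Algebra K F] {B : Type w} {B' : Type w'} [Ring B]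
    [Algebra F B] [Ring B'] [Algebra F B'] (g : B ≃ₐ[F] B') (Λ : MaximalOrder K F B) (b : B) :
    g b ∈ (Λ.mapAlg g).1 ↔ b ∈ Λ.1 := by
  constructor
  · rintro ⟨a, ha, h⟩
    rwa [← g.injective h]
  · exact fun h => ⟨b, h, rfl⟩

theorem eq_of_mapAlg_eq {F : Type v} [Field F] [Algebra K F] {B : Type w} {B' : Type w'} [Ring B]
    [Algebra F B] [Ring B'] [Algebra F B'] (g : B ≃ₐ[F] B') {Λ Λ' : MaximalOrder K F B}
    (h : Λ.mapAlg g = Λ'.mapAlg g) : Λ = Λ' := by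
  apply Subtype.ext
  ext b
  rw [← mem_mapAlg_iff g, ← mem_mapAlg_iff g]
  exact iff_of_eq (congrArg (fun x : MaximalOrder K F B' => g b ∈ x.1) h)

theorem exists_mapAlg_eq {F : Type v} [Field F] [Algebra K F] {B : Type w} {B' : Type w'} [Ring B]
    [Algebra F B] [Ring B'] [Algebra F B'] (g : B ≃ₐ[F] B') (Λ : MaximalOrder K F B') :
    ∃ Λ' : MaximalOrder K F B, Λ'.mapAlg g = Λ := by
  refine ⟨Λ.mapAlg g.symm, Subtype.ext ?_⟩
  ext b
  obtain ⟨a, rfl⟩ := g.surjective b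
  rw [mem_mapAlg_iff, ← mem_mapAlg_iff g.symm Λ, AlgEquiv.symm_apply_apply]

theorem generatedOrder_le_iff {F : Type v} [Field F] [Algebra K F]
    (g : F ⊗[K] A ≃ₐ[F] Matrix (Fin 2) (Fin 2) F) (𝔥 : Subring A)
    (𝔇 : MaximalOrder K F (F ⊗[K] A)) :
    generatedOrder (K := K) F 𝔥 ≤ 𝔇.1 ↔ ∀ a ∈ 𝔥, g (1 ⊗ₜ[K] a) ∈ (𝔇.mapAlg g).1 := by
  rw [← image_generatedOrder_subset_iff]
  constructor
  · rintro h _ ⟨y, hy, rfl⟩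
    exact (mem_mapAlg_iff g 𝔇 y).2 (h hy)
  · intro h y hy
    exact (mem_mapAlg_iff g 𝔇 y).1 (h ⟨y, hy, rfl⟩)

/-- The branch of an order is a subtree. -/
theorem isTree_twistedBranch {π : L} (hπ : IsUniformizer K L π)
    (f : L ⊗[K] A ≃ₐ[L] Matrix (Fin 2) (Fin 2) L) (𝔥 : Subring A) (h𝔥 : IsOrder K K 𝔥) :
    (twistedBranch f 𝔥).coe.IsTree := by
  classical
  refine (hπ.ballModel 1).isTree_induce ?_ (hπ.convex_setOf_subset 1 _)
  obtain ⟨s, hs⟩ := generatedOrder_fg L 𝔥 h𝔥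
  obtain ⟨a, n, h⟩ := hπ.exists_ballVertex_ge 1
    ((generatedOrder (K := K) L 𝔥).map (f : L ⊗[K] A →+* Matrix (Fin 2) (Fin 2) L))
    ⟨s.image f, by
      rw [Subring.coe_map, hs, Finset.coe_image]
      exact congrArg SetLike.coe (Submodule.map_span
        (f.toLinearMap.restrictScalars (ringOfInt K L)) (s : Set (L ⊗[K] A)))⟩
  exact ⟨_, fun M hM => h hM⟩

/-! ### The tree of `E` inside the twisted form, and its intersection with a branch. -/

variable {E : IntermediateField K L} {πE : E} {πL : L} {e : ℕ}

/-- The balls over `L` refine the balls over `E`. -/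
def refinement (hE : IsUniformizer K E πE) (hL : IsUniformizer K L πL) (c : GL (Fin 2) L)
    (he : 0 < e) (h : ∀ (x : E) (j n : ℤ), e * (n - 1) < j → j ≤ e * n →
      (PowDvd (K := K) πL j (algebraMap E L x) ↔ PowDvd (K := K) πE n x)) :
    Refinement (hE.ballModel 1) (hL.ballModel c) e where
  ι := algebraMap E L
  pos := he
  ball_iff := by
    intro a b j n h1 h2
    rw [IsUniformizer.ball_ballModel, IsUniformizer.ball_ballModel, IsUniformizer.ball_ballModel,
      IsUniformizer.ball_ballModel, hL.ballVertex_eq_iff, hE.ballVertex_eq_iff, ← map_sub,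
      h _ j n h1 h2]
    simp

/-- Elements of `Gal(L/E)` move centers and keep radii, so they fix infinity and every center in
`E`. Conversely an invariant finite limit has a fixed center, which lies in `E` by Galois theory. -/
theorem isLeast_limitSubtrees [TopologicalSpace K] [IsNonarchimedeanLocalField K]
    [FiniteDimensional K L] [IsGalois K L]
    (f : L ⊗[K] A ≃ₐ[L] Matrix (Fin 2) (Fin 2) L)
    (g : E ⊗[K] A ≃ₐ[E] Matrix (Fin 2) (Fin 2) E) {c : GL (Fin 2) L}
    (hc : ∀ y, f (inclusionMap A E y) = c.1 * (g y).map (algebraMap E L) * (c⁻¹).1)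
    (hE : IsUniformizer K E πE) (hL : IsUniformizer K L πL)
    (he : 0 < e) (h : ∀ (x : E) (j n : ℤ), e * (n - 1) < j → j ≤ e * n →
      (PowDvd (K := K) πL j (algebraMap E L x) ↔ PowDvd (K := K) πE n x)) :
    IsLeast (limitSubtrees f E)
      ((⊤ : (bruhatTits K L).Subgraph).induce (refinement hE hL c he h).image) := by
  have hfix : ∀ (a : E), ∀ τ ∈ E.fixingSubgroup, τ (algebraMap E L a) = algebraMap E L a :=
    fun a τ hτ => (IntermediateField.mem_fixingSubgroup_iff E τ).1 hτ _ a.2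
  have hinv : ∀ (a : E) (u : ℕ → ℤ),
      InvariantLimit f E fun k : ℕ => hL.ballVertex c (algebraMap E L a) (u k) := by
    intro a u τ hτ
    refine ⟨0, 0, fun k => ?_⟩
    beta_reduce
    rw [twistedAct_ballVertex hL f g hc hτ, hfix a τ hτ]
  refine (refinement hE hL c he h).isLeast_image (fun d n hd => hL.ballVertex_complete c d n hd)
    (InvariantLimit f E) 0 (hinv 0 _) (fun a => hinv a _) ?_
  rintro x r hr ⟨m, n, hx⟩
  have hmem : x ∈ IntermediateField.fixedField E.fixingSubgroup := by
    rw [IntermediateField.mem_fixedField_iff]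
    intro τ hτ
    obtain ⟨p, q, hpq⟩ := hr τ hτ
    rw [← sub_eq_zero]
    -- Invariance makes the balls around `τ x` and `x` coincide for arbitrarily small radii, so `τ x
    -- - x` is divisible by every power of the uniformizer.
    refine hL.eq_zero_of_forall fun k => ?_
    have h1 : r (n + (p + k)) = hL.ballVertex c x ((m + (p + k) : ℕ) : ℤ) := (hx (p + k)).symm
    have h2 : r (n + (q + k)) = hL.ballVertex c x ((m + (q + k) : ℕ) : ℤ) := (hx (q + k)).symm
    have h3 : twistedAct f τ (r (p + (n + k))) = r (q + (n + k)) := hpq (n + k)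
    rw [add_left_comm, h1, add_left_comm q, h2, twistedAct_ballVertex hL f g hc hτ] at h3
    exact hL.powDvd_mono (hL.ballVertex_eq_iff.1 h3).2 (by push_cast; omega)
  rw [IsGalois.fixedField_fixingSubgroup] at hmem
  exact ⟨⟨x, hmem⟩, rfl⟩

/-- Extending scalars turns the conjugate of `M₂(𝒪_E)` by an affine matrix over `E` into the same
conjugate of `M₂(𝒪_L)`. The powers `πE ^ n` and `πL ^ (e * n)` differ by the unit `u ^ n`, which
does not change the vertex. -/
theorem isVertexOf_ballVertex (f : L ⊗[K] A ≃ₐ[L] Matrix (Fin 2) (Fin 2) L)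
    (g : E ⊗[K] A ≃ₐ[E] Matrix (Fin 2) (Fin 2) E) {c : GL (Fin 2) L}
    (hc : ∀ y, f (inclusionMap A E y) = c.1 * (g y).map (algebraMap E L) * (c⁻¹).1)
    (hE : IsUniformizer K E πE) (hL : IsUniformizer K L πL) {e : ℕ}
    (hu : ∃ u : L, u ∈ ringOfInt K L ∧ u⁻¹ ∈ ringOfInt K L ∧ u ≠ 0 ∧
      algebraMap E L πE = πL ^ e * u) {𝔇 : MaximalOrder K E (E ⊗[K] A)} {a : E} {n : ℤ}
    (h𝔇 : 𝔇.mapAlg g = hE.ballVertex 1 a n) :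
    IsVertexOf f E 𝔇 (hL.ballVertex c (algebraMap E L a) (e * n)) := by
  obtain ⟨u, hu1, hu2, hu0, hu⟩ := hu
  let b : GL (Fin 2) L := Units.map ((algebraMap E L).mapMatrix : _ →+* Matrix (Fin 2) (Fin 2) L)
    (hE.affine a n)
  have hb : b.1 = (hE.affine a n).1.map (algebraMap E L) := rfl
  have hb' : (b⁻¹).1 = ((hE.affine a n)⁻¹).1.map (algebraMap E L) := rfl
  have hball : hL.ballVertex c (algebraMap E L a) (e * n) =
      translate (c * b) (baseVertex K L) := by
    rw [IsUniformizer.ballVertex, translate_mul, translate_mul]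
    congr 1
    refine (translate_baseVertex_eq one_ne_zero (k := !![u ^ n, 0; 0, 1])
      (k' := !![u ^ (-n), 0; 0, 1])
      (fin_two_mem_integralMatrices (IsUniformizer.zpow_mem_of_inv_mem hu1 hu2 n) (zero_mem _)
        (zero_mem _) (one_mem _))
      (fin_two_mem_integralMatrices (IsUniformizer.zpow_mem_of_inv_mem hu1 hu2 _) (zero_mem _)
        (zero_mem _) (one_mem _)) ?_ ?_).symm
    · have := zpow_ne_zero n hu0
      simp [Matrix.one_fin_two, this]
    · rw [one_smul, hb, IsUniformizer.coe_affine, IsUniformizer.coe_affine]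
      have e1 : algebraMap E L (πE ^ n) = πL ^ ((e : ℤ) * n) * u ^ n := by
        rw [map_zpow₀, hu, mul_zpow, zpow_mul, zpow_natCast]
      ext i j
      fin_cases i <;> fin_cases j <;> simp [-map_zpow₀, e1]
  have hmem : ∀ N : Matrix (Fin 2) (Fin 2) E, N ∈ integralMatrices K E →
      g.symm ((hE.affine a n).1 * N * ((hE.affine a n)⁻¹).1) ∈ 𝔇.1 := by
    intro N hN
    rw [← mem_mapAlg_iff g, AlgEquiv.apply_symm_apply, h𝔇, IsUniformizer.ballVertex, one_mul,
      mem_translate_iff]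
    have e1 : ((hE.affine a n)⁻¹).1 * ((hE.affine a n).1 * N * ((hE.affine a n)⁻¹).1) *
        (hE.affine a n).1 = N := by simp [mul_assoc]
    rw [e1]
    exact hN
  rw [IsVertexOf, hball]
  apply Set.Subset.antisymm
  · intro M hM
    have hN := mem_translate_iff.1 hM
    set N := ((c * b)⁻¹).1 * M * (c * b).1
    have hMN : M = (c * b).1 * N * ((c * b)⁻¹).1 := by simp [N, mul_assoc]
    have hsum : N = ∑ i, ∑ j, N i j • (Matrix.single i j (1 : E)).map (algebraMap E L) := by
      ext i j
      fin_cases i <;> fin_cases j <;> simp [Fin.sum_univ_two]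
    have hsingle : ∀ i j, Matrix.single i j (1 : E) ∈ integralMatrices K E := by
      intro i j k l
      rw [Matrix.single_apply]
      split_ifs
      exacts [one_mem _, zero_mem _]
    refine ⟨∑ i, ∑ j, N i j • inclusionMap A E (g.symm ((hE.affine a n).1 *
      Matrix.single i j (1 : E) * ((hE.affine a n)⁻¹).1)), ?_, ?_⟩
    · refine sum_mem fun i _ => sum_mem fun j _ => ?_
      exact Submodule.smul_mem _ (⟨N i j, hN i j⟩ : ringOfInt K L)
        (Submodule.subset_span ⟨_, hmem _ (hsingle i j), rfl⟩)
    · rw [hMN]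
      conv_rhs => rw [hsum]
      rw [map_sum, Finset.mul_sum, Finset.sum_mul]
      refine Finset.sum_congr rfl fun i _ => ?_
      rw [map_sum, Finset.mul_sum, Finset.sum_mul]
      refine Finset.sum_congr rfl fun j _ => ?_
      rw [map_smul, hc, AlgEquiv.apply_symm_apply, mul_smul_comm, smul_mul_assoc, mul_inv_rev,
        Units.val_mul, Units.val_mul, hb, hb', Matrix.map_mul, Matrix.map_mul]
      simp only [mul_assoc]
  · rintro _ ⟨y, hy, rfl⟩
    rw [SetLike.mem_coe] at hy ⊢
    induction hy using Submodule.span_induction with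
    | mem y hy =>
      obtain ⟨y, hy, rfl⟩ := hy
      rw [SetLike.mem_coe, ← mem_mapAlg_iff g, h𝔇, IsUniformizer.ballVertex, one_mul,
        mem_translate_iff] at hy
      rw [hc, mem_translate_iff, mul_inv_rev, Units.val_mul, Units.val_mul, hb, hb']
      have e1 : (((hE.affine a n)⁻¹).1.map (algebraMap E L) * (c⁻¹).1) *
          (c.1 * (g y).map (algebraMap E L) * (c⁻¹).1) *
          (c.1 * (hE.affine a n).1.map (algebraMap E L)) =
          (((hE.affine a n)⁻¹).1 * g y * (hE.affine a n).1).map (algebraMap E L) := by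
        rw [Matrix.map_mul, Matrix.map_mul]
        simp [mul_assoc]
      rw [e1]
      intro i j
      rw [Matrix.map_apply]
      exact (algebraMap_mem_ringOfInt_iff _).2 (hy i j)
    | zero => rw [map_zero]; exact zero_mem _
    | add y z _ _ hy hz => rw [map_add]; exact add_mem hy hz
    | smul c y _ hy =>
      have : f (c • y) = (c : L) • f y := map_smul f (c : L) y
      rw [this]
      exact smul_mem_vertex _ c.2 hy

theorem apply_tmul_mem_ballVertex_iff (f : L ⊗[K] A ≃ₐ[L] Matrix (Fin 2) (Fin 2) L)
    (g : E ⊗[K] A ≃ₐ[E] Matrix (Fin 2) (Fin 2) E) {c : GL (Fin 2) L}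
    (hc : ∀ y, f (inclusionMap A E y) = c.1 * (g y).map (algebraMap E L) * (c⁻¹).1)
    (hL : IsUniformizer K L πL) (x : A) (a : L) (j : ℤ) :
    f (1 ⊗ₜ[K] x) ∈ (hL.ballVertex c a j).1 ↔
      (g (1 ⊗ₜ[K] x)).map (algebraMap E L) ∈ (hL.ballVertex 1 a j).1 := by
  have e0 : inclusionMap A E (1 ⊗ₜ[K] x) = 1 ⊗ₜ[K] x := by simp [inclusionMap]
  have e1 : f (1 ⊗ₜ[K] x) = c.1 * (g (1 ⊗ₜ[K] x)).map (algebraMap E L) * (c⁻¹).1 := by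
    rw [← hc, e0]
  have e2 : (c⁻¹).1 * (c.1 * (g (1 ⊗ₜ[K] x)).map (algebraMap E L) * (c⁻¹).1) * c.1 =
      (g (1 ⊗ₜ[K] x)).map (algebraMap E L) := by
    simp [mul_assoc]
  rw [hL.mem_ballVertex_iff, e1, e2]

theorem subset_ballVertex_iff (f : L ⊗[K] A ≃ₐ[L] Matrix (Fin 2) (Fin 2) L)
    (g : E ⊗[K] A ≃ₐ[E] Matrix (Fin 2) (Fin 2) E) {c : GL (Fin 2) L}
    (hc : ∀ y, f (inclusionMap A E y) = c.1 * (g y).map (algebraMap E L) * (c⁻¹).1)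
    (hL : IsUniformizer K L πL) (𝔥 : Subring A) (a : L) (j : ℤ) :
    hL.ballVertex c a j ∈ {Λ : Vertex K L | f '' (generatedOrder (K := K) L 𝔥) ⊆ Λ.1} ↔
      ∀ x ∈ 𝔥, (g (1 ⊗ₜ[K] x)).map (algebraMap E L) ∈ (hL.ballVertex 1 a j).1 :=
  (image_generatedOrder_subset_iff f 𝔥 _).trans
    (forall₂_congr fun x _ => apply_tmul_mem_ballVertex_iff f g hc hL x a j)

/-- The branch of an order meets the tree of `E` in a subgraph. -/
theorem exists_subgraph_inter_branch (f : L ⊗[K] A ≃ₐ[L] Matrix (Fin 2) (Fin 2) L)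
    (g : E ⊗[K] A ≃ₐ[E] Matrix (Fin 2) (Fin 2) E) {c : GL (Fin 2) L}
    (hc : ∀ y, f (inclusionMap A E y) = c.1 * (g y).map (algebraMap E L) * (c⁻¹).1)
    (hE : IsUniformizer K E πE) (hL : IsUniformizer K L πL)
    (he : 0 < e) (h : ∀ (x : E) (j n : ℤ), e * (n - 1) < j → j ≤ e * n →
      (PowDvd (K := K) πL j (algebraMap E L x) ↔ PowDvd (K := K) πE n x)) (𝔥 : Subring A) :
    ∃ S : (bruhatTits K E).Subgraph, (refinement hE hL c he h).map '' subspaceOf S =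
      subspaceOf (twistedBranch f 𝔥) ∩ subspaceOf
        ((⊤ : (bruhatTits K L).Subgraph).induce (refinement hE hL c he h).image) := by
  have he' : (0 : ℤ) < e := by exact_mod_cast he
  refine (refinement hE hL c he h).image_subspaceOf_induce (hL.convex_setOf_subset c _) ?_ ?_
  · intro a n j h1 h2 hj
    refine (subset_ballVertex_iff f g hc hL 𝔥 _ _).2 fun x hx => ?_
    have hxj := (subset_ballVertex_iff f g hc hL 𝔥 _ _).1 hj x hx
    have hxj' := hL.mem_ballVertex_one_iff.1 hxj
    refine hL.mem_ballVertex_one_iff.2 ⟨hxj'.1, hL.powDvd_mono hxj'.2.1 h1, ?_, hxj'.2.2.2⟩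
    have h3 := hxj'.2.2.1
    rw [Matrix.map_apply] at h3 ⊢
    -- The lower left entry comes from `E`, so its condition at `-j` is the one at `-e * n`. The
    -- upper right condition only weakens when the ball grows.
    rw [h _ (-j) (-n) (by linarith) (by linarith)] at h3
    exact (h _ (-(e * n)) (-n) (by linarith) (by linarith)).2 h3
  · intro a n j h1 h2 hj
    refine (subset_ballVertex_iff f g hc hL 𝔥 _ _).2 fun x hx => ?_
    have hxj := (subset_ballVertex_iff f g hc hL 𝔥 _ _).1 hj x hx
    have h4 := hL.mem_ballVertex_one_iff.1 hxj
    refine hL.mem_ballVertex_one_iff.2 ⟨h4.1, ?_, hL.powDvd_mono h4.2.2.1 (by linarith), h4.2.2.2⟩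
    have h3 := h4.2.1
    change PowDvd πL _ (_ + _ * algebraMap E L a - _ * algebraMap E L a ^ 2) at h3
    change PowDvd πL _ (_ + _ * algebraMap E L a - _ * algebraMap E L a ^ 2)
    simp only [Matrix.map_apply, ← map_sub, ← map_add, ← map_mul, ← map_pow] at h3 ⊢
    -- Here the roles are exchanged: the upper right expression comes from `E`, so its condition at
    -- `j` already holds at `e * n`, and the lower left one weakens.
    exact (h _ _ n (by linarith) le_rfl).2 ((h _ j n h1 h2).1 h3)

/-- The maximal orders over `E` containing an order correspond to the vertices of the tree of `E`
that lie in the branch. -/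
theorem bijOn_branch (f : L ⊗[K] A ≃ₐ[L] Matrix (Fin 2) (Fin 2) L)
    (g : E ⊗[K] A ≃ₐ[E] Matrix (Fin 2) (Fin 2) E) {c : GL (Fin 2) L}
    (hc : ∀ y, f (inclusionMap A E y) = c.1 * (g y).map (algebraMap E L) * (c⁻¹).1)
    (hE : IsUniformizer K E πE) (hL : IsUniformizer K L πL)
    (he : 0 < e) (h : ∀ (x : E) (j n : ℤ), e * (n - 1) < j → j ≤ e * n →
      (PowDvd (K := K) πL j (algebraMap E L x) ↔ PowDvd (K := K) πE n x)) (𝔥 : Subring A) :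
    Set.BijOn (fun 𝔇 : MaximalOrder K E (E ⊗[K] A) =>
        (refinement hE hL c he h).map (pt (bruhatTits K E) (𝔇.mapAlg g)))
      {𝔇 | generatedOrder (K := K) E 𝔥 ≤ 𝔇.1}
      (Set.range (fun x => (refinement hE hL c he h).map (pt (bruhatTits K E) x)) ∩
        subspaceOf (twistedBranch f 𝔥)) := by
  have he' : (0 : ℤ) < e := by exact_mod_cast he
  have hpt : ∀ (a : L) (n : ℤ), pt (bruhatTits K L) (hL.ballVertex c a n) ∈
      subspaceOf (twistedBranch f 𝔥) ↔ hL.ballVertex c a n ∈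
        {Λ : Vertex K L | f '' (generatedOrder (K := K) L 𝔥) ⊆ Λ.1} := by
    intro a n
    rw [← hL.ball_ballModel, ← (hL.ballModel c).line_intCast, twistedBranch, branch,
      (hL.ballModel c).line_mem_subspaceOf_induce, Int.floor_intCast, Int.ceil_intCast, and_self]
  -- At the height `e * n` both roundings are exact, so membership over `L` is literally membership
  -- over `E`, tested on the generators `1 ⊗ a`.
  have key : ∀ 𝔇 : MaximalOrder K E (E ⊗[K] A),
      (refinement hE hL c he h).map (pt (bruhatTits K E) (𝔇.mapAlg g)) ∈
        subspaceOf (twistedBranch f 𝔥) ↔ generatedOrder (K := K) E 𝔥 ≤ 𝔇.1 := by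
    intro 𝔇
    obtain ⟨a, n, hx⟩ := hE.exists_ballVertex_eq 1 (𝔇.mapAlg g)
    have hR : (refinement hE hL c he h).map (pt _ (hE.ballVertex 1 a n)) =
      pt _ (hL.ballVertex c (algebraMap E L a) (e * n)) := (refinement hE hL c he h).map_pt a n
    rw [generatedOrder_le_iff g, hx, hR, hpt, subset_ballVertex_iff f g hc hL]
    refine forall₂_congr fun x _ => ?_
    rw [hE.mem_ballVertex_one_iff]
    exact map_mem_ballVertex_one_iff hL h (by linarith) le_rfl le_rfl (by linarith)
  refine ⟨fun 𝔇 h𝔇 => ⟨⟨_, rfl⟩, (key 𝔇).2 h𝔇⟩, fun 𝔇 _ 𝔇' _ heq => ?_, ?_⟩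
  · have h1 : pt (bruhatTits K E) (𝔇.mapAlg g) = pt (bruhatTits K E) (𝔇'.mapAlg g) :=
      (refinement hE hL c he h).map_injective heq
    exact eq_of_mapAlg_eq g ((hE.ballModel 1).pt_injective h1)
  · rintro _ ⟨⟨x, rfl⟩, hx⟩
    obtain ⟨𝔇, rfl⟩ := exists_mapAlg_eq (B := E ⊗[K] A) g x
    exact ⟨𝔇, (key 𝔇).1 hx, rfl⟩

end Main

end TwistedTree

end

/-! ### The theorem. -/

open TwistedTree
theorem theorem1 {K : Type u} [Field K] [ValuativeRel K] [TopologicalSpace K]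
    [IsNonarchimedeanLocalField K]
    {L : Type v} [Field L] [Algebra K L] [FiniteDimensional K L] [IsGalois K L]
    {A : Type w} [DivisionRing A] [Algebra K A] [Algebra.IsCentral K A]
    (hA : Module.finrank K A = 4)
    (f : L ⊗[K] A ≃ₐ[L] Matrix (Fin 2) (Fin 2) L) :
    -- the branch of an order is a subtree
    (∀ 𝔥 : Subring A, IsOrder K K 𝔥 → (twistedBranch f 𝔥).coe.IsTree) ∧
    -- for every splitting intermediate field `E`, with a trivialization `g` of `A_E`
    ∀ (E : IntermediateField K L) (g : E ⊗[K] A ≃ₐ[E] Matrix (Fin 2) (Fin 2) E),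
      IsLeast (limitSubtrees f E) (twistedTree f E) ∧
      (∀ E' : IntermediateField K L, E ≤ E' →
        subspaceOf (twistedTree f E) ⊆ subspaceOf (twistedTree f E')) ∧
      ∃ h : Space (bruhatTits K E) → Space (bruhatTits K L),
        -- `h` is the natural homeomorphism of the tree of `E` with the subspace attached to `E`
        Topology.IsEmbedding h ∧
        Set.range h = subspaceOf (twistedTree f E) ∧
        (∀ 𝔇 : MaximalOrder K E (E ⊗[K] A), ∃ x : Vertex K L, IsVertexOf f E 𝔇 x ∧
          h (pt (bruhatTits K E) (𝔇.mapAlg g)) = pt (bruhatTits K L) x) ∧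
        IsSimplicialOnSubdivision (bruhatTits K E) (bruhatTits K L) (ramIdx K E L) h ∧
        -- intersection with the branch of an order
        ∀ 𝔥 : Subring A, IsOrder K K 𝔥 →
          Set.BijOn
            (fun 𝔇 : MaximalOrder K E (E ⊗[K] A) => h (pt (bruhatTits K E) (𝔇.mapAlg g)))
            {𝔇 | generatedOrder (K := K) E 𝔥 ≤ 𝔇.1}
            (Set.range (fun x => h (pt (bruhatTits K E) x)) ∩ subspaceOf (twistedBranch f 𝔥)) ∧
          ∃ S : (bruhatTits K E).Subgraph,
            h '' subspaceOf S =
              subspaceOf (twistedBranch f 𝔥) ∩ subspaceOf (twistedTree f E) := by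
  obtain ⟨πL, hL⟩ := exists_isUniformizer (K := K) (F := L)
  refine ⟨fun 𝔥 h𝔥 => isTree_twistedBranch hL f 𝔥 h𝔥, fun E g => ?_⟩
  obtain ⟨πE, hE⟩ := exists_isUniformizer (K := K) (F := E)
  have hint : ∀ x : E, algebraMap E L x ∈ ringOfInt K L ↔ x ∈ ringOfInt K E := fun x =>
    algebraMap_mem_ringOfInt_iff x
  obtain ⟨e, he, hu, h⟩ := hE.exists_ramification hL (algebraMap E L) hint
  obtain ⟨c, hc⟩ := exists_conj f E g
  have hleast := isLeast_limitSubtrees f g hc hE hL he h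
  -- The infimum in the definition of `twistedTree` is attained, which identifies it with the union
  -- of the lines with center in `E`.
  have htree : twistedTree f E = _ := le_antisymm (sInf_le hleast.1) (le_sInf hleast.2)
  have hmono : ∀ E' : IntermediateField K L, E ≤ E' → twistedTree f E ≤ twistedTree f E' := by
    intro E' hEE'
    -- A limit invariant under `Gal(L/E)` is invariant under the smaller group `Gal(L/E')`, so every
    -- subtree competing for `E'` also competes for `E`.
    refine sInf_le_sInf fun S hS => ⟨hS.1, fun r hr hI => hS.2 r hr fun τ hτ => hI τ ?_⟩
    exact IntermediateField.fixingSubgroup_antitone hEE' hτ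
  refine ⟨by rw [htree]; exact hleast, ?_, ?_⟩
  · rintro E' hEE' x (⟨a, ha, hx⟩ | ⟨d, t, hd, hx⟩)
    · exact Or.inl ⟨a, (hmono E' hEE').1 ha, hx⟩
    · exact Or.inr ⟨d, t, (hmono E' hEE').2 hd, hx⟩
  set R := refinement hE hL c he h
  have hRpt : ∀ (a : E) (n : ℤ), R.map (pt _ (hE.ballVertex 1 a n)) =
      pt _ (hL.ballVertex c (algebraMap E L a) (e * n)) := R.map_pt
  refine ⟨R.map, R.isEmbedding_map, by rw [R.range_map, htree], ?_, ?_, ?_⟩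
  · intro 𝔇
    obtain ⟨a, n, hx⟩ := hE.exists_ballVertex_eq 1 (𝔇.mapAlg g)
    exact ⟨_, isVertexOf_ballVertex f g hc hE hL hu hx, by rw [hx, hRpt]⟩
  · rw [ramIdx_eq hE hL he h]
    exact R.isSimplicial
  · intro 𝔥 _
    refine ⟨bijOn_branch f g hc hE hL he h 𝔥, ?_⟩
    rw [htree]
    exact exists_subgraph_inter_branch f g hc hE hL he h 𝔥
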